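/- Let $N\ge 1$ and let $\mu$ be a Borel probability measure on $\mathbb R^N$ with a density with respect to Lebesgue measure, $d\mu=\mu(x)\,dx$ with $0\le\mu\in L^1(\mathbb R^N)$, such that (H1) holds: $\mu\in H^1_{\rm loc}(\mathbb R^N)$, $\frac{\nabla\mu}{\mu}\in L^r_{\rm loc}(\mathbb R^N,\mathbb R^N)$ for some $r>N$, and $\inf_K\mu>0$ (essential infimum) for every compact $K\subset\mathbb R^N$. Write $L^2_\mu=L^2(\mathbb R^N,d\mu)$, with real or complex scalars. Let $(L,D(L))$ be the closure in $L^2_\mu$ of the operator $f\mapsto \Delta f+\frac{\nabla\mu}{\mu}\cdot\nabla f$ defined on $C_c^\infty(\mathbb R^N)$, and let $(A,D(A))$ be the operator in $L^2_\mu$ associated with the form $a_L(u,v)=\int_{\mathbb R^N} Lu\,\overline{Lv}\,d\mu$, $u,v\in D(L)$; that is, $u\in D(A)$ and $Au=h$ if and only if $u\in D(L)$, $h\in L^2_\mu$ and $a_L(u,v)=\int h\,\overline v\,d\mu$ for all $v\in D(L)$. For a Borel probability measure $\nu$ on $\mathbb R^N$ and a $C_0$-semigroup $(S(t))_{t\ge0}$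 of bounded linear operators on $L^2_\nu$, the measure $\nu$ is called invariant for $S$ if $\int S(t)f\,d\nu=\int f\,d\nu$ for all $f\in C_b(\mathbb R^N)$ and $t\ge0$. Then $-A$ is the generator of a unique $C_0$-semigroup $(e^{-tA})_{t\ge0}$ on $L^2_\mu$, and the following hold. 1. $\mu$ is an invariant measure for $(e^{-tA})_{t\ge0}$. 2. $0$ is an eigenvalue of $A$, and $\ker A=\{f\in D(A): Af=0\}$ consists exactly of the ($\mu$-a.e.) constant functions. 3. $\mu$ is ergodic with respect to $(e^{-tA})_{t\ge0}$: for every $f\in L^2_\mu$, $$\lim_{t\to+\infty}\frac1t\int_0^te^{-sA}f\,ds=\int_{\mathbb R^N}f\,d\mu\quad\text{in }L^2_\mu .$$ 4. $\mu$ is the unique invariant measure for $(e^{-tA})_{t\ge0}$: let $\nu$ be a Borel probability measure on which $e^{-tA}$ acts as a $C_0$-semigroup, i.e. there is a $C_0$-semigroup $(S(t))_{t\ge0}$ of bounded linear operators on $L^2_\nu$ such that, for all $f\in C_b(\mathbb R^N)$ and $t\ge0$, every function in the class $e^{-tA}f$ (a class of functions modulo $\mu$-null sets) belongs to the class $S(t)f$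 (modulo $\nu$-null sets; in particular $\nu\ll\mu$). If $\nu$ is invariant for $S$, then $\nu=\mu$. -/

import Mathlib

open MeasureTheory Filter Topology
open scoped ContDiff BoundedContinuousFunction NNReal ENNReal

namespace BiKolmogorov

/-! ### Test functions, weak gradients, the standing assumptions on the density -/

/-- `f` is a test function: smooth with compact support. -/
def IsTestFunction {N : ℕ} {𝕜 : Type*} [RCLike 𝕜] (f : EuclideanSpace ℝ (Fin N) → 𝕜) : Prop :=
  ContDiff ℝ ∞ f ∧ HasCompactSupport f

/-- `G` is the weak (distributional) gradient of the locally integrable function `m` on `ℝ^N`: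
`∫ m ∂ᵢφ dx = - ∫ φ Gᵢ dx` for all real test functions `φ` and all `i`. -/
structure HasWeakGradient {N : ℕ} (m : EuclideanSpace ℝ (Fin N) → ℝ)
    (G : EuclideanSpace ℝ (Fin N) → EuclideanSpace ℝ (Fin N)) : Prop where
  locallyIntegrable : LocallyIntegrable m
  locallyIntegrable_grad : LocallyIntegrable G
  integral_eq : ∀ φ : EuclideanSpace ℝ (Fin N) → ℝ, IsTestFunction φ → ∀ i : Fin N,
    ∫ x, m x * fderiv ℝ φ x (EuclideanSpace.single i 1) = - ∫ x, φ x * G x i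

/-- `f ∈ L^p_loc(ℝ^N)`. -/
def IsLpLoc {N : ℕ} {F : Type*} [NormedAddCommGroup F] (p : ℝ≥0∞)
    (f : EuclideanSpace ℝ (Fin N) → F) : Prop :=
  ∀ K : Set (EuclideanSpace ℝ (Fin N)), IsCompact K → MemLp f p (volume.restrict K)

/-- The logarithmic gradient `∇m / m`, where `G` is the weak gradient of `m`. -/
noncomputable def logGrad {N : ℕ} (m : EuclideanSpace ℝ (Fin N) → ℝ)
    (G : EuclideanSpace ℝ (Fin N) → EuclideanSpace ℝ (Fin N)) :
    EuclideanSpace ℝ (Fin N) → EuclideanSpace ℝ (Fin N) :=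
  fun x => (m x)⁻¹ • G x

/-- Hypothesis (H1) on a density `m` with weak gradient `G = ∇m`:
`m ∈ H¹_loc`, `∇m / m ∈ L^r_loc` for some `r > N`, and `m` is (essentially) bounded below by a
positive constant on every compact set. -/
structure HypothesisH1 {N : ℕ} (m : EuclideanSpace ℝ (Fin N) → ℝ)
    (G : EuclideanSpace ℝ (Fin N) → EuclideanSpace ℝ (Fin N)) : Prop where
  hasWeakGradient : HasWeakGradient m G
  memL2Loc : IsLpLoc 2 m
  memL2Loc_grad : IsLpLoc 2 G
  memLrLoc_logGrad : ∃ r : ℝ, (N : ℝ) < r ∧ IsLpLoc (ENNReal.ofReal r) (logGrad m G)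
  pos_on_compacts : ∀ K : Set (EuclideanSpace ℝ (Fin N)), IsCompact K →
    ∃ c : ℝ, 0 < c ∧ ∀ᵐ x ∂(volume.restrict K), c ≤ m x

/-! ### The Kolmogorov operator `L` and the bi-Kolmogorov operator `A` -/

/-- The differential expression `Δ f + (∇m / m) · ∇ f`. -/
noncomputable def kolmogorovExpr {N : ℕ} {𝕜 : Type*} [RCLike 𝕜]
    (m : EuclideanSpace ℝ (Fin N) → ℝ) (G : EuclideanSpace ℝ (Fin N) → EuclideanSpace ℝ (Fin N))
    (f : EuclideanSpace ℝ (Fin N) → 𝕜) (x : EuclideanSpace ℝ (Fin N)) : 𝕜 :=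
  Laplacian.laplacian f x + fderiv ℝ f x (logGrad m G x)

/-- The graph in `L²_μ × L²_μ` of `L` acting on test functions. -/
noncomputable def kolmogorovGraph {N : ℕ} (𝕜 : Type*) [RCLike 𝕜]
    (μ : Measure (EuclideanSpace ℝ (Fin N)))
    (m : EuclideanSpace ℝ (Fin N) → ℝ) (G : EuclideanSpace ℝ (Fin N) → EuclideanSpace ℝ (Fin N)) :
    Submodule 𝕜 (Lp 𝕜 2 μ × Lp 𝕜 2 μ) where
  carrier := {p | ∃ f : EuclideanSpace ℝ (Fin N) → 𝕜, IsTestFunction f ∧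
    p.1 =ᵐ[μ] f ∧ p.2 =ᵐ[μ] kolmogorovExpr m G f}
  zero_mem' := by
    refine ⟨0, ⟨contDiff_const, HasCompactSupport.zero⟩, Lp.coeFn_zero _ _ _, ?_⟩
    refine (Lp.coeFn_zero _ _ _).trans (Eventually.of_forall fun x => ?_)
    have h : Laplacian.laplacian (0 : EuclideanSpace ℝ (Fin N) → 𝕜) x = 0 := by
      have := InnerProductSpace.laplacian_const (E := EuclideanSpace ℝ (Fin N)) (c := (0 : 𝕜))
      exact congrFun this x
    simp [kolmogorovExpr, h]
  add_mem' := by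
    rintro ⟨a, b⟩ ⟨c, d⟩ ⟨f, hf, ha, hb⟩ ⟨g, hg, hc, hd⟩
    refine ⟨f + g, ⟨hf.1.add hg.1, hf.2.add hg.2⟩, ?_, ?_⟩
    · exact (Lp.coeFn_add a c).trans (ha.add hc)
    · refine (Lp.coeFn_add b d).trans ((hb.add hd).trans (Eventually.of_forall fun x => ?_))
      have h2 : (2 : WithTop ℕ∞) ≤ ((⊤ : ℕ∞) : WithTop ℕ∞) := WithTop.coe_le_coe.2 le_top
      have hL := ((hf.1.of_le h2).contDiffAt (x := x)).laplacian_add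
        ((hg.1.of_le h2).contDiffAt (x := x))
      have hD := fderiv_add (x := x) ((hf.1.differentiable (by simp)) x)
        ((hg.1.differentiable (by simp)) x)
      simp only [kolmogorovExpr, Pi.add_apply, hL, hD, _root_.add_apply]
      ring
  smul_mem' := by
    rintro k ⟨a, b⟩ ⟨f, hf, ha, hb⟩
    refine ⟨k • f, ⟨hf.1.const_smul k, hf.2.smul_left (f := fun _ => k)⟩, ?_, ?_⟩
    · exact (Lp.coeFn_smul k a).trans (ha.const_smul k)
    · refine (Lp.coeFn_smul k b).trans ((hb.const_smul k).trans
        (Eventually.of_forall fun x => ?_))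
      have h2 : (2 : WithTop ℕ∞) ≤ ((⊤ : ℕ∞) : WithTop ℕ∞) := WithTop.coe_le_coe.2 le_top
      have hL : Laplacian.laplacian (k • f) x = k • Laplacian.laplacian f x := by
        have h := ((hf.1.of_le h2).contDiffAt (x := x)).laplacian_CLM_comp_left
          (l := (ContinuousLinearMap.mul ℝ 𝕜 k))
        exact h
      have hD := fderiv_const_smul (x := x) ((hf.1.differentiable (by simp)) x) k
      simp only [kolmogorovExpr, Pi.smul_apply, hL, hD, _root_.smul_apply, smul_add]

/-- `(L, D(L))`: the closure in `L²_μ` of `L` defined on test functions. -/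
noncomputable def kolmogorov {N : ℕ} (𝕜 : Type*) [RCLike 𝕜]
    (μ : Measure (EuclideanSpace ℝ (Fin N)))
    (m : EuclideanSpace ℝ (Fin N) → ℝ) (G : EuclideanSpace ℝ (Fin N) → EuclideanSpace ℝ (Fin N)) :
    Lp 𝕜 2 μ →ₗ.[𝕜] Lp 𝕜 2 μ :=
  (kolmogorovGraph 𝕜 μ m G).toLinearPMap.closure

/-- For an operator `L` in a Hilbert space, the graph of the operator associated with the form
`a(u, v) = (L u | L v)` on `D(L)`: the pairs `(u, h)` with `u ∈ D(L)` and
`a(u, v) = (h | v)` for all `v ∈ D(L)`. (Mathlib's `inner` is conjugate linear in its first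
argument, so `(L u | L v)` reads `inner 𝕜 (L v) (L u)`.) -/
def squareFormGraph {𝕜 H : Type*} [RCLike 𝕜] [NormedAddCommGroup H] [InnerProductSpace 𝕜 H]
    (L : H →ₗ.[𝕜] H) : Submodule 𝕜 (H × H) where
  carrier := {p | ∃ u : L.domain, (u : H) = p.1 ∧
    ∀ v : L.domain, inner 𝕜 (L v) (L u) = inner 𝕜 (v : H) p.2}
  zero_mem' := ⟨0, by simp⟩
  add_mem' := by
    rintro ⟨a, b⟩ ⟨c, d⟩ ⟨u, hu, h⟩ ⟨u', hu', h'⟩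
    refine ⟨u + u', by simp_all, fun v => ?_⟩
    rw [LinearPMap.map_add, inner_add_right, h v, h' v]
    exact (inner_add_right _ _ _).symm
  smul_mem' := by
    rintro k ⟨a, b⟩ ⟨u, hu, h⟩
    refine ⟨k • u, by simp_all, fun v => ?_⟩
    rw [LinearPMap.map_smul, inner_smul_right, h v]
    exact (inner_smul_right _ _ _).symm

/-- The operator associated with the form `a(u, v) = (L u | L v)` on `D(L)`. -/
noncomputable def squareFormOperator {𝕜 H : Type*} [RCLike 𝕜] [NormedAddCommGroup H]
    [InnerProductSpace 𝕜 H] (L : H →ₗ.[𝕜] H) : H →ₗ.[𝕜] H :=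
  (squareFormGraph L).toLinearPMap

/-- The bi-Kolmogorov operator `(A, D(A))`, associated with the form
`a_L(u, v) = ∫ L u conj(L v) dμ` on `D(L)`. -/
noncomputable def biKolmogorov {N : ℕ} (𝕜 : Type*) [RCLike 𝕜]
    (μ : Measure (EuclideanSpace ℝ (Fin N)))
    (m : EuclideanSpace ℝ (Fin N) → ℝ) (G : EuclideanSpace ℝ (Fin N) → EuclideanSpace ℝ (Fin N)) :
    Lp 𝕜 2 μ →ₗ.[𝕜] Lp 𝕜 2 μ :=
  squareFormOperator (kolmogorov 𝕜 μ m G)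

/-! ### Strongly continuous semigroups and invariant measures -/

/-- A `C₀`-semigroup of bounded linear operators on `X`. -/
structure C0Semigroup (𝕜 X : Type*) [RCLike 𝕜] [NormedAddCommGroup X] [NormedSpace 𝕜 X] where
  /-- The operators of the semigroup. -/
  op : ℝ≥0 → X →L[𝕜] X
  op_zero : op 0 = ContinuousLinearMap.id 𝕜 X
  op_add : ∀ s t, op (s + t) = (op s).comp (op t)
  tendsto_zero : ∀ x, Tendsto (fun t => op t x) (𝓝 0) (𝓝 x)

/-- The graph of the generator of a `C₀`-semigroup: the pairs `(x, y)` with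
`y = lim_{t → 0+} (T(t) x - x) / t`. -/
def C0Semigroup.generatorGraph {𝕜 X : Type*} [RCLike 𝕜] [NormedAddCommGroup X]
    [NormedSpace 𝕜 X] (T : C0Semigroup 𝕜 X) : Submodule 𝕜 (X × X) where
  carrier := {p | Tendsto (fun t : ℝ≥0 => (((t : ℝ)⁻¹ : ℝ) : 𝕜) • (T.op t p.1 - p.1))
    (𝓝[>] 0) (𝓝 p.2)}
  zero_mem' := by simp
  add_mem' := by
    rintro ⟨a, b⟩ ⟨c, d⟩ h h'
    refine (Tendsto.add h h').congr fun t => ?_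
    simp only [Prod.fst_add, map_add, ← smul_add]
    congr 1
    abel
  smul_mem' := by
    rintro k ⟨a, b⟩ h
    refine (Tendsto.const_smul h k).congr fun t => ?_
    simp only [Prod.smul_fst, map_smul, ← smul_sub]
    rw [smul_comm]

/-- The generator of a `C₀`-semigroup. -/
noncomputable def C0Semigroup.generator {𝕜 X : Type*} [RCLike 𝕜] [NormedAddCommGroup X]
    [NormedSpace 𝕜 X] (T : C0Semigroup 𝕜 X) : X →ₗ.[𝕜] X :=
  T.generatorGraph.toLinearPMap

/-- The class in `L²_ν` of a bounded continuous function. -/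
noncomputable def bddContToL2 {N : ℕ} {𝕜 : Type*} [RCLike 𝕜]
    (ν : Measure (EuclideanSpace ℝ (Fin N))) [IsProbabilityMeasure ν]
    (f : EuclideanSpace ℝ (Fin N) →ᵇ 𝕜) : Lp 𝕜 2 ν :=
  BoundedContinuousFunction.toLp (E := 𝕜) 2 ν 𝕜 f

/-- The probability measure `ν` is invariant for the `C₀`-semigroup `S` on `L²_ν`:
`∫ S(t) f dν = ∫ f dν` for all `f ∈ C_b(ℝ^N)` and `t ≥ 0`. -/
def IsInvariantMeasure {N : ℕ} {𝕜 : Type*} [RCLike 𝕜]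
    (ν : Measure (EuclideanSpace ℝ (Fin N))) [IsProbabilityMeasure ν]
    (S : C0Semigroup 𝕜 (Lp 𝕜 2 ν)) : Prop :=
  ∀ (f : EuclideanSpace ℝ (Fin N) →ᵇ 𝕜) (t : ℝ≥0),
    ∫ x, S.op t (bddContToL2 ν f) x ∂ν = ∫ x, f x ∂ν

/-- The `C₀`-semigroup `S` on `L²_ν` is the semigroup `T` of `L²_μ`, acting on `L²_ν`: for
`f ∈ C_b(ℝ^N)` (a dense subspace of both spaces) `T(t) f` and `S(t) f` are the same function.
As `T(t) f` is a class of functions modulo `μ`-null sets, this says that every function `g` which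
represents `T(t) f` represents `S(t) f`, i.e. that `T(t) f` is well defined as an element of `L²_ν`
and is equal to `S(t) f` there. -/
def ActsAs {N : ℕ} {𝕜 : Type*} [RCLike 𝕜]
    (μ : Measure (EuclideanSpace ℝ (Fin N))) [IsProbabilityMeasure μ]
    (T : C0Semigroup 𝕜 (Lp 𝕜 2 μ))
    (ν : Measure (EuclideanSpace ℝ (Fin N))) [IsProbabilityMeasure ν]
    (S : C0Semigroup 𝕜 (Lp 𝕜 2 ν)) : Prop :=
  ∀ (f : EuclideanSpace ℝ (Fin N) →ᵇ 𝕜) (t : ℝ≥0) (g : EuclideanSpace ℝ (Fin N) → 𝕜),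
    g =ᵐ[μ] T.op t (bddContToL2 μ f) → g =ᵐ[ν] S.op t (bddContToL2 ν f)

end BiKolmogorov

set_option linter.unusedSectionVars false

namespace BiKolmogorov

/-! ### Orbits of strongly continuous semigroups and their generators -/

section Orbits

variable {𝕜 X : Type*} [RCLike 𝕜] [NormedAddCommGroup X] [NormedSpace 𝕜 X] [CompleteSpace X]

/-! Everything rests on the essential self-adjointness of L on test functions. Integration by parts
makes L symmetric and nonpositive there, so its closure is self-adjoint as soon as (1 - L)C_c^∞ is
dense in L²_μ (`IsNonposSymmetricGraph.topologicalClosure`), that is, as soon as every v in L²_μ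
with ∫ (f - Lf) v dμ = 0 for all test functions f vanishes
(`HypothesisH1.eq_zero_of_weak_resolvent`). If v is locally in H¹, testing the equation with φ²v
gives ∫ φ²v² dμ ≤ ∫ |∇φ|²v² dμ, and cutoffs φ with decaying gradients force v = 0.

The hard point is thus local H¹ regularity of v with a drift that is only in L^r. Since ∇ log m is
locally in L^q for some q > N, a Morrey estimate for log m shows that m is locally bounded
(`HypothesisH1.exists_ae_le`). The density can then be replaced, outside a ball, by one with bounds
c ≤ M ≤ C on the whole space (`HypothesisH1.exists_extension`). Its drift b = ∇M/M is form bounded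
with bound 0, because |b|² lies in a Morrey class; so b·∇ is a small perturbation of λ - Δ for large
λ, and very weak L² solutions of λw - Δw + div(bw) = 0 vanish (`IsFormBounded.exists_eq_zero`). The
Riesz theorem produces an H¹ solution of the equation satisfied by a cutoff times v, and this
uniqueness identifies the two (`HypothesisH1.exists_tendsto_testFunction`).

Once L is self-adjoint, the operator of the form (Lu | Lv) is L². It is densely defined and maximal
accretive, so a Hille–Yosida argument with Yosida approximations gives the semigroup, and
dissipativity gives its uniqueness. The kernel of L² is that of L; Lu = 0 forces ∇u = 0, and
constants lie in the kernel because ∫ Lf dμ = 0 for test functions. Invariance of μ says that the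
pairing with the constant 1 is preserved, and ergodicity is the mean ergodic theorem, as the vectors
orthogonal to the kernel are limits of vectors in the range of A.

For the uniqueness of ν the semigroup itself is of little use, as it need not preserve positivity or
bounded functions. The resolvent J = (1 - L)⁻¹ does preserve bounds (`HypothesisH1.ae_le_of_mem`),
and LJ = J - 1 gives A J^(n+2) f = (J - 1)² J^n f. For bounded f all these functions are bounded,
hence meaningful in L²_ν, and invariance of ν says that their ν-integral is 0. So the sequence ∫ J^n
f dν has zero second differences and is bounded, hence constant. The Cesàro means of J^n f tend to ∫
f dμ in L²_μ, along a subsequence μ-a.e. and therefore ν-a.e.; dominated convergence gives ∫ f dν =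
∫ f dμ (`HypothesisH1.integral_eq_of_invariant`). -/

theorem C0Semigroup.exists_norm_le_near_zero (T : C0Semigroup 𝕜 X) :
    ∃ δ : ℝ≥0, 0 < δ ∧ ∃ M : ℝ, 1 ≤ M ∧ ∀ t ≤ δ, ‖T.op t‖ ≤ M := by
  -- Otherwise there are times t n ≤ 1/(n+1) with norms above n + 1, although every orbit converges
  -- along t n: this contradicts uniform boundedness.
  by_contra! hcon
  have hpos : ∀ n : ℕ, (0 : ℝ≥0) < 1 / ((n : ℝ≥0) + 1) := fun n => by positivity
  have h1 : ∀ n : ℕ, ∃ t : ℝ≥0, t ≤ 1 / ((n : ℝ≥0) + 1) ∧ ((n : ℝ) + 1) < ‖T.op t‖ := fun n =>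
    hcon _ (hpos n) _ (by linarith [Nat.cast_nonneg (α := ℝ) n])
  choose t ht hM using h1
  have ht0 : Tendsto t atTop (𝓝 0) :=
    tendsto_of_tendsto_of_tendsto_of_le_of_le tendsto_const_nhds
      tendsto_one_div_add_atTop_nhds_zero_nat (fun _ => bot_le) ht
  obtain ⟨C, hC⟩ := banach_steinhaus (g := fun n => T.op (t n)) fun x => by
    obtain ⟨C, hC⟩ := ((T.tendsto_zero x).comp ht0).norm.bddAbove_range
    exact ⟨C, fun n => hC ⟨n, rfl⟩⟩
  obtain ⟨n, hn⟩ := exists_nat_gt C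
  linarith [hC n, hM n]

theorem C0Semigroup.op_add_apply (T : C0Semigroup 𝕜 X) (s t : ℝ≥0) (x : X) :
    T.op (s + t) x = T.op s (T.op t x) := by
  rw [T.op_add]; rfl

theorem C0Semigroup.op_zero_apply (T : C0Semigroup 𝕜 X) (x : X) : T.op 0 x = x := by
  rw [T.op_zero]; rfl

theorem C0Semigroup.op_comm (T : C0Semigroup 𝕜 X) (s t : ℝ≥0) (x : X) :
    T.op s (T.op t x) = T.op t (T.op s x) := by
  rw [← T.op_add_apply, add_comm, T.op_add_apply]

theorem C0Semigroup.exists_norm_le (T : C0Semigroup 𝕜 X) (a : ℝ≥0) :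
    ∃ M : ℝ, 1 ≤ M ∧ ∀ t ≤ a, ‖T.op t‖ ≤ M := by
  obtain ⟨δ, hδ, M, hM, hb⟩ := T.exists_norm_le_near_zero
  -- Splitting off one time step δ costs one factor M.
  have key : ∀ n : ℕ, ∀ t ≤ n * δ, ‖T.op t‖ ≤ M ^ (n + 1) := by
    intro n
    induction n with
    | zero => intro t ht; simpa using hb t (le_trans ht (by simp))
    | succ n ih =>
      intro t ht
      rcases le_total t δ with h | h
      · exact (hb t h).trans (by simpa using pow_le_pow_right₀ hM (show 1 ≤ n + 1 + 1 by omega))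
      · have h1 : t = δ + (t - δ) := (add_tsub_cancel_of_le h).symm
        have h2 : t - δ ≤ n * δ := by
          rw [tsub_le_iff_right]; calc t ≤ _ := ht
            _ = _ := by push_cast; ring
        rw [h1, T.op_add]
        calc _ ≤ ‖T.op δ‖ * ‖T.op (t - δ)‖ := ContinuousLinearMap.opNorm_comp_le _ _
          _ ≤ M * M ^ (n + 1) := mul_le_mul (hb _ le_rfl) (ih _ h2) (norm_nonneg _) (by linarith)
          _ = _ := by ring
  obtain ⟨n, hn⟩ := exists_nat_ge (a / δ)
  refine ⟨M ^ (n + 1), one_le_pow₀ hM, fun t ht => key n t (ht.trans ?_)⟩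
  rwa [div_le_iff₀ hδ] at hn

/-- Left and right continuity at once: with a = min s t and b = max s t, T(b)x - T(a)x = T(a)(T(b -
a)x - x), and T(a) is bounded for s near t. -/
theorem C0Semigroup.continuous_orbit (T : C0Semigroup 𝕜 X) (x : X) :
    Continuous fun t => T.op t x := by
  refine continuous_iff_continuousAt.2 fun t => ?_
  obtain ⟨M, hM, hb⟩ := T.exists_norm_le (t + 1)
  have hz : Tendsto (fun s : ℝ≥0 => M * ‖T.op (max s t - min s t) x - x‖) (𝓝 t) (𝓝 0) := by
    have h1 : Tendsto (fun s : ℝ≥0 => max s t - min s t) (𝓝 t) (𝓝 0) := by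
      have : Continuous fun s : ℝ≥0 => max s t - min s t := by fun_prop
      simpa using this.tendsto t
    have := (((T.tendsto_zero x).comp h1).sub_const x).norm.const_mul M
    simpa using this
  refine tendsto_iff_norm_sub_tendsto_zero.2 (squeeze_zero' (Eventually.of_forall fun _ =>
    norm_nonneg _) ?_ hz)
  filter_upwards [Iio_mem_nhds (show t < t + 1 by simp)] with s hs
  have hmin : ‖T.op (min s t)‖ ≤ M := hb _ ((min_le_right _ _).trans (by simp))
  have hle : ∀ y, ‖T.op (min s t) y‖ ≤ M * ‖y‖ := fun y =>
    (ContinuousLinearMap.le_opNorm _ y).trans (by gcongr)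
  have hmax : T.op (max s t) x - T.op (min s t) x
      = T.op (min s t) (T.op (max s t - min s t) x - x) := by
    rw [map_sub, ← T.op_add_apply, add_tsub_cancel_of_le min_le_max]
  have := hle (T.op (max s t - min s t) x - x)
  rw [← hmax] at this
  rcases le_total s t with h | h
  · simp only [h, max_eq_right, min_eq_left] at this ⊢
    rwa [norm_sub_rev]
  · simpa only [h, max_eq_left, min_eq_right] using this

theorem C0Semigroup.op_mem_generatorGraph (T : C0Semigroup 𝕜 X) {x y : X}
    (h : (x, y) ∈ T.generatorGraph) (t : ℝ≥0) : (T.op t x, T.op t y) ∈ T.generatorGraph := by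
  have h' : Tendsto (fun s : ℝ≥0 => (((s : ℝ)⁻¹ : ℝ) : 𝕜) • (T.op s x - x)) (𝓝[>] 0) (𝓝 y) := h
  refine (((T.op t).continuous.tendsto y).comp h').congr fun s => ?_
  simp only [Function.comp, map_smul, map_sub, T.op_comm t s]

theorem C0Semigroup.generatorGraph_unique (T : C0Semigroup 𝕜 X) {x y z : X}
    (h : (x, y) ∈ T.generatorGraph) (h' : (x, z) ∈ T.generatorGraph) : y = z :=
  tendsto_nhds_unique (f := fun s : ℝ≥0 => (((s : ℝ)⁻¹ : ℝ) : 𝕜) • (T.op s x - x))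
    (l := 𝓝[>] 0) h h'

/-- `toLinearPMap` is faithful only for single-valued graphs; here that is uniqueness of limits. -/
theorem C0Semigroup.generator_graph (T : C0Semigroup 𝕜 X) :
    T.generator.graph = T.generatorGraph := by
  refine Submodule.toLinearPMap_graph_eq _ ?_
  rintro ⟨x, y⟩ h rfl
  exact T.generatorGraph_unique h (T.generatorGraph.zero_mem)

variable [NormedSpace ℝ X] [IsScalarTower ℝ 𝕜 X]

/-- Only the right derivative comes straight from the definition of the generator. It suffices both
for the fundamental theorem of calculus and for the differential inequality below. -/
theorem C0Semigroup.hasDerivWithinAt_orbit (T : C0Semigroup 𝕜 X) {x y : X}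
    (h : (x, y) ∈ T.generatorGraph) {t : ℝ} (ht : 0 ≤ t) :
    HasDerivWithinAt (fun s : ℝ => T.op s.toNNReal x) (T.op t.toNNReal y) (Set.Ici t) t := by
  rw [hasDerivWithinAt_iff_tendsto_slope, Set.Ici_sdiff_left]
  have h' : Tendsto (fun s : ℝ≥0 => (((s : ℝ)⁻¹ : ℝ) : 𝕜) • (T.op s (T.op t.toNNReal x)
      - T.op t.toNNReal x)) (𝓝[>] 0) (𝓝 (T.op t.toNNReal y)) := T.op_mem_generatorGraph h _
  have hs : Tendsto (fun s : ℝ => (s - t).toNNReal) (𝓝[>] t) (𝓝[>] 0) := by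
    refine tendsto_nhdsWithin_iff.2 ⟨?_, ?_⟩
    · have : Continuous fun s : ℝ => (s - t).toNNReal := by fun_prop
      simpa using (this.tendsto t).mono_left nhdsWithin_le_nhds
    · filter_upwards [self_mem_nhdsWithin] with s hs
      simpa using hs
  refine (h'.comp hs).congr' ?_
  filter_upwards [self_mem_nhdsWithin] with s hs
  have hs' : t < s := hs
  have h2 : s.toNNReal = (s - t).toNNReal + t.toNNReal := by
    rw [← Real.toNNReal_add (by linarith) ht]; simp
  simp only [Function.comp, slope, vsub_eq_sub, h2, T.op_add_apply]
  rw [Real.coe_toNNReal _ (by linarith), RCLike.real_smul_eq_coe_smul (K := 𝕜)]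

theorem C0Semigroup.continuous_orbit_real (T : C0Semigroup 𝕜 X) (x : X) :
    Continuous fun s : ℝ => T.op s.toNNReal x :=
  (T.continuous_orbit x).comp continuous_real_toNNReal

theorem C0Semigroup.integral_orbit (T : C0Semigroup 𝕜 X) {x y : X}
    (h : (x, y) ∈ T.generatorGraph) {t : ℝ} (ht : 0 ≤ t) :
    ∫ s in (0 : ℝ)..t, T.op s.toNNReal y = T.op t.toNNReal x - x := by
  have := intervalIntegral.integral_eq_sub_of_hasDeriv_right
    (f := fun s : ℝ => T.op s.toNNReal x) (f' := fun s : ℝ => T.op s.toNNReal y) (a := 0) (b := t)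
    (T.continuous_orbit_real x).continuousOn (fun s hs => ?_)
    ((T.continuous_orbit_real y).intervalIntegrable _ _)
  · simpa [T.op_zero_apply] using this
  · have hs0 : 0 < s := by simpa [ht] using hs.1
    exact (T.hasDerivWithinAt_orbit h hs0.le).mono Set.Ioi_subset_Ici_self

end Orbits

/-! ### Dissipativity: contractivity and uniqueness of semigroups -/

section Contraction

variable {𝕜 H : Type*} [RCLike 𝕜] [NormedAddCommGroup H] [InnerProductSpace 𝕜 H]
  [NormedSpace ℝ H]

/-- The derivative of ‖u‖² is 2 Re (u | u') ≤ 0. The same inequality gives contractivity, uniqueness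
of the semigroup with a given generator, and the bounds on exponentials of dissipative operators. -/
theorem norm_le_of_re_inner_deriv_nonpos {u u' : ℝ → H} {t : ℝ} (ht : 0 ≤ t)
    (hu : Continuous u) (hd : ∀ s, 0 ≤ s → HasDerivWithinAt u (u' s) (Set.Ici s) s)
    (hre : ∀ s, 0 ≤ s → RCLike.re (inner 𝕜 (u s) (u' s)) ≤ 0) : ‖u t‖ ≤ ‖u 0‖ := by
  have key : ∀ ⦃x⦄, x ∈ Set.Icc 0 t → RCLike.re (inner 𝕜 (u x) (u x)) ≤ ‖u 0‖ ^ 2 :=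
    image_le_of_deriv_right_le_deriv_boundary
      (f := fun s => RCLike.re (inner 𝕜 (u s) (u s)))
      (f' := fun s => RCLike.re (inner 𝕜 (u s) (u' s) + inner 𝕜 (u' s) (u s)))
      (B := fun _ => ‖u 0‖ ^ 2) (B' := fun _ => 0)
      (by fun_prop)
      (fun s hs => by
        have := ((hd s hs.1).inner 𝕜 (hd s hs.1)).hasFDerivWithinAt
        have h2 := (RCLike.reCLM (K := 𝕜)).hasFDerivAt.comp_hasFDerivWithinAt s this
        have h3 := h2.hasDerivWithinAt
        simpa [Function.comp_def] using h3)
      (by simp) continuousOn_const (fun s _ => hasDerivWithinAt_const ..)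
      (fun s hs => by
        have := hre s hs.1
        rw [map_add, inner_re_symm (𝕜 := 𝕜) (u' s)]; linarith)
  have := key (Set.right_mem_Icc.2 ht)
  rw [inner_self_eq_norm_sq] at this
  exact (sq_le_sq₀ (norm_nonneg _) (norm_nonneg _)).1 this

variable [CompleteSpace H] [IsScalarTower ℝ 𝕜 H]

theorem C0Semigroup.norm_op_apply_le (T : C0Semigroup 𝕜 H)
    (hdiss : ∀ p ∈ T.generatorGraph, RCLike.re (inner 𝕜 p.1 p.2) ≤ 0)
    (hdense : Dense {x | ∃ y, (x, y) ∈ T.generatorGraph}) (t : ℝ≥0) (x : H) :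
    ‖T.op t x‖ ≤ ‖x‖ := by
  refine hdense.induction (P := fun x => ‖T.op t x‖ ≤ ‖x‖) ?_
    (isClosed_le (by fun_prop) (by fun_prop)) x
  rintro x ⟨y, hxy⟩
  have := norm_le_of_re_inner_deriv_nonpos (𝕜 := 𝕜) t.2 (T.continuous_orbit_real x)
    (fun s hs => T.hasDerivWithinAt_orbit hxy hs)
    (fun s _ => hdiss _ (T.op_mem_generatorGraph hxy _))
  simpa [T.op_zero_apply] using this

/-- For x in the common domain, the difference of the two orbits solves the same dissipative
equation and starts at 0. Density and continuity extend the equality to all x. -/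
theorem C0Semigroup.ext_of_generatorGraph {T S : C0Semigroup 𝕜 H}
    (hTS : T.generatorGraph = S.generatorGraph)
    (hdiss : ∀ p ∈ T.generatorGraph, RCLike.re (inner 𝕜 p.1 p.2) ≤ 0)
    (hdense : Dense {x | ∃ y, (x, y) ∈ T.generatorGraph}) : T = S := by
  have key : ∀ t x, T.op t x = S.op t x := by
    intro t x
    refine hdense.induction (P := fun x => T.op t x = S.op t x) ?_
      (isClosed_eq (by fun_prop) (by fun_prop)) x
    rintro x ⟨y, hxy⟩
    have hxy' := hTS ▸ hxy
    have := norm_le_of_re_inner_deriv_nonpos (𝕜 := 𝕜) t.2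
      ((T.continuous_orbit_real x).sub (S.continuous_orbit_real x))
      (fun s hs => (T.hasDerivWithinAt_orbit hxy hs).sub (S.hasDerivWithinAt_orbit hxy' hs))
      (fun s _ => hdiss (_, _) (T.generatorGraph.sub_mem (T.op_mem_generatorGraph hxy s.toNNReal)
        (hTS ▸ S.op_mem_generatorGraph hxy' s.toNNReal)))
    simpa [T.op_zero_apply, S.op_zero_apply, sub_eq_zero] using this
  cases T; cases S
  congr
  ext t x
  exact key t x

end Contraction

/-! ### Generation of contraction semigroups by maximal accretive operators -/

section Exponential

variable {𝕜 H : Type*} [RCLike 𝕜] [NormedAddCommGroup H] [InnerProductSpace 𝕜 H]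
  [CompleteSpace H] [NormedSpace ℝ H] [IsScalarTower ℝ 𝕜 H]

/-- The orbit `t ↦ exp (t a) x` of the uniformly continuous semigroup generated by `a`. -/
noncomputable def expOrbit (a : H →L[𝕜] H) (t : ℝ) : H →L[𝕜] H := NormedSpace.exp ((t : 𝕜) • a)

/-- The path r ↦ e^(ra) e^((t-r)b) x joins e^(tb) x to e^(ta) x, so its derivative compares the two
exponentials. With b = 0 it gives the derivative of a single orbit. -/
theorem hasDerivAt_expOrbit_mul (a b : H →L[𝕜] H) (t s : ℝ) (x : H) :
    HasDerivAt (fun r : ℝ => expOrbit a r (expOrbit b (t - r) x))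
      (expOrbit a s ((a - b) (expOrbit b (t - s) x))) s := by
  have h1 := hasDerivAt_exp_smul_const (𝕂 := 𝕜) a (s : 𝕜)
  have h2 : HasDerivAt (fun r : 𝕜 => NormedSpace.exp (((t : 𝕜) - r) • b))
      (-(b * NormedSpace.exp (((t : 𝕜) - s) • b))) (s : 𝕜) := by
    have h3 := (hasDerivAt_exp_smul_const' (𝕂 := 𝕜) b ((t : 𝕜) - s)).scomp (s : 𝕜)
      ((hasDerivAt_id (s : 𝕜)).const_sub (t : 𝕜))
    simpa [Function.comp_def] using h3
  have h4 := (h1.mul h2).clm_apply (hasDerivAt_const (s : 𝕜) x)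
  have h5 := h4.scomp (𝕜 := ℝ) s (RCLike.ofRealCLM (K := 𝕜)).hasDerivAt
  convert h5 using 1
  · ext r; simp [expOrbit]
  · simp [expOrbit, sub_eq_add_neg]

theorem expOrbit_zero (a : H →L[𝕜] H) : expOrbit a 0 = 1 := by
  simp [expOrbit]

theorem expOrbit_zero_left (t : ℝ) : expOrbit (0 : H →L[𝕜] H) t = 1 := by
  simp [expOrbit]

theorem hasDerivAt_expOrbit (a : H →L[𝕜] H) (s : ℝ) (x : H) :
    HasDerivAt (fun r : ℝ => expOrbit a r x) (expOrbit a s (a x)) s := by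
  simpa [expOrbit_zero_left] using hasDerivAt_expOrbit_mul a 0 0 s x

theorem expOrbit_add (a : H →L[𝕜] H) (s t : ℝ) :
    expOrbit a (s + t) = (expOrbit a s).comp (expOrbit a t) := by
  let _ : NormedAlgebra ℚ (H →L[𝕜] H) := NormedAlgebra.restrictScalars ℚ 𝕜 _
  have : Commute ((s : 𝕜) • a) ((t : 𝕜) • a) :=
    ((Commute.refl a).smul_left _).smul_right _
  simp only [expOrbit]
  rw [RCLike.ofReal_add, add_smul, NormedSpace.exp_add_of_commute this]
  rfl

theorem commute_expOrbit {a b : H →L[𝕜] H} (h : Commute a b) (t : ℝ) :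
    Commute a (expOrbit b t) := by
  let _ : NormedAlgebra ℚ (H →L[𝕜] H) := NormedAlgebra.restrictScalars ℚ 𝕜 _
  exact (h.smul_right _).exp_right

theorem norm_expOrbit_apply_le {a : H →L[𝕜] H}
    (ha : ∀ x, RCLike.re (inner 𝕜 x (a x)) ≤ 0) {t : ℝ} (ht : 0 ≤ t) (x : H) :
    ‖expOrbit a t x‖ ≤ ‖x‖ := by
  have hc : ∀ s, expOrbit a s (a x) = a (expOrbit a s x) := fun s =>
    (DFunLike.congr_fun (commute_expOrbit (Commute.refl a) s) x).symm
  have := norm_le_of_re_inner_deriv_nonpos (𝕜 := 𝕜) (u := fun s => expOrbit a s x) ht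
    (continuous_iff_continuousAt.2 fun s => (hasDerivAt_expOrbit a s x).continuousAt)
    (fun s _ => (hasDerivAt_expOrbit a s x).hasDerivWithinAt)
    (fun s _ => by rw [hc]; exact ha _)
  simpa [expOrbit_zero] using this

/-- Commutation moves a - b onto x in the derivative of the interpolating path, and contractivity
removes the exponentials. The bound involves a and b only through ax - bx. -/
theorem norm_expOrbit_sub_le {a b : H →L[𝕜] H} (hab : Commute a b)
    (ha : ∀ x, RCLike.re (inner 𝕜 x (a x)) ≤ 0) (hb : ∀ x, RCLike.re (inner 𝕜 x (b x)) ≤ 0)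
    {t : ℝ} (ht : 0 ≤ t) (x : H) :
    ‖expOrbit a t x - expOrbit b t x‖ ≤ ‖a x - b x‖ * t := by
  have hc : ∀ s, (a - b) (expOrbit b s x) = expOrbit b s ((a - b) x) := fun s =>
    (DFunLike.congr_fun (commute_expOrbit (hab.sub_left (Commute.refl b)) s) x)
  have := norm_image_sub_le_of_norm_deriv_right_le_segment
    (f := fun r : ℝ => expOrbit a r (expOrbit b (t - r) x)) (a := 0) (b := t)
    (C := ‖a x - b x‖)
    (fun s _ => (hasDerivAt_expOrbit_mul a b t s x).continuousAt.continuousWithinAt)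
    (fun s _ => (hasDerivAt_expOrbit_mul a b t s x).hasDerivWithinAt)
    (fun s hs => by
      rw [hc]
      exact (norm_expOrbit_apply_le ha hs.1 _).trans
        (norm_expOrbit_apply_le hb (sub_nonneg.2 hs.2.le) _)) t (Set.right_mem_Icc.2 ht)
  simpa [expOrbit_zero] using this

/-- The error does not involve the operator norm of a, which blows up along the Yosida
approximations to which this is applied. -/
theorem norm_expOrbit_taylor_le {a : H →L[𝕜] H} {t : ℝ} (ht : 0 ≤ t) (x : H) {C : ℝ}
    (hC : ∀ s ∈ Set.Ico 0 t, ‖expOrbit a s (a x) - a x‖ ≤ C) :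
    ‖expOrbit a t x - x - t • a x‖ ≤ C * t := by
  have hd : ∀ s, HasDerivAt (fun r : ℝ => expOrbit a r x - r • a x)
      (expOrbit a s (a x) - a x) s := fun s => by
    have := (hasDerivAt_expOrbit a s x).fun_sub ((hasDerivAt_id s).smul_const (a x))
    simpa using this
  have := norm_image_sub_le_of_norm_deriv_right_le_segment
    (f := fun r : ℝ => expOrbit a r x - r • a x) (a := 0) (b := t) (C := C)
    (fun s _ => (hd s).continuousAt.continuousWithinAt)
    (fun s _ => (hd s).hasDerivWithinAt) hC t (Set.right_mem_Icc.2 ht)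
  simp only [expOrbit_zero, zero_smul, sub_zero, one_apply_eq_self] at this
  rwa [sub_right_comm]

end Exponential

/-! ### Resolvents and Yosida approximations of maximal accretive graphs -/

section Resolvent

variable {𝕜 H : Type*} [RCLike 𝕜] [NormedAddCommGroup H] [InnerProductSpace 𝕜 H]

/-- The graph `𝒜` is accretive. -/
def IsAccretiveGraph (𝒜 : Submodule 𝕜 (H × H)) : Prop :=
  ∀ p ∈ 𝒜, 0 ≤ RCLike.re (inner 𝕜 p.1 p.2)

/-- `1 + s 𝒜` is surjective for all `s > 0`. -/
def IsMaximalGraph (𝒜 : Submodule 𝕜 (H × H)) : Prop :=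
  ∀ s : ℝ, 0 < s → ∀ h : H, ∃ p ∈ 𝒜, p.1 + (s : 𝕜) • p.2 = h

/-- Pairing p.1 + s p.2 with p.1 and dropping the nonnegative term. It makes 1 + s𝒜 injective with
contractive inverse. -/
theorem IsAccretiveGraph.norm_le {𝒜 : Submodule 𝕜 (H × H)} (hA : IsAccretiveGraph 𝒜) {p : H × H}
    (hp : p ∈ 𝒜) {s : ℝ} (hs : 0 ≤ s) : ‖p.1‖ ≤ ‖p.1 + (s : 𝕜) • p.2‖ := by
  have h1 : ‖p.1‖ ^ 2 ≤ RCLike.re (inner 𝕜 p.1 (p.1 + (s : 𝕜) • p.2)) := by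
    rw [inner_add_right, inner_smul_right, map_add, RCLike.re_ofReal_mul, inner_self_eq_norm_sq]
    nlinarith [hA p hp]
  have h2 := (RCLike.re_le_norm _).trans (norm_inner_le_norm (𝕜 := 𝕜) p.1 (p.1 + (s : 𝕜) • p.2))
  by_contra! h
  nlinarith [norm_nonneg p.1, norm_nonneg (p.1 + (s : 𝕜) • p.2)]

theorem IsAccretiveGraph.exists_resolvent {𝒜 : Submodule 𝕜 (H × H)} (hA : IsAccretiveGraph 𝒜)
    {s : ℝ} (hs : 0 < s) (hsurj : ∀ h : H, ∃ p ∈ 𝒜, p.1 + (s : 𝕜) • p.2 = h) :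
    ∃ J : H →L[𝕜] H, (∀ h, ‖J h‖ ≤ ‖h‖) ∧ (∀ h, ∃ k, (J h, k) ∈ 𝒜 ∧ J h + (s : 𝕜) • k = h) ∧
      ∀ u k, (u, k) ∈ 𝒜 → J (u + (s : 𝕜) • k) = u := by
  choose p hp hps using hsurj
  have huniq : ∀ q ∈ 𝒜, ∀ h, q.1 + (s : 𝕜) • q.2 = h → (p h).1 = q.1 := by
    intro q hq h hh
    have := hA.norm_le (𝒜.sub_mem (hp h) hq) hs.le
    simp only [Prod.fst_sub, Prod.snd_sub, smul_sub] at this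
    rw [sub_add_sub_comm, hps, hh, sub_self, norm_zero] at this
    exact sub_eq_zero.1 (norm_le_zero_iff.1 this)
  let J₀ : H →ₗ[𝕜] H :=
    { toFun := fun h => (p h).1
      map_add' := fun a b => huniq _ (𝒜.add_mem (hp a) (hp b)) _ (by
        simp only [Prod.fst_add, Prod.snd_add, smul_add]
        rw [add_add_add_comm, hps, hps])
      map_smul' := fun c a => huniq _ (𝒜.smul_mem c (hp a)) _ (by
        simp only [Prod.smul_fst, Prod.smul_snd]
        rw [smul_comm, ← smul_add, hps]) }
  have hb : ∀ h, ‖J₀ h‖ ≤ 1 * ‖h‖ := fun h => by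
    have := hA.norm_le (hp h) hs.le
    rw [hps] at this
    rw [one_mul]
    exact this
  refine ⟨J₀.mkContinuous 1 hb, fun h => by simpa using hb h, fun h => ⟨(p h).2, hp h, hps h⟩,
    fun u k huk => huniq (u, k) huk _ rfl⟩

/-- Bounded resolvents `J s = (1 + s 𝒜)⁻¹` of a maximal accretive graph `𝒜`. -/
structure ResolventFamily (𝒜 : Submodule 𝕜 (H × H)) where
  J : ℝ → H →L[𝕜] H
  norm_le : ∀ s, 0 < s → ∀ h, ‖J s h‖ ≤ ‖h‖
  mem : ∀ s, 0 < s → ∀ h, ∃ k, (J s h, k) ∈ 𝒜 ∧ J s h + (s : 𝕜) • k = h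
  left_inv : ∀ s, 0 < s → ∀ u k, (u, k) ∈ 𝒜 → J s (u + (s : 𝕜) • k) = u

theorem IsMaximalGraph.nonempty_resolventFamily {𝒜 : Submodule 𝕜 (H × H)}
    (hA : IsAccretiveGraph 𝒜) (hmax : IsMaximalGraph 𝒜) : Nonempty (ResolventFamily 𝒜) := by
  have : ∀ s : ℝ, ∃ J : H →L[𝕜] H, 0 < s → (∀ h, ‖J h‖ ≤ ‖h‖) ∧
      (∀ h, ∃ k, (J h, k) ∈ 𝒜 ∧ J h + (s : 𝕜) • k = h) ∧
      ∀ u k, (u, k) ∈ 𝒜 → J (u + (s : 𝕜) • k) = u := fun s => by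
    by_cases hs : 0 < s
    · obtain ⟨J, hJ⟩ := hA.exists_resolvent hs (hmax s hs)
      exact ⟨J, fun _ => hJ⟩
    -- A dummy value: resolvents are only used for s > 0.
    · exact ⟨0, fun h => absurd h hs⟩
  choose J hJ using this
  exact ⟨⟨J, fun s hs => (hJ s hs).1, fun s hs => (hJ s hs).2.1, fun s hs => (hJ s hs).2.2⟩⟩

namespace ResolventFamily

variable {𝒜 : Submodule 𝕜 (H × H)} (R : ResolventFamily 𝒜)

/-- The (negative) Yosida approximation `s⁻¹ (J s - 1)`. -/
noncomputable def yosida (s : ℝ) : H →L[𝕜] H := ((s⁻¹ : ℝ) : 𝕜) • (R.J s - 1)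

theorem yosida_apply (s : ℝ) (h : H) : R.yosida s h = ((s⁻¹ : ℝ) : 𝕜) • (R.J s h - h) := rfl

/-- The resolvent identity. The pair (J s h, k) in 𝒜 has k = (h - J s h)/s, and the argument on the
right is J s h + r k, which J r sends back to J s h. -/
theorem J_eq {s r : ℝ} (hs : 0 < s) (hr : 0 < r) (h : H) :
    R.J s h = R.J r (((r / s : ℝ) : 𝕜) • h + ((1 - r / s : ℝ) : 𝕜) • R.J s h) := by
  obtain ⟨k, hk, hk'⟩ := R.mem s hs h
  have h1 := R.left_inv r hr _ _ hk
  conv_lhs => rw [← h1]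
  congr 1
  have hs0 : (s : 𝕜) ≠ 0 := by exact_mod_cast hs.ne'
  nth_rw 2 [← hk']
  push_cast
  rw [smul_add, smul_smul, div_mul_cancel₀ _ hs0, sub_smul, one_smul]
  abel

/-- The two resolvent identities, with s and r exchanged, express J r (J s h) and J s (J r h) by the
same combination of J s h and J r h. The common factor 1 - r/s is invertible unless s = r, when
there is nothing to prove. -/
theorem J_comm {s r : ℝ} (hs : 0 < s) (hr : 0 < r) : Commute (R.J s) (R.J r) := by
  rcases eq_or_ne s r with rfl | hne
  · exact Commute.refl _
  ext h
  have h1 := R.J_eq hs hr h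
  have h2 := R.J_eq hr hs h
  rw [map_add, map_smul, map_smul] at h1 h2
  have e1 : ((1 - r / s : ℝ) : 𝕜) • R.J r (R.J s h) = R.J s h - ((r / s : ℝ) : 𝕜) • R.J r h :=
    eq_sub_of_add_eq' h1.symm
  have e2 : ((1 - s / r : ℝ) : 𝕜) • R.J s (R.J r h) = R.J r h - ((s / r : ℝ) : 𝕜) • R.J s h :=
    eq_sub_of_add_eq' h2.symm
  have e3 : ((1 - r / s : ℝ) : 𝕜) • R.J s (R.J r h) = R.J s h - ((r / s : ℝ) : 𝕜) • R.J r h := by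
    have hc : (1 - r / s) = (-(r / s)) * (1 - s / r) := by field_simp; ring
    rw [hc, RCLike.ofReal_mul, mul_smul, e2, smul_sub, smul_smul, ← RCLike.ofReal_mul]
    have hc2 : -(r / s) * (s / r) = -1 := by field_simp
    rw [hc2]; push_cast; simp only [neg_smul, one_smul]; abel
  have hne' : ((1 - r / s : ℝ) : 𝕜) ≠ 0 := by
    rw [Ne, RCLike.ofReal_eq_zero, sub_eq_zero, eq_comm, div_eq_one_iff_eq hs.ne']
    exact hne.symm
  exact smul_right_injective H hne' (e3.trans e1.symm)

theorem yosida_comm {s r : ℝ} (hs : 0 < s) (hr : 0 < r) : Commute (R.yosida s) (R.yosida r) :=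
  ((((R.J_comm hs hr).sub_left (Commute.one_left _)).sub_right
    ((Commute.one_right _))).smul_left _).smul_right _

theorem re_inner_yosida {s : ℝ} (hs : 0 < s) (x : H) :
    RCLike.re (inner 𝕜 x (R.yosida s x)) ≤ 0 := by
  rw [yosida_apply, inner_smul_right, RCLike.re_ofReal_mul, inner_sub_right, map_sub,
    inner_self_eq_norm_sq]
  have h2 := (RCLike.re_le_norm _).trans (norm_inner_le_norm (𝕜 := 𝕜) x (R.J s x))
  have h3 := R.norm_le s hs x
  have : 0 < s⁻¹ := inv_pos.2 hs
  refine mul_nonpos_of_nonneg_of_nonpos this.le ?_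
  nlinarith [norm_nonneg x]

/-- On the domain the approximation is bounded uniformly in s, and it converges to -k as s → 0 when
the domain is dense, by `tendsto_J`. -/
theorem yosida_eq {s : ℝ} (hs : 0 < s) {x k : H} (h : (x, k) ∈ 𝒜) :
    R.yosida s x = -R.J s k := by
  have h1 := R.left_inv s hs x k h
  have hs0 : (s : 𝕜) ≠ 0 := by exact_mod_cast hs.ne'
  rw [map_add, map_smul] at h1
  have h2 : R.J s x - x = -((s : 𝕜) • R.J s k) := by
    nth_rw 2 [← h1]; abel
  rw [yosida_apply, h2, RCLike.ofReal_inv, smul_neg, smul_smul, inv_mul_cancel₀ hs0, one_smul]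

theorem tendsto_J (hdense : Dense {x | ∃ k, (x, k) ∈ 𝒜}) {s : ℕ → ℝ} (hs : ∀ n, 0 < s n)
    (hs0 : Tendsto s atTop (𝓝 0)) (x : H) : Tendsto (fun n => R.J (s n) x) atTop (𝓝 x) := by
  rw [Metric.tendsto_atTop]
  intro ε hε
  obtain ⟨y, ⟨k, hyk⟩, hxy⟩ := hdense.exists_dist_lt x (ε := ε / 4) (by positivity)
  have h1 : Tendsto (fun n => s n * ‖k‖) atTop (𝓝 0) := by simpa using hs0.mul_const ‖k‖
  obtain ⟨N, hN⟩ := (Metric.tendsto_atTop.1 h1) (ε / 4) (by positivity)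
  refine ⟨N, fun n hn => ?_⟩
  have h2 := hN n hn
  rw [Real.dist_eq, sub_zero, abs_of_nonneg (mul_nonneg (hs n).le (norm_nonneg _))] at h2
  have h3 : R.J (s n) y - y = -((s n : 𝕜) • R.J (s n) k) := by
    have h1 := R.left_inv (s n) (hs n) y k hyk
    rw [map_add, map_smul] at h1
    nth_rw 2 [← h1]; abel
  have h4 : ‖R.J (s n) y - y‖ ≤ s n * ‖k‖ := by
    rw [h3, norm_neg, norm_smul, RCLike.norm_ofReal, abs_of_pos (hs n)]
    exact mul_le_mul_of_nonneg_left (R.norm_le _ (hs n) k) (hs n).le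
  have h5 : R.J (s n) x - x = R.J (s n) (x - y) + (R.J (s n) y - y) + (y - x) := by
    rw [map_sub]; abel
  rw [dist_eq_norm] at hxy ⊢
  rw [h5]
  calc _ ≤ ‖R.J (s n) (x - y)‖ + ‖R.J (s n) y - y‖ + ‖y - x‖ := norm_add₃_le
    _ < ε := by
      have := R.norm_le _ (hs n) (x - y)
      rw [norm_sub_rev y x]; linarith

end ResolventFamily

end Resolvent

/-! ### The Hille–Yosida construction in a Hilbert space -/

section Generation

variable {𝕜 H : Type*} [RCLike 𝕜] [NormedAddCommGroup H] [InnerProductSpace 𝕜 H]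
  [CompleteSpace H] [NormedSpace ℝ H] [IsScalarTower ℝ 𝕜 H]

namespace ResolventFamily

variable {𝒜 : Submodule 𝕜 (H × H)} (R : ResolventFamily 𝒜)

/-- The approximating semigroups. -/
noncomputable def approx (n : ℕ) (t : ℝ≥0) : H →L[𝕜] H :=
  expOrbit (R.yosida (1 / ((n : ℝ) + 1))) t

theorem norm_approx_le (n : ℕ) (t : ℝ≥0) (x : H) : ‖R.approx n t x‖ ≤ ‖x‖ :=
  norm_expOrbit_apply_le (R.re_inner_yosida (by positivity)) t.2 x

/-- At a point y of the domain the exponentials differ by at most t times the difference of the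
Yosida approximations at y, which is Cauchy. Contractivity carries this to all x by density. -/
theorem cauchySeq_approx (hdense : Dense {x | ∃ k, (x, k) ∈ 𝒜}) (t : ℝ≥0) (x : H) :
    CauchySeq fun n => R.approx n t x := by
  have hs : ∀ n : ℕ, (0 : ℝ) < 1 / ((n : ℝ) + 1) := fun n => by positivity
  rw [Metric.cauchySeq_iff]
  intro ε hε
  obtain ⟨y, ⟨k, hyk⟩, hxy⟩ := hdense.exists_dist_lt x (ε := ε / 4) (by positivity)
  have h1 : CauchySeq fun n : ℕ => R.yosida (1 / ((n : ℝ) + 1)) y := by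
    have := (R.tendsto_J hdense hs tendsto_one_div_add_atTop_nhds_zero_nat k).neg.cauchySeq
    simpa only [R.yosida_eq (hs _) hyk] using this
  obtain ⟨N, hN⟩ := (Metric.cauchySeq_iff.1 h1) (ε / 4 / (t + 1)) (by positivity)
  refine ⟨N, fun m hm n hn => ?_⟩
  have h2 := hN m hm n hn
  rw [dist_eq_norm] at h2 hxy ⊢
  have h3 := norm_expOrbit_sub_le (R.yosida_comm (hs m) (hs n)) (R.re_inner_yosida (hs m))
    (R.re_inner_yosida (hs n)) t.2 y
  have h4 : R.approx m t x - R.approx n t x = R.approx m t (x - y) +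
      (R.approx m t y - R.approx n t y) - R.approx n t (x - y) := by
    simp only [map_sub]; abel
  have h5 : ‖R.approx m t y - R.approx n t y‖ ≤ ε / 4 := by
    refine h3.trans ?_
    calc _ ≤ (ε / 4 / (t + 1)) * t := mul_le_mul_of_nonneg_right h2.le t.2
      _ ≤ (ε / 4 / (t + 1)) * (t + 1) := by gcongr; simp
      _ = ε / 4 := by field_simp
  rw [h4]
  calc _ ≤ ‖R.approx m t (x - y)‖ + ‖R.approx m t y - R.approx n t y‖ + ‖R.approx n t (x - y)‖ :=
        (norm_sub_le _ _).trans (by gcongr; exact norm_add_le _ _)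
    _ < ε := by linarith [R.norm_approx_le m t (x - y), R.norm_approx_le n t (x - y)]

/-- The strong limit of the approximating exponentials is the semigroup. Only one inclusion between
-𝒜 and the generator is shown here; the converse follows from maximality. -/
theorem exists_semigroup (R : ResolventFamily 𝒜) (hdense : Dense {x | ∃ k, (x, k) ∈ 𝒜}) :
    ∃ T : C0Semigroup 𝕜 H, (∀ t x, ‖T.op t x‖ ≤ ‖x‖) ∧
      ∀ x k, (x, k) ∈ 𝒜 → (x, -k) ∈ T.generatorGraph := by
  have hs : ∀ n : ℕ, (0 : ℝ) < 1 / ((n : ℝ) + 1) := fun n => by positivity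
  choose F hF using fun t x => cauchySeq_tendsto_of_complete (R.cauchySeq_approx hdense t x)
  have hFn : ∀ t x, ‖F t x‖ ≤ ‖x‖ := fun t x =>
    le_of_tendsto (hF t x).norm (Eventually.of_forall fun n => R.norm_approx_le n t x)
  let op : ℝ≥0 → H →L[𝕜] H := fun t => LinearMap.mkContinuous
    { toFun := F t
      map_add' := fun x y => tendsto_nhds_unique (hF t (x + y)) (by
        simpa only [map_add] using (hF t x).add (hF t y))
      map_smul' := fun c x => tendsto_nhds_unique (hF t (c • x)) (by
        simpa only [map_smul, RingHom.id_apply] using (hF t x).const_smul c) } 1 (fun x => by simpa using hFn t x)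
  have hop : ∀ t x, op t x = F t x := fun _ _ => rfl
  have hlip : ∀ x k, (x, k) ∈ 𝒜 → ∀ n : ℕ, ∀ t : ℝ≥0, ‖R.approx n t x - x‖ ≤ ‖k‖ * t := by
    intro x k hxk n t
    have := norm_expOrbit_sub_le (Commute.zero_right (R.yosida (1 / ((n : ℝ) + 1))))
      (R.re_inner_yosida (hs n)) (by simp) t.2 x
    simp only [expOrbit_zero_left, one_apply_eq_self, zero_apply,
      sub_zero, R.yosida_eq (hs n) hxk, norm_neg] at this
    exact this.trans (mul_le_mul_of_nonneg_right (R.norm_le _ (hs n) k) t.2)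
  have hlipF : ∀ x k, (x, k) ∈ 𝒜 → ∀ t : ℝ≥0, ‖F t x - x‖ ≤ ‖k‖ * t := fun x k hxk t =>
    le_of_tendsto ((hF t x).sub_const x).norm (Eventually.of_forall fun n => hlip x k hxk n t)
  have hcont : ∀ x, Tendsto (fun t => op t x) (𝓝 0) (𝓝 x) := by
    intro x
    rw [Metric.tendsto_nhds]
    intro ε hε
    obtain ⟨y, ⟨k, hyk⟩, hxy⟩ := hdense.exists_dist_lt x (ε := ε / 4) (by positivity)
    have h1 : Tendsto (fun t : ℝ≥0 => ‖k‖ * (t : ℝ)) (𝓝 0) (𝓝 0) := by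
      have : Continuous fun t : ℝ≥0 => ‖k‖ * (t : ℝ) := by fun_prop
      simpa using this.tendsto 0
    filter_upwards [h1.eventually (gt_mem_nhds (show 0 < ε / 4 by positivity))] with t ht
    have h2 : op t x - x = op t (x - y) + (F t y - y) + (y - x) := by
      rw [map_sub, hop t y]; abel
    rw [dist_eq_norm] at hxy ⊢
    rw [h2]
    have h3 : ‖op t (x - y)‖ ≤ ‖x - y‖ := hFn t _
    calc _ ≤ ‖op t (x - y)‖ + ‖F t y - y‖ + ‖y - x‖ := norm_add₃_le
      _ < ε := by rw [norm_sub_rev y x]; linarith [hlipF y k hyk t]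
  let T : C0Semigroup 𝕜 H :=
    { op := op
      op_zero := by
        ext x
        refine tendsto_nhds_unique (hF 0 x) ?_
        simp [approx, expOrbit_zero]
      op_add := fun s t => by
        ext x
        refine tendsto_nhds_unique (hF (s + t) x) ?_
        have h1 : ∀ n, R.approx n (s + t) x = R.approx n s (R.approx n t x - F t x) +
            R.approx n s (F t x) := fun n => by
          rw [← map_add, sub_add_cancel]
          simp only [approx, NNReal.coe_add, expOrbit_add, ContinuousLinearMap.comp_apply]
        simp only [h1]
        have h2 : Tendsto (fun n => R.approx n s (R.approx n t x - F t x)) atTop (𝓝 0) := by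
          refine squeeze_zero_norm (fun n => R.norm_approx_le n s _) ?_
          simpa using ((hF t x).sub_const (F t x)).norm
        simpa [hop] using h2.add (hF s (F t x))
      tendsto_zero := hcont }
  refine ⟨T, hFn, fun x k hxk => ?_⟩
  change Tendsto (fun t : ℝ≥0 => (((t : ℝ)⁻¹ : ℝ) : 𝕜) • (T.op t x - x)) (𝓝[>] 0) (𝓝 (-k))
  -- To control e^(ra) ax - ax, where ax tends to -k, the vector k is replaced by a nearby y in the
  -- domain: the orbit of y is Lipschitz with constant ‖l‖, and the error is at most 2‖ax + y‖.
  -- After division by t and t → 0 only 2‖k - y‖ remains, which is arbitrarily small.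
  have hT : ∀ y l, (y, l) ∈ 𝒜 → ∀ t : ℝ≥0,
      ‖F t x - x + (t : ℝ) • k‖ ≤ (2 * ‖k - y‖ + ‖l‖ * t) * t := by
    intro y l hyl t
    have hy : Tendsto (fun n : ℕ => R.yosida (1 / ((n : ℝ) + 1)) x) atTop (𝓝 (-k)) := by
      simpa only [R.yosida_eq (hs _) hxk] using
        (R.tendsto_J hdense hs tendsto_one_div_add_atTop_nhds_zero_nat k).neg
    have hlim : Tendsto (fun n : ℕ => R.approx n t x - x - (t : ℝ) •
        R.yosida (1 / ((n : ℝ) + 1)) x) atTop (𝓝 (F t x - x + (t : ℝ) • k)) := by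
      have := ((hF t x).sub_const x).sub (hy.const_smul (t : ℝ))
      simpa [smul_neg, sub_neg_eq_add] using this
    have hb : Tendsto (fun n : ℕ => (2 * ‖R.yosida (1 / ((n : ℝ) + 1)) x + y‖ + ‖l‖ * t) * t) atTop
        (𝓝 ((2 * ‖-k + y‖ + ‖l‖ * t) * t)) :=
      (((hy.add_const y).norm.const_mul 2).add_const _).mul_const _
    rw [norm_sub_rev k y, sub_eq_neg_add y k]
    refine le_of_tendsto_of_tendsto' hlim.norm hb fun n => ?_
    refine norm_expOrbit_taylor_le t.2 x fun r hr => ?_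
    set a := R.yosida (1 / ((n : ℝ) + 1)) with ha
    have e1 : expOrbit a r (a x) - a x =
        expOrbit a r (a x + y) - (a x + y) - (expOrbit a r y - y) := by
      rw [map_add]; abel
    have e2 := norm_expOrbit_apply_le (R.re_inner_yosida (hs n)) hr.1 (a x + y)
    have e3 := hlip y l hyl n ⟨r, hr.1⟩
    have e4 : ‖expOrbit a r y - y‖ ≤ ‖l‖ * t := e3.trans (by gcongr; exact hr.2.le)
    rw [e1]
    calc _ ≤ ‖expOrbit a r (a x + y)‖ + ‖a x + y‖ + ‖expOrbit a r y - y‖ :=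
          (norm_sub_le _ _).trans (by gcongr; exact norm_sub_le _ _)
      _ ≤ _ := by linarith
  rw [Metric.tendsto_nhds]
  intro ε hε
  obtain ⟨y, ⟨l, hyl⟩, hky⟩ := hdense.exists_dist_lt k (ε := ε / 4) (by positivity)
  have h1 : Tendsto (fun t : ℝ≥0 => ‖l‖ * (t : ℝ)) (𝓝[>] 0) (𝓝 0) := by
    have : Continuous fun t : ℝ≥0 => ‖l‖ * (t : ℝ) := by fun_prop
    simpa using (this.tendsto 0).mono_left nhdsWithin_le_nhds
  filter_upwards [h1.eventually (gt_mem_nhds (show 0 < ε / 4 by positivity)),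
    self_mem_nhdsWithin] with t ht ht0
  have ht0' : (0 : ℝ) < t := ht0
  have h2 : (((t : ℝ)⁻¹ : ℝ) : 𝕜) • (T.op t x - x) - -k = (t : ℝ)⁻¹ • (F t x - x + (t : ℝ) • k) := by
    rw [← RCLike.real_smul_eq_coe_smul, smul_add, smul_smul, inv_mul_cancel₀ ht0'.ne', one_smul,
      sub_neg_eq_add]
    rfl
  rw [dist_eq_norm] at hky ⊢
  rw [h2, norm_smul, norm_inv, Real.norm_of_nonneg ht0'.le, inv_mul_lt_iff₀ ht0']
  refine (hT y l hyl t).trans_lt ?_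
  rw [mul_comm]
  gcongr
  linarith

end ResolventFamily

theorem re_inner_generatorGraph_nonpos {T : C0Semigroup 𝕜 H} (hT : ∀ t x, ‖T.op t x‖ ≤ ‖x‖)
    {p : H × H} (hp : p ∈ T.generatorGraph) : RCLike.re (inner 𝕜 p.1 p.2) ≤ 0 := by
  have hp' : Tendsto (fun t : ℝ≥0 => (((t : ℝ)⁻¹ : ℝ) : 𝕜) • (T.op t p.1 - p.1))
    (𝓝[>] 0) (𝓝 p.2) := hp
  have h1 : Tendsto (fun t : ℝ≥0 => RCLike.re (inner 𝕜 p.1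
      ((((t : ℝ)⁻¹ : ℝ) : 𝕜) • (T.op t p.1 - p.1)))) (𝓝[>] 0)
      (𝓝 (RCLike.re (inner 𝕜 p.1 p.2))) := by
    have hc : Continuous fun y : H => RCLike.re (inner 𝕜 p.1 y) := by fun_prop
    exact (hc.tendsto _).comp hp'
  refine le_of_tendsto h1 (Eventually.of_forall fun t => ?_)
  rw [inner_smul_right, RCLike.re_ofReal_mul, inner_sub_right, map_sub, inner_self_eq_norm_sq]
  have h2 := (RCLike.re_le_norm _).trans (norm_inner_le_norm (𝕜 := 𝕜) p.1 (T.op t p.1))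
  refine mul_nonpos_of_nonneg_of_nonpos (by positivity) ?_
  nlinarith [norm_nonneg p.1, hT t p.1]

/-- A maximal accretive graph with dense domain is minus the generator of a contraction
semigroup. -/
theorem exists_semigroup_of_maximal_accretive {𝒜 : Submodule 𝕜 (H × H)}
    (hA : IsAccretiveGraph 𝒜) (hmax : IsMaximalGraph 𝒜)
    (hdense : Dense {x | ∃ k, (x, k) ∈ 𝒜}) :
    ∃ T : C0Semigroup 𝕜 H, ∀ x k, (x, k) ∈ T.generatorGraph ↔ (x, -k) ∈ 𝒜 := by
  obtain ⟨R⟩ := hmax.nonempty_resolventFamily hA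
  obtain ⟨T, hT, hgen⟩ := R.exists_semigroup hdense
  refine ⟨T, fun x k => ⟨fun h => ?_, fun h => by simpa using hgen x (-k) h⟩⟩
  -- With u + l = x - k, the difference of (x, k) and (u, -l) is (x - u, x - u). It lies in the
  -- generator graph, and dissipativity forces ‖x - u‖² ≤ 0.
  obtain ⟨⟨u, l⟩, hul, hsum⟩ := hmax 1 one_pos (x - k)
  simp only [RCLike.ofReal_one, one_smul] at hsum
  have h1 := T.generatorGraph.sub_mem h (hgen u l hul)
  have h2 : k - -l = x - u := by
    rw [sub_neg_eq_add, eq_sub_iff_add_eq, add_assoc, add_comm l u, hsum]; abel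
  rw [Prod.mk_sub_mk, h2] at h1
  have h3 := re_inner_generatorGraph_nonpos hT h1
  simp only [inner_self_eq_norm_sq] at h3
  have h4 : x - u = 0 := by
    rw [← norm_eq_zero]; exact pow_eq_zero_iff two_ne_zero |>.1 (le_antisymm h3 (sq_nonneg _))
  have h5 : k = -l := by rw [h4] at h2; exact sub_eq_zero.1 h2
  rw [sub_eq_zero.1 h4, h5, neg_neg]
  exact hul

end Generation

/-! ### Nonpositive self-adjoint operators, in terms of their graphs -/

section SelfAdjoint

variable {𝕜 H : Type*} [RCLike 𝕜] [NormedAddCommGroup H] [InnerProductSpace 𝕜 H]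

/-- `Γ` is the graph of a symmetric nonpositive operator. -/
structure IsNonposSymmetricGraph (Γ : Submodule 𝕜 (H × H)) : Prop where
  symm : ∀ p ∈ Γ, ∀ q ∈ Γ, inner 𝕜 p.2 q.1 = inner 𝕜 p.1 q.2
  nonpos : ∀ p ∈ Γ, RCLike.re (inner 𝕜 p.1 p.2) ≤ 0

/-- `Γ` is the graph of a nonpositive self-adjoint operator `L`: it is symmetric, nonpositive, and
`1 - L` is surjective. -/
structure IsNonposSelfAdjointGraph (Γ : Submodule 𝕜 (H × H)) : Prop
    extends IsNonposSymmetricGraph Γ where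
  closed : IsClosed (Γ : Set (H × H))
  dense : Dense {x | ∃ y, (x, y) ∈ Γ}
  surj : ∀ h, ∃ p ∈ Γ, p.1 - p.2 = h

/-- In ‖p.1 - p.2‖² = ‖p.1‖² - 2 Re (p.1 | p.2) + ‖p.2‖² the cross term is nonnegative. So 1 - L is
bounded below in the graph norm. -/
theorem IsNonposSymmetricGraph.norm_le {Γ : Submodule 𝕜 (H × H)} (hΓ : IsNonposSymmetricGraph Γ)
    {p : H × H} (hp : p ∈ Γ) : ‖p‖ ≤ ‖p.1 - p.2‖ := by
  have h1 := norm_sub_sq (𝕜 := 𝕜) p.1 p.2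
  have h2 := hΓ.nonpos p hp
  rw [Prod.norm_def, max_le_iff]
  constructor <;> refine (sq_le_sq₀ (norm_nonneg _) (norm_nonneg _)).1 ?_ <;>
    nlinarith [norm_nonneg p.1, norm_nonneg p.2]

/-- The criterion for essential self-adjointness: on the closed graph, p ↦ p.1 - p.2 is bounded
below, so its range is closed; containing a dense set, it is everything. -/
theorem IsNonposSymmetricGraph.topologicalClosure [CompleteSpace H] {Γ : Submodule 𝕜 (H × H)}
    (hΓ : IsNonposSymmetricGraph Γ) (hd : Dense {h | ∃ p ∈ Γ, p.1 - p.2 = h})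
    (hdom : Dense {x | ∃ y, (x, y) ∈ Γ}) :
    IsNonposSelfAdjointGraph Γ.topologicalClosure := by
  have hsymm : IsNonposSymmetricGraph Γ.topologicalClosure := by
    refine ⟨fun p hp q hq => ?_, fun p hp => ?_⟩
    · have h1 : ∀ q ∈ Γ, ∀ p ∈ Γ.topologicalClosure, inner 𝕜 p.2 q.1 = inner 𝕜 p.1 q.2 := by
        intro q hq p hp
        exact closure_minimal (t := {p : H × H | inner 𝕜 p.2 q.1 = inner 𝕜 p.1 q.2})
          (fun p hp => hΓ.symm p hp q hq) (isClosed_eq (by fun_prop) (by fun_prop)) hp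
      exact closure_minimal (t := {q : H × H | inner 𝕜 p.2 q.1 = inner 𝕜 p.1 q.2})
          (fun q hq => h1 q hq p hp) (isClosed_eq (by fun_prop) (by fun_prop)) hq
    · exact closure_minimal (t := {p : H × H | RCLike.re (inner 𝕜 p.1 p.2) ≤ 0})
          hΓ.nonpos (isClosed_le (by fun_prop) (by fun_prop)) hp
  have hclosed := Γ.isClosed_topologicalClosure
  refine ⟨hsymm, hclosed, hdom.mono ?_, ?_⟩
  · rintro x ⟨y, hy⟩
    exact ⟨y, Γ.le_topologicalClosure hy⟩
  have : CompleteSpace Γ.topologicalClosure := hclosed.completeSpace_coe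
  let Φ : Γ.topologicalClosure →L[𝕜] H :=
    (ContinuousLinearMap.fst 𝕜 H H - ContinuousLinearMap.snd 𝕜 H H).comp
      Γ.topologicalClosure.subtypeL
  have hanti : AntilipschitzWith 1 Φ := Φ.antilipschitz_of_bound fun p => by
    rw [NNReal.coe_one, one_mul]
    exact hsymm.norm_le p.2
  have hrange : IsClosed (Set.range Φ) := hanti.isClosed_range Φ.uniformContinuous
  have hall : Set.range Φ = Set.univ := by
    rw [← hrange.closure_eq]
    refine (hd.mono ?_).closure_eq
    rintro _ ⟨p, hp, rfl⟩
    exact ⟨⟨p, Γ.le_topologicalClosure hp⟩, rfl⟩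
  intro h
  obtain ⟨p, hp⟩ : h ∈ Set.range Φ := hall ▸ Set.mem_univ h
  exact ⟨p, p.2, hp⟩

/-- The graph of the square of an operator with graph `Γ`. -/
def squareGraph (Γ : Submodule 𝕜 (H × H)) : Submodule 𝕜 (H × H) where
  carrier := {p | ∃ y, (p.1, y) ∈ Γ ∧ (y, p.2) ∈ Γ}
  zero_mem' := ⟨0, Γ.zero_mem, Γ.zero_mem⟩
  add_mem' := by
    rintro p q ⟨y, h1, h2⟩ ⟨z, h3, h4⟩
    exact ⟨y + z, Γ.add_mem h1 h3, Γ.add_mem h2 h4⟩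
  smul_mem' := by
    rintro c p ⟨y, h1, h2⟩
    exact ⟨c • y, Γ.smul_mem c h1, Γ.smul_mem c h2⟩

namespace IsNonposSelfAdjointGraph

variable {Γ : Submodule 𝕜 (H × H)}

/-- The resolvent `J = (1 - L)⁻¹`. -/
theorem exists_resolvent (hΓ : IsNonposSelfAdjointGraph Γ) :
    ∃ J : H →L[𝕜] H, (∀ h, ‖J h‖ ≤ ‖h‖) ∧ (∀ h, (J h, J h - h) ∈ Γ) ∧
      ∀ x y, (x, y) ∈ Γ → J (x - y) = x := by
  let 𝒜 : Submodule 𝕜 (H × H) := Γ.comap (LinearMap.prodMap LinearMap.id (-LinearMap.id))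
  have hA : ∀ x y, (x, y) ∈ 𝒜 ↔ (x, -y) ∈ Γ := fun _ _ => Iff.rfl
  have hacc : IsAccretiveGraph 𝒜 := fun p hp => by
    have := hΓ.nonpos _ ((hA p.1 p.2).1 hp)
    simpa using this
  obtain ⟨J, h1, h2, h3⟩ := hacc.exists_resolvent one_pos (fun h => by
    obtain ⟨p, hp, hh⟩ := hΓ.surj h
    exact ⟨(p.1, -p.2), (hA _ _).2 (by simpa using hp), by simpa [← sub_eq_add_neg] using hh⟩)
  refine ⟨J, h1, fun h => ?_, fun x y hxy => ?_⟩
  · obtain ⟨k, hk, hk'⟩ := h2 h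
    have := (hA _ _).1 hk
    simp only [RCLike.ofReal_one, one_smul] at hk'
    rwa [show J h - h = -k by nth_rw 2 [← hk']; abel]
  · have := h3 x (-y) ((hA _ _).2 (by simpa using hxy))
    simpa [← sub_eq_add_neg] using this

theorem resolvent_symm (hΓ : IsNonposSelfAdjointGraph Γ) {J : H →L[𝕜] H}
    (hJ : ∀ h, (J h, J h - h) ∈ Γ) (h k : H) : inner 𝕜 (J h) k = inner 𝕜 h (J k) := by
  have := hΓ.symm _ (hJ h) _ (hJ k)
  simp only [inner_sub_left, inner_sub_right] at this
  exact (sub_right_injective this).symm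

/-- By symmetry y is orthogonal to the dense domain. -/
theorem snd_eq_zero (hΓ : IsNonposSelfAdjointGraph Γ) {y : H} (hy : (0, y) ∈ Γ) : y = 0 := by
  refine hΓ.dense.induction (P := fun x => inner 𝕜 y x = 0) ?_
    (isClosed_eq (by fun_prop) (by fun_prop)) y |> inner_self_eq_zero.1
  rintro x ⟨z, hz⟩
  simpa using hΓ.symm _ hy _ hz

/-- The adjoint is contained in the operator. Solve q.1 - q.2 = y - h within Γ; then y - q.1 is
orthogonal to the range of 1 - L, which is everything. -/
theorem mem_of_forall_inner (hΓ : IsNonposSelfAdjointGraph Γ) {y h : H}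
    (hyh : ∀ p ∈ Γ, inner 𝕜 p.2 y = inner 𝕜 p.1 h) : (y, h) ∈ Γ := by
  obtain ⟨q, hq, hqy⟩ := hΓ.surj (y - h)
  have h1 : ∀ k : H, inner 𝕜 k (y - q.1) = 0 := by
    intro k
    obtain ⟨p, hp, rfl⟩ := hΓ.surj k
    have e1 := hyh p hp
    have e2 := hΓ.symm p hp q hq
    have e3 : inner 𝕜 p.1 (q.1 - q.2) = inner 𝕜 p.1 (y - h) := by rw [hqy]
    simp only [inner_sub_left, inner_sub_right] at e3 ⊢
    linear_combination e2 - e1 - e3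
  have h2 : y = q.1 := sub_eq_zero.1 (inner_self_eq_zero.1 (h1 _))
  have h3 : h = q.2 := by
    rw [h2] at hqy; exact (sub_right_injective hqy).symm
  rw [h2, h3]
  exact hq

/-- The form condition on u says that Lu lies in the domain of L*, and L* = L. This identifies the
operator of the form (Lu | Lv) with L². -/
theorem mem_squareGraph_iff (hΓ : IsNonposSelfAdjointGraph Γ) {u h : H} :
    (u, h) ∈ squareGraph Γ ↔ ∃ y, (u, y) ∈ Γ ∧ ∀ p ∈ Γ, inner 𝕜 p.2 y = inner 𝕜 p.1 h :=
  ⟨fun ⟨y, h1, h2⟩ => ⟨y, h1, fun p hp => hΓ.symm p hp _ h2⟩,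
    fun ⟨y, h1, h2⟩ => ⟨y, h1, hΓ.mem_of_forall_inner h2⟩⟩

theorem accretive_squareGraph (hΓ : IsNonposSelfAdjointGraph Γ) :
    IsAccretiveGraph (squareGraph Γ) := by
  rintro ⟨u, h⟩ ⟨y, h1, h2⟩
  have := hΓ.symm _ h1 _ h2
  simp only at this h1 h2 ⊢
  rw [← this]
  exact inner_self_nonneg

theorem squareGraph_snd_eq_zero (hΓ : IsNonposSelfAdjointGraph Γ) {h : H}
    (hh : (0, h) ∈ squareGraph Γ) : h = 0 := by
  obtain ⟨y, h1, h2⟩ := hh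
  rw [hΓ.snd_eq_zero h1] at h2
  exact hΓ.snd_eq_zero h2

/-- Von Neumann's argument: u + sL²u = h is solved by projecting (h, 0) orthogonally onto the graph
of √s L. If (u, y) is the projection, the remainder (a, -y) is orthogonal to the graph, which says
exactly that sL²u = a = h - u. -/
theorem maximal_squareGraph [CompleteSpace H] (hΓ : IsNonposSelfAdjointGraph Γ) :
    IsMaximalGraph (squareGraph Γ) := by
  intro s hs h
  set c : 𝕜 := ((Real.sqrt s : ℝ) : 𝕜) with hc
  have hcc : c * c = s := by rw [hc, ← RCLike.ofReal_mul, Real.mul_self_sqrt hs.le]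
  have hc0 : c ≠ 0 := by
    rw [hc, Ne, RCLike.ofReal_eq_zero]; exact (Real.sqrt_pos.2 hs).ne'
  have hconj : (starRingEnd 𝕜) c = c := RCLike.conj_ofReal _
  let e : WithLp 2 (H × H) →L[𝕜] H × H :=
    ((ContinuousLinearMap.id 𝕜 H).prodMap (c⁻¹ • ContinuousLinearMap.id 𝕜 H)).comp
      (WithLp.prodContinuousLinearEquiv 2 𝕜 H H).toContinuousLinearMap
  -- The product carries the sup norm; the ℓ² norm is needed to have an orthogonal projection.
  let K : Submodule 𝕜 (WithLp 2 (H × H)) := Γ.comap e.toLinearMap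
  have hK : ∀ x y, WithLp.toLp 2 (x, y) ∈ K ↔ (x, c⁻¹ • y) ∈ Γ := fun _ _ => Iff.rfl
  have hKclosed : IsClosed (K : Set (WithLp 2 (H × H))) := hΓ.closed.preimage e.continuous
  have : CompleteSpace K := hKclosed.completeSpace_coe
  obtain ⟨w, hw, z, hz, hwz⟩ := K.exists_add_mem_mem_orthogonal (WithLp.toLp 2 (h, (0 : H)))
  obtain ⟨⟨u, y⟩⟩ := w
  obtain ⟨⟨a, b⟩⟩ := z
  have hsum : h = u + a ∧ 0 = y + b := by
    have := congrArg (WithLp.ofLp) hwz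
    simpa [Prod.ext_iff] using this
  have hort : ∀ p ∈ Γ, inner 𝕜 p.1 a + inner 𝕜 (c • p.2) b = 0 := by
    intro p hp
    have h1 : WithLp.toLp 2 (p.1, c • p.2) ∈ K := by
      rw [hK, smul_smul, inv_mul_cancel₀ hc0, one_smul]; exact hp
    have := (Submodule.mem_orthogonal K _).1 hz _ h1
    simpa [WithLp.prod_inner_apply] using this
  have hb : b = -y := eq_neg_of_add_eq_zero_right hsum.2.symm
  have hs0 : (s : 𝕜) ≠ 0 := by exact_mod_cast hs.ne'
  refine ⟨(u, (s : 𝕜)⁻¹ • a), ?_, ?_⟩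
  · refine hΓ.mem_squareGraph_iff.2 ⟨c⁻¹ • y, (hK u y).1 hw, fun p hp => ?_⟩
    have := hort p hp
    rw [hb, inner_smul_left, hconj, inner_neg_right] at this
    rw [inner_smul_right, inner_smul_right, ← hcc]
    have h2 : inner 𝕜 p.1 a = c * inner 𝕜 p.2 y := by linear_combination this
    rw [h2]
    field_simp
  · simp only
    rw [smul_smul, mul_inv_cancel₀ hs0, one_smul, ← hsum.1]

/-- Write h, orthogonal to the domain, as u + L²u. Pairing with u gives ‖u‖² + (u | L²u) = 0, so u =
0 and then h = 0. -/
theorem dense_squareGraph [CompleteSpace H] (hΓ : IsNonposSelfAdjointGraph Γ) :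
    Dense {x | ∃ k, (x, k) ∈ squareGraph Γ} := by
  have hset : {x | ∃ k, (x, k) ∈ squareGraph Γ} =
      ((squareGraph Γ).map (LinearMap.fst 𝕜 H H) : Set H) := by
    ext x; simp
  rw [hset, ← Submodule.dense_iff_topologicalClosure_eq_top.symm.eq,
    Submodule.topologicalClosure_eq_top_iff, Submodule.eq_bot_iff]
  intro h hh
  rw [Submodule.mem_orthogonal] at hh
  obtain ⟨p, hp, hph⟩ := hΓ.maximal_squareGraph 1 one_pos h
  rw [RCLike.ofReal_one, one_smul] at hph
  have h1 := hh p.1 ⟨p, hp, rfl⟩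
  rw [← hph, inner_add_right] at h1
  have h2 := congrArg RCLike.re h1
  rw [map_add, inner_self_eq_norm_sq, map_zero] at h2
  have h3 := hΓ.accretive_squareGraph p hp
  have h4 : p.1 = 0 := norm_eq_zero.1 (pow_eq_zero_iff two_ne_zero |>.1
    (le_antisymm (by linarith) (sq_nonneg _)))
  have h5 : p.2 = 0 := hΓ.squareGraph_snd_eq_zero (by rw [← h4]; exact hp)
  rw [← hph, h4, h5, add_zero]

/-- If L²u = 0 then ‖Lu‖² = (u | L²u) = 0. -/
theorem mem_squareGraph_zero_iff (hΓ : IsNonposSelfAdjointGraph Γ) {u : H} :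
    (u, 0) ∈ squareGraph Γ ↔ (u, 0) ∈ Γ := by
  refine ⟨?_, fun h => ⟨0, h, Γ.zero_mem⟩⟩
  rintro ⟨y, h1, h2⟩
  have := hΓ.symm _ h1 _ h2
  simp only [inner_zero_right] at this
  have hy : y = 0 := inner_self_eq_zero.1 this
  rw [hy] at h1
  exact h1

/-- Since LJ = J - 1, J² maps into the domain of L² and L²J² = (J - 1)². -/
theorem resolvent_sq_mem_squareGraph {J : H →L[𝕜] H} (hJ : ∀ h, (J h, J h - h) ∈ Γ) (f : H) :
    (J (J f), (J (J f) - J f) - (J f - f)) ∈ squareGraph Γ := by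
  refine ⟨J (J f) - J f, hJ (J f), ?_⟩
  have := hJ (J f - f)
  rwa [map_sub] at this

theorem mem_of_resolvent_eq {J : H →L[𝕜] H} (hJ : ∀ h, (J h, J h - h) ∈ Γ) {f : H}
    (hf : J f = f) : (f, 0) ∈ Γ := by
  simpa [hf] using hJ f

/-- A vector orthogonal to the range of the square lies in the kernel. -/
theorem mem_of_forall_inner_snd_eq_zero (hΓ : IsNonposSelfAdjointGraph Γ) {h : H}
    (hh : ∀ p ∈ squareGraph Γ, inner 𝕜 p.2 h = 0) : (h, 0) ∈ Γ := by
  obtain ⟨J, -, hJ, -⟩ := hΓ.exists_resolvent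
  have h1 := hh _ (resolvent_sq_mem_squareGraph hJ h)
  have hs := hΓ.resolvent_symm hJ
  -- J is symmetric, so ((J - 1)²h | h) = ‖Jh - h‖²; and fixed points of J lie in the kernel.
  have h2 : inner 𝕜 (J h - h) (J h - h) = 0 := by
    simp only [inner_sub_left, hs] at h1
    simp only [inner_sub_left, inner_sub_right, hs] at h1 ⊢
    linear_combination h1
  exact mem_of_resolvent_eq hJ (sub_eq_zero.1 (inner_self_eq_zero.1 h2))

end IsNonposSelfAdjointGraph

theorem squareFormGraph_eq_squareGraph {L : H →ₗ.[𝕜] H} (hL : IsNonposSelfAdjointGraph L.graph) :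
    squareFormGraph L = squareGraph L.graph := by
  ext ⟨u, h⟩
  rw [hL.mem_squareGraph_iff]
  constructor
  · rintro ⟨u', rfl, hv⟩
    refine ⟨L u', L.mem_graph u', ?_⟩
    rintro ⟨v, z⟩ hp
    obtain ⟨v', hv', hz⟩ := (L.mem_graph_iff).1 hp
    simp only at hv' hz
    rw [← hv', ← hz]
    exact hv v'
  · rintro ⟨y, hy, hv⟩
    obtain ⟨u', hu', hy'⟩ := (L.mem_graph_iff).1 hy
    simp only at hu' hy'
    exact ⟨u', hu', fun v => by rw [hy']; exact hv _ (L.mem_graph v)⟩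

theorem squareFormOperator_graph {L : H →ₗ.[𝕜] H} (hL : IsNonposSelfAdjointGraph L.graph) :
    (squareFormOperator L).graph = squareGraph L.graph := by
  rw [squareFormOperator, squareFormGraph_eq_squareGraph hL]
  refine Submodule.toLinearPMap_graph_eq _ ?_
  rintro ⟨x, y⟩ h rfl
  exact hL.squareGraph_snd_eq_zero h

/-- Closability comes from self-adjointness: the closed graph is single-valued because the domain is
dense. -/
theorem toLinearPMap_closure_graph {Γ : Submodule 𝕜 (H × H)}
    (hΓ : IsNonposSelfAdjointGraph Γ.topologicalClosure) :
    Γ.toLinearPMap.closure.graph = Γ.topologicalClosure := by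
  have h1 : Γ.toLinearPMap.graph = Γ := Submodule.toLinearPMap_graph_eq _ (by
    rintro ⟨x, y⟩ h rfl
    exact hΓ.snd_eq_zero (Γ.le_topologicalClosure h))
  have h2 : Γ.toLinearPMap.IsClosable := by
    refine ⟨Γ.topologicalClosure.toLinearPMap, ?_⟩
    rw [h1, Submodule.toLinearPMap_graph_eq]
    rintro ⟨x, y⟩ h rfl
    exact hΓ.snd_eq_zero h
  rw [← h2.graph_closure_eq_closure_graph, h1]

end SelfAdjoint

/-! ### Averages over balls and inequalities of Sobolev and Morrey type -/

section Averages

theorem ennreal_add_sq_le (a b : ℝ≥0∞) : (a + b) ^ 2 ≤ 2 * a ^ 2 + 2 * b ^ 2 := by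
  have h := ENNReal.rpow_add_le_mul_rpow_add_rpow a b (p := 2) (by norm_num)
  norm_num at h
  rwa [mul_add] at h

theorem lintegral_mul_sq_le {α : Type*} [MeasurableSpace α] (μ : Measure α) {f g : α → ℝ≥0∞}
    (hf : AEMeasurable f μ) (hg : AEMeasurable g μ) :
    (∫⁻ x, f x * g x ∂μ) ^ 2 ≤ (∫⁻ x, f x ^ 2 ∂μ) * ∫⁻ x, g x ^ 2 ∂μ := by
  have h := ENNReal.lintegral_mul_le_Lp_mul_Lq μ Real.HolderConjugate.two_two hf hg
  have h2 := ENNReal.pow_le_pow_left h (n := 2)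
  rw [mul_pow, ← ENNReal.rpow_natCast, ← ENNReal.rpow_natCast, ← ENNReal.rpow_mul,
    ← ENNReal.rpow_natCast, ← ENNReal.rpow_mul] at h2
  norm_num at h2
  simpa [ENNReal.rpow_natCast] using h2

theorem lintegral_sq_le {α : Type*} [MeasurableSpace α] (μ : Measure α) {f : α → ℝ≥0∞}
    (hf : AEMeasurable f μ) :
    (∫⁻ x, f x ∂μ) ^ 2 ≤ μ Set.univ * ∫⁻ x, f x ^ 2 ∂μ := by
  simpa using lintegral_mul_sq_le μ (aemeasurable_const (b := 1)) hf

variable {E : Type*} [NormedAddCommGroup E] [NormedSpace ℝ E] [FiniteDimensional ℝ E]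
  [MeasurableSpace E] [BorelSpace E] (μ : Measure E) [μ.IsAddHaarMeasure]

/-- The (not normalized) average `∫_{|z| < 1} h (x + s z) dz`. -/
noncomputable def ballAvg (h : E → ℝ≥0∞) (s : ℝ) (x : E) : ℝ≥0∞ :=
  ∫⁻ z in Metric.ball 0 1, h (x + s • z) ∂μ

theorem measurable_ballAvg {h : E → ℝ≥0∞} (hh : Measurable h) :
    Measurable fun p : E × ℝ => ballAvg μ h p.2 p.1 := by
  unfold ballAvg
  refine Measurable.lintegral_prod_right' (f := fun q : (E × ℝ) × E => h (q.1.1 + q.1.2 • q.2)) ?_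
  fun_prop

theorem ballAvg_add_le {f g h : E → ℝ≥0∞} (hg : Measurable g) (hfg : ∀ x, f x ≤ g x + h x)
    (s : ℝ) (x : E) : ballAvg μ f s x ≤ ballAvg μ g s x + ballAvg μ h s x := by
  unfold ballAvg
  rw [← lintegral_add_left (by fun_prop)]
  exact lintegral_mono fun z => hfg _

theorem lintegral_comp_add_smul {h : E → ℝ≥0∞} (hh : Measurable h) {s : ℝ} (hs : s ≠ 0) (x : E) :
    ∫⁻ z, h (x + s • z) ∂μ = ENNReal.ofReal (|s| ^ (-(Module.finrank ℝ E : ℝ))) * ∫⁻ z, h z ∂μ := by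
  have h1 : ∫⁻ z, h (x + s • z) ∂μ = ∫⁻ w, h (x + w) ∂(μ.map fun z => s • z) := by
    rw [lintegral_map (by fun_prop) (by fun_prop)]
  rw [h1, Measure.map_addHaar_smul μ hs, lintegral_smul_measure, smul_eq_mul,
    lintegral_add_left_eq_self (fun w => h w) x, abs_inv, abs_pow, Real.rpow_neg (abs_nonneg _),
    Real.rpow_natCast]

/-- The Morrey bound for functions in `L^q`. -/
theorem ballAvg_le_of_lintegral_rpow {h : E → ℝ≥0∞} (hh : Measurable h) {q : ℝ} (hq : 1 ≤ q)
    (hint : ∫⁻ x, h x ^ q ∂μ < ⊤) : ∃ C : ℝ≥0, ∀ s : ℝ, s ≠ 0 → ∀ x,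
      ballAvg μ h s x ≤ C * ENNReal.ofReal (|s| ^ (-(Module.finrank ℝ E / q : ℝ))) := by
  set κ := μ (Metric.ball (0 : E) 1) with hκ
  have hκ_top : κ ≠ ⊤ := measure_ball_lt_top.ne
  have hq0 : 0 < q := by linarith
  have hC : κ ^ (1 - 1 / q) * (∫⁻ x, h x ^ q ∂μ) ^ (1 / q) ≠ ⊤ := by
    refine ENNReal.mul_ne_top (ENNReal.rpow_ne_top_of_nonneg ?_ hκ_top)
      (ENNReal.rpow_ne_top_of_nonneg (by positivity) hint.ne)
    rw [sub_nonneg, div_le_one hq0]; exact hq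
  refine ⟨(κ ^ (1 - 1 / q) * (∫⁻ x, h x ^ q ∂μ) ^ (1 / q)).toNNReal, fun s hs x => ?_⟩
  rw [ENNReal.coe_toNNReal hC]
  -- Hölder against the constant 1 on the unit ball. The change of variables z ↦ x + sz gives the
  -- factor |s|^(-dim E), and the power 1/q turns it into |s|^(-dim E/q).
  have h1 := ENNReal.lintegral_mul_norm_pow_le (μ := μ.restrict (Metric.ball (0 : E) 1))
    (f := fun _ => 1) (g := fun z => h (x + s • z) ^ q) (p := 1 - 1 / q) (q := 1 / q)
    aemeasurable_const (by fun_prop) (by rw [sub_nonneg, div_le_one hq0]; exact hq)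
    (by positivity) (by ring)
  have h2 : ∀ y : ℝ≥0∞, (y ^ q) ^ (1 / q) = y := fun y => by
    rw [← ENNReal.rpow_mul, mul_one_div_cancel hq0.ne', ENNReal.rpow_one]
  simp only [ENNReal.one_rpow, one_mul, h2, lintegral_const, Measure.restrict_apply_univ] at h1
  refine h1.trans ?_
  have h3 : ∫⁻ z in Metric.ball (0 : E) 1, h (x + s • z) ^ q ∂μ ≤
      ENNReal.ofReal (|s| ^ (-(Module.finrank ℝ E : ℝ))) * ∫⁻ z, h z ^ q ∂μ := by
    rw [← lintegral_comp_add_smul μ (h := fun y => h y ^ q) (by fun_prop) hs x]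
    exact setLIntegral_le_lintegral _ _
  calc _ ≤ κ ^ (1 - 1 / q) * (ENNReal.ofReal (|s| ^ (-(Module.finrank ℝ E : ℝ))) *
        ∫⁻ z, h z ^ q ∂μ) ^ (1 / q) := by gcongr
    _ = _ := by
      rw [ENNReal.mul_rpow_of_nonneg _ _ (by positivity),
        ENNReal.ofReal_rpow_of_nonneg (by positivity) (by positivity), ← Real.rpow_mul (abs_nonneg _),
        mul_comm (ENNReal.ofReal _), ← mul_assoc]
      congr 3
      ring

/-- A `C¹` function is bounded pointwise by averages of itself and of its derivative. -/
theorem enorm_le_ballAvg {f : E → ℝ} (hf : ContDiff ℝ 1 f) {δ : ℝ} (hδ : 0 ≤ δ) (x : E) :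
    μ (Metric.ball (0 : E) 1) * ‖f x‖ₑ ≤ ballAvg μ (fun y => ‖f y‖ₑ) δ x +
      ENNReal.ofReal δ * ∫⁻ t in Set.Ioo (0 : ℝ) 1,
        ballAvg μ (fun y => ‖fderiv ℝ f y‖ₑ) (t * δ) x := by
  have hc : Continuous (fderiv ℝ f) := hf.continuous_fderiv (by simp)
  have hfc : Continuous f := hf.continuous
  -- The fundamental theorem of calculus on the segment from x to x + δz; the claim follows by
  -- integrating over z.
  have hpt : ∀ z ∈ Metric.ball (0 : E) 1, ‖f x‖ₑ ≤ ‖f (x + δ • z)‖ₑ +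
      ENNReal.ofReal δ * ∫⁻ t in Set.Ioo (0 : ℝ) 1, ‖fderiv ℝ f (x + (t * δ) • z)‖ₑ := by
    intro z hz
    have hz1 : ‖z‖ ≤ 1 := by simpa using (mem_ball_zero_iff.1 hz).le
    have hd : ∀ t : ℝ, HasDerivAt (fun t : ℝ => f (x + (t * δ) • z))
        (fderiv ℝ f (x + (t * δ) • z) (δ • z)) t := by
      intro t
      have h1 : HasDerivAt (fun t : ℝ => x + (t * δ) • z) (δ • z) t := by
        simpa using (((hasDerivAt_id t).mul_const δ).smul_const z).const_add x
      exact ((hf.differentiable (by simp)) _).hasFDerivAt.comp_hasDerivAt t h1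
    have hint := intervalIntegral.integral_eq_sub_of_hasDerivAt (a := 0) (b := 1)
      (fun t _ => hd t) (Continuous.intervalIntegrable (by fun_prop) _ _)
    simp only [one_mul, zero_mul, zero_smul, add_zero] at hint
    have h2 : f x = f (x + δ • z) -
        ∫ t in Set.Ioo (0 : ℝ) 1, fderiv ℝ f (x + (t * δ) • z) (δ • z) := by
      rw [← integral_Ioc_eq_integral_Ioo, ← intervalIntegral.integral_of_le zero_le_one, hint]
      ring
    rw [h2]
    refine enorm_sub_le.trans ?_
    gcongr
    refine (enorm_integral_le_lintegral_enorm _).trans ?_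
    rw [← lintegral_const_mul' _ _ ENNReal.ofReal_ne_top]
    refine lintegral_mono fun t => ?_
    refine (ContinuousLinearMap.le_opENorm _ _).trans ?_
    rw [mul_comm, enorm_smul, Real.enorm_of_nonneg hδ]
    gcongr
    calc _ ≤ ENNReal.ofReal δ * 1 := by
          gcongr
          rw [← ofReal_norm]
          exact ENNReal.ofReal_le_one.2 hz1
      _ = _ := mul_one _
  have h3 : μ (Metric.ball (0 : E) 1) * ‖f x‖ₑ = ∫⁻ z in Metric.ball (0 : E) 1, ‖f x‖ₑ ∂μ := by
    rw [lintegral_const, Measure.restrict_apply_univ, mul_comm]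
  rw [h3]
  refine (setLIntegral_mono' Metric.isOpen_ball.measurableSet hpt).trans ?_
  have hm : Measurable fun z : E => ‖f (x + δ • z)‖ₑ :=
    (hfc.comp (by fun_prop : Continuous fun z : E => x + δ • z)).enorm.measurable
  have hm2 : Measurable (Function.uncurry fun (z : E) (t : ℝ) =>
      ‖fderiv ℝ f (x + (t * δ) • z)‖ₑ) :=
    (hc.comp (by fun_prop : Continuous fun p : E × ℝ => x + (p.2 * δ) • p.1)).enorm.measurable
  rw [lintegral_add_left hm, lintegral_const_mul' _ _ ENNReal.ofReal_ne_top,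
    lintegral_lintegral_swap hm2.aemeasurable]
  rfl

variable {μ}

/-- Fubini and translation invariance move the average from g to W, with s replaced by -s. -/
theorem lintegral_mul_ballAvg_le {W g : E → ℝ≥0∞} (hW : Measurable W) (hg : Measurable g) {s : ℝ}
    {K : ℝ≥0∞} (hK : ∀ y, ballAvg μ W (-s) y ≤ K) :
    ∫⁻ x, W x * ballAvg μ g s x ∂μ ≤ K * ∫⁻ x, g x ∂μ := by
  calc ∫⁻ x, W x * ballAvg μ g s x ∂μ
      = ∫⁻ x, ∫⁻ z in Metric.ball 0 1, W x * g (x + s • z) ∂μ ∂μ := by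
        refine lintegral_congr fun x => ?_
        rw [ballAvg, lintegral_const_mul _ (by fun_prop)]
    _ = ∫⁻ z in Metric.ball 0 1, ∫⁻ x, W x * g (x + s • z) ∂μ ∂μ :=
        lintegral_lintegral_swap (by fun_prop)
    _ = ∫⁻ z in Metric.ball 0 1, ∫⁻ y, W (y + (-s) • z) * g y ∂μ ∂μ := by
        refine lintegral_congr fun z => ?_
        rw [← lintegral_add_right_eq_self (fun y => W (y + (-s) • z) * g y) (s • z)]
        simp
    _ = ∫⁻ y, ∫⁻ z in Metric.ball 0 1, W (y + (-s) • z) * g y ∂μ ∂μ :=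
        lintegral_lintegral_swap (by fun_prop)
    _ = ∫⁻ y, ballAvg μ W (-s) y * g y ∂μ := by
        refine lintegral_congr fun y => ?_
        rw [ballAvg, lintegral_mul_const _ (by fun_prop)]
    _ ≤ ∫⁻ y, K * g y ∂μ := lintegral_mono fun y => by gcongr; exact hK y
    _ = _ := lintegral_const_mul _ hg

theorem ballAvg_sq_le {h : E → ℝ≥0∞} (hh : Measurable h) (s : ℝ) (x : E) :
    ballAvg μ h s x ^ 2 ≤ μ (Metric.ball (0 : E) 1) * ballAvg μ (fun y => h y ^ 2) s x := by
  have := lintegral_sq_le (μ.restrict (Metric.ball (0 : E) 1)) (f := fun z => h (x + s • z))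
    (by fun_prop)
  simpa [ballAvg] using this

theorem lintegral_Ioo_rpow_lt_top {α : ℝ} (hα : α < 1) :
    ∫⁻ t in Set.Ioo (0 : ℝ) 1, ENNReal.ofReal (t ^ (-α)) < ⊤ := by
  have h1 : IntervalIntegrable (fun t : ℝ => t ^ (-α)) volume 0 1 :=
    intervalIntegral.intervalIntegrable_rpow' (by linarith)
  rw [intervalIntegrable_iff_integrableOn_Ioo_of_le zero_le_one] at h1
  have h2 := h1.2
  rw [hasFiniteIntegral_iff_enorm] at h2
  refine lt_of_le_of_lt (setLIntegral_mono' measurableSet_Ioo fun t ht => ?_) h2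
  rw [Real.enorm_of_nonneg (Real.rpow_nonneg ht.1.le _)]

/-- A weight `W` in a Morrey class. -/
def IsMorreyWeight (μ : Measure E) (W : E → ℝ≥0∞) (α : ℝ) : Prop :=
  Measurable W ∧ ∃ C : ℝ≥0, ∀ s : ℝ, s ≠ 0 → ∀ x,
    ballAvg μ W s x ≤ C * ENNReal.ofReal (|s| ^ (-(2 * α)))

/-- Cauchy–Schwarz in t with the weights t^(-α/2) and t^(α/2) leaves t^α inside; moving the average
onto W costs (tδ)^(-2α). The net power t^(-α) is integrable for α < 1, which is how this is used. -/
theorem lintegral_weight_mul_integral_ballAvg_sq_le {W h : E → ℝ≥0∞} (hW : Measurable W)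
    (hh : Measurable h) {α δ : ℝ} (hδ : 0 < δ) {C : ℝ≥0}
    (hC : ∀ s : ℝ, s ≠ 0 → ∀ x, ballAvg μ W s x ≤ C * ENNReal.ofReal (|s| ^ (-(2 * α)))) :
    ∫⁻ x, W x * (∫⁻ t in Set.Ioo (0 : ℝ) 1, ballAvg μ h (t * δ) x) ^ 2 ∂μ ≤
      (∫⁻ t in Set.Ioo (0 : ℝ) 1, ENNReal.ofReal (t ^ (-α))) ^ 2 * μ (Metric.ball (0 : E) 1) * C *
        ENNReal.ofReal (δ ^ (-(2 * α))) * ∫⁻ x, h x ^ 2 ∂μ := by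
  set c := ∫⁻ t in Set.Ioo (0 : ℝ) 1, ENNReal.ofReal (t ^ (-α)) with hc
  set κ := μ (Metric.ball (0 : E) 1)
  have hm : Measurable fun p : E × ℝ => ballAvg μ h (p.2 * δ) p.1 :=
    (measurable_ballAvg μ hh).comp (f := fun p : E × ℝ => (p.1, p.2 * δ)) (by fun_prop)
  have hm2 : Measurable fun p : E × ℝ => ballAvg μ (fun y => h y ^ 2) (p.2 * δ) p.1 :=
    (measurable_ballAvg μ (hh.pow_const 2)).comp (f := fun p : E × ℝ => (p.1, p.2 * δ))
      (by fun_prop)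
  have h1 : ∀ x, (∫⁻ t in Set.Ioo (0 : ℝ) 1, ballAvg μ h (t * δ) x) ^ 2 ≤
      c * ∫⁻ t in Set.Ioo (0 : ℝ) 1, ENNReal.ofReal (t ^ α) * (κ *
        ballAvg μ (fun y => h y ^ 2) (t * δ) x) := by
    intro x
    have h2 : ∫⁻ t in Set.Ioo (0 : ℝ) 1, ballAvg μ h (t * δ) x =
        ∫⁻ t in Set.Ioo (0 : ℝ) 1, ENNReal.ofReal (t ^ (-(α / 2))) *
          (ENNReal.ofReal (t ^ (α / 2)) * ballAvg μ h (t * δ) x) := by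
      refine setLIntegral_congr_fun measurableSet_Ioo fun t ht => ?_
      rw [← mul_assoc, ← ENNReal.ofReal_mul (Real.rpow_nonneg ht.1.le _), ← Real.rpow_add ht.1,
        neg_add_cancel, Real.rpow_zero, ENNReal.ofReal_one, one_mul]
    have hmx : Measurable fun t : ℝ => ballAvg μ h (t * δ) x :=
      hm.comp (f := fun t : ℝ => (x, t)) (by fun_prop)
    rw [h2]
    refine (lintegral_mul_sq_le _ (by fun_prop) (by fun_prop)).trans ?_
    refine mul_le_mul' (le_of_eq ?_) ?_
    · refine setLIntegral_congr_fun measurableSet_Ioo fun t ht => ?_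
      rw [← ENNReal.ofReal_pow (Real.rpow_nonneg ht.1.le _), ← Real.rpow_mul_natCast ht.1.le]
      congr 2; push_cast; ring
    · refine setLIntegral_mono' measurableSet_Ioo fun t ht => ?_
      rw [mul_pow, ← ENNReal.ofReal_pow (Real.rpow_nonneg ht.1.le _),
        ← Real.rpow_mul_natCast ht.1.le]
      refine mul_le_mul' (le_of_eq ?_) (ballAvg_sq_le hh _ _)
      congr 2; push_cast; ring
  calc _ ≤ ∫⁻ x, W x * (c * ∫⁻ t in Set.Ioo (0 : ℝ) 1, ENNReal.ofReal (t ^ α) * (κ *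
        ballAvg μ (fun y => h y ^ 2) (t * δ) x)) ∂μ := lintegral_mono fun x => by gcongr; exact h1 x
    _ = ∫⁻ x, (∫⁻ t in Set.Ioo (0 : ℝ) 1, (c * κ * ENNReal.ofReal (t ^ α)) * (W x *
        ballAvg μ (fun y => h y ^ 2) (t * δ) x)) ∂μ := by
      refine lintegral_congr fun x => ?_
      have hmx : Measurable fun t : ℝ => ballAvg μ (fun y => h y ^ 2) (t * δ) x :=
        hm2.comp (f := fun t : ℝ => (x, t)) (by fun_prop)
      rw [← mul_assoc, ← lintegral_const_mul _ (by fun_prop)]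
      refine lintegral_congr fun t => ?_
      ring
    _ = ∫⁻ t in Set.Ioo (0 : ℝ) 1, ∫⁻ x, (c * κ * ENNReal.ofReal (t ^ α)) * (W x *
        ballAvg μ (fun y => h y ^ 2) (t * δ) x) ∂μ := by
      refine lintegral_lintegral_swap (Measurable.aemeasurable ?_)
      exact ((measurable_const.mul (by fun_prop)).mul ((hW.comp measurable_fst).mul hm2))
    _ ≤ ∫⁻ t in Set.Ioo (0 : ℝ) 1, (c * κ * C * ENNReal.ofReal (δ ^ (-(2 * α))) *
          ∫⁻ x, h x ^ 2 ∂μ) * ENNReal.ofReal (t ^ (-α)) := by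
      refine setLIntegral_mono' measurableSet_Ioo fun t ht => ?_
      have hmx : Measurable fun x : E => ballAvg μ (fun y => h y ^ 2) (t * δ) x :=
        hm2.comp (f := fun x : E => (x, t)) (by fun_prop)
      rw [lintegral_const_mul _ (by fun_prop)]
      have htδ : 0 < t * δ := mul_pos ht.1 hδ
      have h4 := lintegral_mul_ballAvg_le (μ := μ) hW (hh.pow_const 2) (s := t * δ)
        (fun y => hC (-(t * δ)) (neg_ne_zero.2 htδ.ne') y)
      refine (mul_le_mul_right h4 _).trans (le_of_eq ?_)
      rw [abs_neg, abs_of_pos htδ, Real.mul_rpow ht.1.le hδ.le,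
        ENNReal.ofReal_mul (Real.rpow_nonneg ht.1.le _)]
      have h5 : ENNReal.ofReal (t ^ α) * ENNReal.ofReal (t ^ (-(2 * α))) =
          ENNReal.ofReal (t ^ (-α)) := by
        rw [← ENNReal.ofReal_mul (Real.rpow_nonneg ht.1.le _), ← Real.rpow_add ht.1]
        congr 2; ring
      rw [← h5]; ring
    _ = _ := by
      rw [lintegral_const_mul _ (by fun_prop), ← hc]; ring

/-- Functions in `H¹` are square integrable against weights of a Morrey class, with small constant
in front of the derivative. -/
theorem IsMorreyWeight.exists_lintegral_le {W : E → ℝ≥0∞} {α : ℝ} (hα : α < 1)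
    (hW : IsMorreyWeight μ W α) {ε : ℝ≥0} (hε : 0 < ε) : ∃ K : ℝ≥0, ∀ f : E → ℝ, ContDiff ℝ 1 f →
      ∫⁻ x, W x * ‖f x‖ₑ ^ 2 ∂μ ≤ ε * ∫⁻ x, ‖fderiv ℝ f x‖ₑ ^ 2 ∂μ + K * ∫⁻ x, ‖f x‖ₑ ^ 2 ∂μ := by
  obtain ⟨hWm, C, hC⟩ := hW
  set κ := μ (Metric.ball (0 : E) 1) with hκ
  have hκ_top : κ ≠ ⊤ := measure_ball_lt_top.ne
  have hκ0 : κ ≠ 0 := (Metric.measure_ball_pos μ _ one_pos).ne'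
  set c := ∫⁻ t in Set.Ioo (0 : ℝ) 1, ENNReal.ofReal (t ^ (-α)) with hc
  have hc_top : c ≠ ⊤ := (lintegral_Ioo_rpow_lt_top hα).ne
  -- The gradient term carries δ² from the segment length and δ^(-2α) from the weight. As α < 1 the
  -- total power 2 - 2α is positive, so the coefficient can be made small at the price of a large
  -- multiple of ∫ f².
  have hB : ∀ δ : ℝ, 0 < δ → ∀ f : E → ℝ, ContDiff ℝ 1 f → κ ^ 2 * ∫⁻ x, W x * ‖f x‖ₑ ^ 2 ∂μ ≤
      (2 * c ^ 2 * κ * C * ENNReal.ofReal (δ ^ (2 - 2 * α))) * ∫⁻ x, ‖fderiv ℝ f x‖ₑ ^ 2 ∂μ +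
      (2 * κ * C * ENNReal.ofReal (δ ^ (-(2 * α)))) * ∫⁻ x, ‖f x‖ₑ ^ 2 ∂μ := by
    intro δ hδ f hf
    have hfm : Measurable fun x => ‖f x‖ₑ := hf.continuous.enorm.measurable
    have hdm : Measurable fun x => ‖fderiv ℝ f x‖ₑ :=
      (hf.continuous_fderiv (by simp)).enorm.measurable
    have hav : Measurable fun x => ballAvg μ (fun y => ‖f y‖ₑ ^ 2) δ x :=
      (measurable_ballAvg μ (hfm.pow_const 2)).comp (f := fun x : E => (x, δ)) (by fun_prop)
    rw [← lintegral_const_mul _ (by fun_prop)]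
    calc _ ≤ ∫⁻ x, ((2 * κ) * (W x * ballAvg μ (fun y => ‖f y‖ₑ ^ 2) δ x) +
          (2 * ENNReal.ofReal δ ^ 2) * (W x * (∫⁻ t in Set.Ioo (0 : ℝ) 1,
            ballAvg μ (fun y => ‖fderiv ℝ f y‖ₑ) (t * δ) x) ^ 2)) ∂μ := by
          refine lintegral_mono fun x => ?_
          have h1 := ENNReal.pow_le_pow_left (n := 2) (enorm_le_ballAvg μ hf hδ.le x)
          have h2 := (h1.trans (ennreal_add_sq_le _ _)).trans (add_le_add_left
            (mul_le_mul_right (ballAvg_sq_le hfm δ x) 2) _)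
          calc κ ^ 2 * (W x * ‖f x‖ₑ ^ 2) = W x * (κ * ‖f x‖ₑ) ^ 2 := by ring
            _ ≤ _ := mul_le_mul_right h2 _
            _ = _ := by ring
      _ = (2 * κ) * ∫⁻ x, W x * ballAvg μ (fun y => ‖f y‖ₑ ^ 2) δ x ∂μ +
          (2 * ENNReal.ofReal δ ^ 2) * ∫⁻ x, W x * (∫⁻ t in Set.Ioo (0 : ℝ) 1,
            ballAvg μ (fun y => ‖fderiv ℝ f y‖ₑ) (t * δ) x) ^ 2 ∂μ := by
          rw [lintegral_add_left (by fun_prop), lintegral_const_mul _ (by fun_prop),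
            lintegral_const_mul' _ _ (by finiteness)]
      _ ≤ (2 * κ) * ((C * ENNReal.ofReal (δ ^ (-(2 * α)))) * ∫⁻ x, ‖f x‖ₑ ^ 2 ∂μ) +
          (2 * ENNReal.ofReal δ ^ 2) * (c ^ 2 * κ * C *
            ENNReal.ofReal (δ ^ (-(2 * α))) * ∫⁻ x, ‖fderiv ℝ f x‖ₑ ^ 2 ∂μ) := by
          gcongr
          · refine lintegral_mul_ballAvg_le hWm (hfm.pow_const 2) fun y => ?_
            have := hC (-δ) (neg_ne_zero.2 hδ.ne') y
            rwa [abs_neg, abs_of_pos hδ] at this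
          · exact lintegral_weight_mul_integral_ballAvg_sq_le hWm hdm hδ hC
      _ = _ := by
          have : ENNReal.ofReal (δ ^ (2 - 2 * α)) =
              ENNReal.ofReal δ ^ 2 * ENNReal.ofReal (δ ^ (-(2 * α))) := by
            rw [← ENNReal.ofReal_pow hδ.le, ← ENNReal.ofReal_mul (by positivity), sub_eq_add_neg,
              Real.rpow_add hδ]
            norm_num
          rw [this]; ring
  -- choose `δ` small
  have hlim : Tendsto (fun δ : ℝ => (2 * c ^ 2 * κ * C * ENNReal.ofReal (δ ^ (2 - 2 * α))) / κ ^ 2)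
      (𝓝[>] 0) (𝓝 0) := by
    have h1 : Tendsto (fun δ : ℝ => δ ^ (2 - 2 * α)) (𝓝[>] 0) (𝓝 0) := by
      have h2 : Continuous fun δ : ℝ => δ ^ (2 - 2 * α) :=
        Real.continuous_rpow_const (by linarith)
      have h3 := h2.tendsto 0
      rw [Real.zero_rpow (by linarith)] at h3
      exact h3.mono_left nhdsWithin_le_nhds
    have h2 := ENNReal.tendsto_ofReal h1
    have h3 := ENNReal.Tendsto.const_mul (a := 2 * c ^ 2 * κ * C) h2 (Or.inr (by finiteness))
    have h4 := ENNReal.Tendsto.div_const h3 (b := κ ^ 2) (Or.inr (by positivity))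
    simpa using h4
  obtain ⟨δ, hδε, hδ⟩ := ((hlim.eventually (gt_mem_nhds (show (0 : ℝ≥0∞) < ε by
    exact_mod_cast hε))).and self_mem_nhdsWithin).exists
  have hδ' : 0 < δ := hδ
  have hκ2 : κ ^ 2 ≠ 0 := by positivity
  have hκ2t : κ ^ 2 ≠ ⊤ := by finiteness
  have hKt : (2 * κ * C * ENNReal.ofReal (δ ^ (-(2 * α)))) / κ ^ 2 ≠ ⊤ :=
    ENNReal.div_ne_top (by finiteness) hκ2
  refine ⟨((2 * κ * C * ENNReal.ofReal (δ ^ (-(2 * α)))) / κ ^ 2).toNNReal, fun f hf => ?_⟩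
  rw [ENNReal.coe_toNNReal hKt]
  have h1 := hB δ hδ' f hf
  rw [mul_comm, ← ENNReal.le_div_iff_mul_le (Or.inl hκ2) (Or.inl hκ2t)] at h1
  refine h1.trans ?_
  rw [ENNReal.add_div, ENNReal.mul_div_right_comm,
    ENNReal.mul_div_right_comm (a := 2 * κ * C * ENNReal.ofReal (δ ^ (-(2 * α))))]
  exact add_le_add_left (mul_le_mul_left hδε.le _) _

end Averages

/-! ### A Morrey embedding and mollification -/

section Morrey

variable {E : Type*} [NormedAddCommGroup E] [NormedSpace ℝ E] [FiniteDimensional ℝ E]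
  [MeasurableSpace E] [BorelSpace E] {μ : Measure E} [μ.IsAddHaarMeasure]

theorem lintegral_ballAvg_le {g : E → ℝ≥0∞} (hg : Measurable g) (s : ℝ) (S : Set E) :
    ∫⁻ x in S, ballAvg μ g s x ∂μ ≤ μ (Metric.ball (0 : E) 1) * ∫⁻ x, g x ∂μ := by
  refine (setLIntegral_le_lintegral _ _).trans ?_
  have := lintegral_mul_ballAvg_le (μ := μ) (W := fun _ => 1) measurable_const hg (s := s)
    (K := μ (Metric.ball (0 : E) 1)) (fun y => by simp [ballAvg])
  simpa using this

/-- Morrey's embedding: limits in `W^{1,1}` of `C¹` functions, such that the limit and a bound of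
its gradient satisfy Morrey bounds, are bounded. -/
theorem exists_ae_bound_of_morrey {f : ℕ → E → ℝ} {F : E → ℝ} {g : E → ℝ≥0∞}
    {r : ℕ → E → ℝ≥0∞} (hf : ∀ n, ContDiff ℝ 1 (f n)) (hF : Measurable F) (hg : Measurable g)
    (hr : ∀ n, Measurable (r n)) (hgr : ∀ n x, ‖fderiv ℝ (f n) x‖ₑ ≤ g x + r n x)
    (hlimF : Tendsto (fun n => ∫⁻ x, ‖f n x - F x‖ₑ ∂μ) atTop (𝓝 0))
    (hlimr : Tendsto (fun n => ∫⁻ x, r n x ∂μ) atTop (𝓝 0)) {α : ℝ} (hα : α < 1) {C₁ C₂ : ℝ≥0}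
    (hC₁ : ∀ x, ballAvg μ (fun y => ‖F y‖ₑ) 1 x ≤ C₁)
    (hC₂ : ∀ s : ℝ, s ≠ 0 → ∀ x, ballAvg μ g s x ≤ C₂ * ENNReal.ofReal (|s| ^ (-α))) :
    ∃ K : ℝ≥0, ∀ᵐ x ∂μ, ‖F x‖ₑ ≤ K := by
  set κ := μ (Metric.ball (0 : E) 1) with hκ
  have hκ_top : κ ≠ ⊤ := measure_ball_lt_top.ne
  have hκ0 : κ ≠ 0 := (Metric.measure_ball_pos μ _ one_pos).ne'
  set c := ∫⁻ t in Set.Ioo (0 : ℝ) 1, ENNReal.ofReal (t ^ (-α)) with hc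
  have hc_top : c ≠ ⊤ := (lintegral_Ioo_rpow_lt_top hα).ne
  have hFm : Measurable fun x => ‖F x‖ₑ := hF.enorm
  have hqm : ∀ n, Measurable fun x => ‖f n x - F x‖ₑ := fun n =>
    ((hf n).continuous.measurable.sub hF).enorm
  have hpt : ∀ n x, κ * ‖f n x‖ₑ ≤ (C₁ + C₂ * c) + (ballAvg μ (fun y => ‖f n y - F y‖ₑ) 1 x +
      ∫⁻ t in Set.Ioo (0 : ℝ) 1, ballAvg μ (r n) t x) := by
    intro n x
    have h1 := enorm_le_ballAvg μ (hf n) zero_le_one x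
    rw [ENNReal.ofReal_one, one_mul] at h1
    refine h1.trans ?_
    have h2 : ballAvg μ (fun y => ‖f n y‖ₑ) 1 x ≤ C₁ + ballAvg μ (fun y => ‖f n y - F y‖ₑ) 1 x := by
      refine (ballAvg_add_le μ hFm (fun y => ?_) 1 x).trans (add_le_add_left (hC₁ x) _)
      calc ‖f n y‖ₑ = ‖F y + (f n y - F y)‖ₑ := by rw [add_sub_cancel]
        _ ≤ _ := enorm_add_le _ _
    have h3 : ∫⁻ t in Set.Ioo (0 : ℝ) 1, ballAvg μ (fun y => ‖fderiv ℝ (f n) y‖ₑ) (t * 1) x ≤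
        C₂ * c + ∫⁻ t in Set.Ioo (0 : ℝ) 1, ballAvg μ (r n) t x := by
      rw [hc, ← lintegral_const_mul _ (by fun_prop), ← lintegral_add_left (by fun_prop)]
      refine setLIntegral_mono' measurableSet_Ioo fun t ht => ?_
      rw [mul_one]
      refine (ballAvg_add_le μ hg (hgr n) t x).trans (add_le_add_left ?_ _)
      have := hC₂ t ht.1.ne' x
      rwa [abs_of_pos ht.1] at this
    calc _ ≤ (C₁ + ballAvg μ (fun y => ‖f n y - F y‖ₑ) 1 x) +
          (C₂ * c + ∫⁻ t in Set.Ioo (0 : ℝ) 1, ballAvg μ (r n) t x) := add_le_add h2 h3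
      _ = _ := by ring
  -- The errors tend to zero only in L¹, so the bound is passed to the limit in integrated form over
  -- sets of finite measure, which is enough for an a.e. inequality.
  have hS : ∀ S, MeasurableSet S → μ S < ⊤ →
      ∫⁻ x in S, κ * ‖F x‖ₑ ∂μ ≤ ∫⁻ _ in S, (C₁ + C₂ * c) ∂μ := by
    intro S hS hSt
    have hn : ∀ n, ∫⁻ x in S, κ * ‖F x‖ₑ ∂μ ≤ ∫⁻ _ in S, (C₁ + C₂ * c) ∂μ +
        (κ * ∫⁻ x, ‖f n x - F x‖ₑ ∂μ + κ * ∫⁻ x, r n x ∂μ + κ * ∫⁻ x, ‖f n x - F x‖ₑ ∂μ) := by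
      intro n
      have hm1 : Measurable fun x => ballAvg μ (fun y => ‖f n y - F y‖ₑ) 1 x :=
        (measurable_ballAvg μ (hqm n)).comp (f := fun x : E => (x, (1 : ℝ))) (by fun_prop)
      calc ∫⁻ x in S, κ * ‖F x‖ₑ ∂μ
          ≤ ∫⁻ x in S, ((C₁ + C₂ * c) + (ballAvg μ (fun y => ‖f n y - F y‖ₑ) 1 x +
            ((∫⁻ t in Set.Ioo (0 : ℝ) 1, ballAvg μ (r n) t x) + κ * ‖f n x - F x‖ₑ))) ∂μ := by
            refine lintegral_mono fun x => ?_
            calc κ * ‖F x‖ₑ ≤ κ * (‖f n x‖ₑ + ‖f n x - F x‖ₑ) := by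
                  gcongr
                  calc ‖F x‖ₑ = ‖f n x - (f n x - F x)‖ₑ := by rw [sub_sub_cancel]
                    _ ≤ _ := enorm_sub_le
              _ ≤ _ := by
                  rw [mul_add]
                  refine (add_le_add_left (hpt n x) _).trans (le_of_eq ?_)
                  ring
        _ = ∫⁻ _ in S, (C₁ + C₂ * c) ∂μ + (∫⁻ x in S, ballAvg μ (fun y => ‖f n y - F y‖ₑ) 1 x ∂μ +
            ((∫⁻ x in S, ∫⁻ t in Set.Ioo (0 : ℝ) 1, ballAvg μ (r n) t x ∂volume ∂μ) +
              ∫⁻ x in S, κ * ‖f n x - F x‖ₑ ∂μ)) := by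
            rw [lintegral_add_left (by fun_prop), lintegral_add_left hm1,
              lintegral_add_right _ ((hqm n).const_mul _)]
        _ ≤ _ := by
            rw [add_assoc (κ * _)]
            gcongr
            · exact lintegral_ballAvg_le (hqm n) 1 S
            · rw [lintegral_lintegral_swap (measurable_ballAvg μ (hr n)).aemeasurable]
              calc _ ≤ ∫⁻ t in Set.Ioo (0 : ℝ) 1, κ * ∫⁻ x, r n x ∂μ :=
                    lintegral_mono fun t => lintegral_ballAvg_le (hr n) t S
                _ = _ := by simp
            · rw [lintegral_const_mul _ (hqm n)]
              exact mul_le_mul_right (setLIntegral_le_lintegral _ _) _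
    have hlim : Tendsto (fun n => ∫⁻ _ in S, (C₁ + C₂ * c) ∂μ +
        (κ * ∫⁻ x, ‖f n x - F x‖ₑ ∂μ + κ * ∫⁻ x, r n x ∂μ + κ * ∫⁻ x, ‖f n x - F x‖ₑ ∂μ))
        atTop (𝓝 (∫⁻ _ in S, (C₁ + C₂ * c) ∂μ + (κ * 0 + κ * 0 + κ * 0))) := by
      have e1 := ENNReal.Tendsto.const_mul hlimF (Or.inr hκ_top)
      have e2 := ENNReal.Tendsto.const_mul hlimr (Or.inr hκ_top)
      exact ((e1.add e2).add e1).const_add _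
    simpa using ge_of_tendsto' hlim hn
  have hae := ae_le_of_forall_setLIntegral_le_of_sigmaFinite (hFm.const_mul κ) hS
  have hK : (C₁ + C₂ * c) / κ ≠ ⊤ := ENNReal.div_ne_top (by finiteness) hκ0
  refine ⟨((C₁ + C₂ * c) / κ).toNNReal, ?_⟩
  filter_upwards [hae] with x hx
  rw [ENNReal.coe_toNNReal hK, ENNReal.le_div_iff_mul_le (Or.inl hκ0) (Or.inl hκ_top), mul_comm]
  exact hx

end Morrey

/-! ### Mollification: a.e. and L¹ convergence, preservation of lower bounds -/

section Mollify

variable {E : Type*} [NormedAddCommGroup E] [NormedSpace ℝ E] [FiniteDimensional ℝ E]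
  [MeasurableSpace E] [BorelSpace E] {μ : Measure E} [μ.IsAddHaarMeasure]
  {F : Type*} [NormedAddCommGroup F] [NormedSpace ℝ F] [CompleteSpace F]

/-- A sequence of bump functions at the origin, with shrinking supports. -/
noncomputable def mollBump (E : Type*) [NormedAddCommGroup E] (n : ℕ) : ContDiffBump (0 : E) where
  rIn := 1 / (2 * ((n : ℝ) + 1))
  rOut := 1 / ((n : ℝ) + 1)
  rIn_pos := by positivity
  rIn_lt_rOut := by
    apply one_div_lt_one_div_of_lt <;> linarith [Nat.cast_nonneg (α := ℝ) n]

theorem mollBump_rOut_le (n : ℕ) : (mollBump E n).rOut ≤ 1 := by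
  change 1 / ((n : ℝ) + 1) ≤ 1
  rw [div_le_one (by positivity)]
  linarith [Nat.cast_nonneg (α := ℝ) n]

variable (μ) in
/-- The mollification kernels. -/
noncomputable def mollifier (n : ℕ) : E → ℝ := (mollBump E n).normed μ

variable (μ) in
/-- Mollification. -/
noncomputable def mollify (n : ℕ) (f : E → F) : E → F :=
  convolution (mollifier μ n) f (ContinuousLinearMap.lsmul ℝ ℝ) μ

theorem mollifier_nonneg (n : ℕ) (x : E) : 0 ≤ mollifier μ n x := (mollBump E n).nonneg_normed x

theorem mollifier_contDiff (n : ℕ) : ContDiff ℝ ∞ (mollifier μ n) := (mollBump E n).contDiff_normed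

theorem mollifier_continuous (n : ℕ) : Continuous (mollifier μ n) :=
  (mollifier_contDiff n).continuous

theorem mollifier_hasCompactSupport (n : ℕ) : HasCompactSupport (mollifier μ n) :=
  (mollBump E n).hasCompactSupport_normed

theorem mollifier_integrable (n : ℕ) : Integrable (mollifier μ n) μ :=
  (mollifier_continuous n).integrable_of_hasCompactSupport (mollifier_hasCompactSupport n)

theorem mollifier_integral (n : ℕ) : ∫ x, mollifier μ n x ∂μ = 1 := (mollBump E n).integral_normed

theorem mollifier_eq_zero {n : ℕ} {x : E} (hx : 1 ≤ ‖x‖) : mollifier μ n x = 0 := by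
  have : x ∉ Function.support ((mollBump E n).normed μ) := by
    rw [ContDiffBump.support_normed_eq, mem_ball_zero_iff, not_lt]
    exact (mollBump_rOut_le n).trans hx
  exact Function.notMem_support.1 this

theorem mollify_def (n : ℕ) (f : E → F) (x : E) :
    mollify μ n f x = ∫ t, mollifier μ n t • f (x - t) ∂μ := rfl

theorem mollify_eq_swap (n : ℕ) (f : E → F) (x : E) :
    mollify μ n f x = ∫ t, mollifier μ n (x - t) • f t ∂μ :=
  convolution_eq_swap _

theorem integrable_mollifier_smul {f : E → F} (hf : LocallyIntegrable f μ) (n : ℕ) (x : E) :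
    Integrable (fun t => mollifier μ n (x - t) • f t) μ := by
  refine hf.integrable_smul_left_of_hasCompactSupport ?_ ?_
  · exact (mollifier_continuous n).comp (by fun_prop)
  · exact (mollifier_hasCompactSupport n).comp_homeomorph (Homeomorph.subLeft x)

theorem mollify_ae_tendsto {f : E → F} (hf : LocallyIntegrable f μ) :
    ∀ᵐ x ∂μ, Tendsto (fun n => mollify μ n f x) atTop (𝓝 (f x)) := by
  -- K = 2 is the ratio of the outer to the inner radius of the bumps.
  refine ContDiffBump.ae_convolution_tendsto_right_of_locallyIntegrable (K := 2) ?_ ?_ hf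
  · exact tendsto_one_div_add_atTop_nhds_zero_nat
  · refine Eventually.of_forall fun n => le_of_eq ?_
    simp only [mollBump]
    field_simp

theorem norm_mollify_le (n : ℕ) (f : E → F) (x : E) :
    ‖mollify μ n f x‖ ≤ mollify μ n (fun y => ‖f y‖) x := by
  rw [mollify_def, mollify_def]
  refine (norm_integral_le_integral_norm _).trans (le_of_eq ?_)
  simp_rw [norm_smul, Real.norm_of_nonneg (mollifier_nonneg n _), smul_eq_mul]

theorem mollify_integrable {f : E → F} (hf : Integrable f μ) (n : ℕ) :
    Integrable (mollify μ n f) μ :=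
  (mollifier_integrable n).integrable_convolution _ hf

theorem mollify_contDiff {f : E → F} (hf : LocallyIntegrable f μ) (n : ℕ) :
    ContDiff ℝ ∞ (mollify μ n f) :=
  (mollifier_hasCompactSupport n).contDiff_convolution_left _ (mollifier_contDiff n) hf

/-- Fatou's lemma applied to u n = ρ_n∗|f| + |f| - |ρ_n∗f - f|, ρ_n being the mollifier. It is
nonnegative, tends to 2|f| a.e., and has integral 2‖f‖₁ minus the quantity in question. -/
theorem mollify_tendsto_integral {f : E → F} (hf : Integrable f μ) :
    Tendsto (fun n => ∫ x, ‖mollify μ n f x - f x‖ ∂μ) atTop (𝓝 0) := by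
  set a := 2 * ∫ x, ‖f x‖ ∂μ with ha
  set d : ℕ → ℝ := fun n => ∫ x, ‖mollify μ n f x - f x‖ ∂μ with hd
  have hint : ∀ n, ∫ x, mollify μ n (fun y => ‖f y‖) x ∂μ = ∫ x, ‖f x‖ ∂μ := by
    intro n
    have := integral_convolution (ContinuousLinearMap.lsmul ℝ ℝ) (mollifier_integrable (μ := μ) n)
      hf.norm
    rw [mollifier_integral] at this
    exact this.trans (by simp)
  let u : ℕ → E → ℝ := fun n x =>
    mollify μ n (fun y => ‖f y‖) x + ‖f x‖ - ‖mollify μ n f x - f x‖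
  have hu0 : ∀ n x, 0 ≤ u n x := fun n x => by
    have := norm_sub_le (mollify μ n f x) (f x)
    have := norm_mollify_le (μ := μ) n f x
    simp only [u]; linarith
  have hi1 : ∀ n, Integrable (mollify μ n (fun y => ‖f y‖)) μ := fun n => mollify_integrable hf.norm n
  have hi2 : ∀ n, Integrable (fun x => ‖mollify μ n f x - f x‖) μ := fun n =>
    ((mollify_integrable hf n).sub hf).norm
  have hui : ∀ n, Integrable (u n) μ := fun n => ((hi1 n).add hf.norm).sub (hi2 n)
  have hu : ∀ n, ∫ x, u n x ∂μ = a - d n := by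
    intro n
    have : ∫ x, u n x ∂μ = (∫ x, mollify μ n (fun y => ‖f y‖) x ∂μ + ∫ x, ‖f x‖ ∂μ) - d n := by
      exact (integral_sub ((hi1 n).add hf.norm) (hi2 n)).trans
        (congrArg (· - d n) (integral_add (hi1 n) hf.norm))
    rw [this, hint, ha]; ring
  have hd0 : ∀ n, 0 ≤ d n := fun n => integral_nonneg fun x => norm_nonneg _
  have hda : ∀ n, d n ≤ a := fun n => by
    have := integral_nonneg (μ := μ) (f := u n) (fun x => hu0 n x)
    rw [hu] at this; linarith
  have hfatou : ENNReal.ofReal a ≤ liminf (fun n => ENNReal.ofReal (a - d n)) atTop := by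
    have h1 := lintegral_liminf_le' (μ := μ) (u := atTop) (f := fun n x => ENNReal.ofReal (u n x))
      (fun n => (hui n).aestronglyMeasurable.aemeasurable.ennreal_ofReal)
    have h2 : ∫⁻ x, liminf (fun n => ENNReal.ofReal (u n x)) atTop ∂μ = ENNReal.ofReal a := by
      have h3 : ∀ᵐ x ∂μ, liminf (fun n => ENNReal.ofReal (u n x)) atTop =
          ENNReal.ofReal (2 * ‖f x‖) := by
        filter_upwards [mollify_ae_tendsto hf.locallyIntegrable,
          mollify_ae_tendsto hf.norm.locallyIntegrable] with x h4 h5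
        refine Tendsto.liminf_eq (ENNReal.tendsto_ofReal ?_)
        have h6 := (h5.add_const ‖f x‖).sub (h4.sub_const (f x)).norm
        simpa [two_mul] using h6
      rw [lintegral_congr_ae h3, ha, ← integral_const_mul, ofReal_integral_eq_lintegral_ofReal
        (hf.norm.const_mul 2) (Eventually.of_forall fun x => by positivity)]
    rw [h2] at h1
    refine h1.trans (le_of_eq ?_)
    congr 1
    ext n
    rw [← hu, ofReal_integral_eq_lintegral_ofReal (hui n) (Eventually.of_forall (hu0 n))]
  rcases eq_or_lt_of_le (show 0 ≤ a from (hd0 0).trans (hda 0)) with h0 | h0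
  · have : d = fun _ => 0 := by
      ext n; exact le_antisymm (h0 ▸ hda n) (hd0 n)
    rw [this]; exact tendsto_const_nhds
  · rw [Metric.tendsto_atTop']
    intro ε hε
    have h1 : ENNReal.ofReal (a - ε) < ENNReal.ofReal a :=
      (ENNReal.ofReal_lt_ofReal_iff h0).2 (by linarith)
    have h2 := eventually_lt_of_lt_liminf (h1.trans_le hfatou)
    obtain ⟨n₀, hn₀⟩ := eventually_atTop.1 h2
    refine ⟨n₀, fun n hn => ?_⟩
    have h3 := (ENNReal.ofReal_lt_ofReal_iff').1 (hn₀ n hn.le)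
    rw [Real.dist_eq, sub_zero, abs_of_nonneg (hd0 n)]
    linarith [h3.1]

theorem mollify_congr_of_eqOn {f g : E → F} {K : Set E} (hfg : ∀ y ∈ Metric.cthickening 1 K, f y = g y)
    (n : ℕ) {x : E} (hx : x ∈ K) : mollify μ n f x = mollify μ n g x := by
  rw [mollify_eq_swap, mollify_eq_swap]
  refine integral_congr_ae (Eventually.of_forall fun t => ?_)
  by_cases ht : 1 ≤ ‖x - t‖
  · simp [mollifier_eq_zero ht]
  · have : t ∈ Metric.cthickening 1 K := Metric.mem_cthickening_of_dist_le t x 1 K hx (by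
      rw [dist_eq_norm, norm_sub_rev]; exact (not_le.1 ht).le)
    simp only [hfg t this]

/-- The kernels live in the unit ball, so on K only the values of f in the unit neighbourhood of K
matter and f may be truncated there. -/
theorem mollify_tendsto_setLIntegral {f : E → F} (hf : LocallyIntegrable f μ) {K : Set E}
    (hK : IsCompact K) :
    Tendsto (fun n => ∫⁻ x in K, ‖mollify μ n f x - f x‖ₑ ∂μ) atTop (𝓝 0) := by
  set K' := Metric.cthickening 1 K
  have hK' : IsCompact K' := hK.cthickening
  set g := K'.indicator f with hg
  have hgi : Integrable g μ :=
    (hf.integrableOn_isCompact hK').integrable_indicator hK'.isClosed.measurableSet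
  have h1 := ENNReal.tendsto_ofReal (mollify_tendsto_integral hgi)
  rw [ENNReal.ofReal_zero] at h1
  refine tendsto_of_tendsto_of_tendsto_of_le_of_le tendsto_const_nhds h1 (fun _ => zero_le) fun n => ?_
  have h2 := ofReal_integral_norm_eq_lintegral_enorm ((mollify_integrable hgi n).sub hgi)
  simp only [Pi.sub_apply] at h2
  rw [h2]
  calc _ = ∫⁻ x in K, ‖mollify μ n g x - g x‖ₑ ∂μ := by
        refine setLIntegral_congr_fun hK.isClosed.measurableSet fun x hx => ?_
        have hx' : g x = f x := Set.indicator_of_mem (Metric.self_subset_cthickening K hx) f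
        have : mollify μ n f x = mollify μ n g x := mollify_congr_of_eqOn (K := K)
          (fun y hy => (Set.indicator_of_mem hy f).symm) n hx
        simp only [hx', this]
    _ ≤ _ := setLIntegral_le_lintegral _ _

/-- The kernels are probability densities supported in the unit ball. This keeps the mollified
density positive, so that its logarithm is smooth. -/
theorem le_mollify {f : E → ℝ} (hf : LocallyIntegrable f μ) {c : ℝ} {x : E}
    (hc : ∀ᵐ y ∂μ.restrict (Metric.closedBall x 1), c ≤ f y) (n : ℕ) : c ≤ mollify μ n f x := by
  have h1 : ∫ t, mollifier μ n (x - t) * c ∂μ = c := by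
    rw [integral_mul_const, integral_sub_left_eq_self (mollifier μ n) μ x, mollifier_integral,
      one_mul]
  rw [mollify_eq_swap, ← h1]
  have hci : Integrable (fun t => mollifier μ n (x - t) * c) μ :=
    integrable_mollifier_smul (locallyIntegrable_const c) n x
  refine integral_mono_ae hci (integrable_mollifier_smul hf n x) ?_
  have hc' := (ae_restrict_iff' Metric.isClosed_closedBall.measurableSet).1 hc
  filter_upwards [hc'] with t ht
  by_cases h : 1 ≤ ‖x - t‖
  · simp [mollifier_eq_zero h]
  · have : t ∈ Metric.closedBall x 1 := by
      rw [mem_closedBall_iff_norm, norm_sub_rev]; exact (not_le.1 h).le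
    exact mul_le_mul_of_nonneg_left (ht this) (mollifier_nonneg n _)

end Mollify

/-! ### The density is locally bounded -/

/-- The Euclidean space `ℝ^N`. -/
abbrev Sp (N : ℕ) : Type := EuclideanSpace ℝ (Fin N)

/-! ### Mollification commutes with the weak gradient -/

section WeakGradient

variable {N : ℕ}

theorem mollify_apply_euclidean {G : Sp N → Sp N} (hG : LocallyIntegrable G) (n : ℕ) (x : Sp N)
    (i : Fin N) : mollify volume n G x i = mollify volume n (fun y => G y i) x := by
  rw [mollify_eq_swap, mollify_eq_swap]
  have := (EuclideanSpace.proj (𝕜 := ℝ) i).integral_comp_comm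
    (integrable_mollifier_smul (μ := volume) hG n x)
  simpa using this.symm

/-- The derivative falls on the kernel, and y ↦ ρ_n(x - y) is an admissible test function in the
definition of the weak gradient. Two signs cancel: one from integration by parts, one from x - y. -/
theorem HasWeakGradient.fderiv_mollify_single {m : Sp N → ℝ} {G : Sp N → Sp N}
    (h : HasWeakGradient m G) (n : ℕ) (x : Sp N) (i : Fin N) :
    fderiv ℝ (mollify volume n m) x (EuclideanSpace.single i 1) = mollify volume n G x i := by
  set e : Sp N := EuclideanSpace.single i 1
  have h1 := (mollifier_hasCompactSupport (E := Sp N) (μ := volume) n).hasFDerivAt_convolution_left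
    (ContinuousLinearMap.lsmul ℝ ℝ) ((mollifier_contDiff n).of_le (by simp)) h.locallyIntegrable x
  have h2 : fderiv ℝ (mollify volume n m) x = _ := h1.fderiv
  have hc : Continuous (fderiv ℝ (mollifier (volume : Measure (Sp N)) n)) :=
    (mollifier_contDiff n).continuous_fderiv (by simp)
  have h3 := (mollifier_hasCompactSupport (E := Sp N) (μ := volume) n).fderiv (𝕜 := ℝ)
  have h4 : ConvolutionExistsAt (fderiv ℝ (mollifier (volume : Measure (Sp N)) n)) m x
      ((ContinuousLinearMap.lsmul ℝ ℝ).precompL (Sp N)) volume :=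
    h3.convolutionExists_left _ hc h.locallyIntegrable x
  rw [h2, convolution_def, ContinuousLinearMap.integral_apply h4]
  have h5 : ∫ t, ((ContinuousLinearMap.lsmul ℝ ℝ).precompL (Sp N)
      (fderiv ℝ (mollifier (volume : Measure (Sp N)) n) t) (m (x - t))) e =
      ∫ t, m t * fderiv ℝ (mollifier (volume : Measure (Sp N)) n) (x - t) e := by
    rw [← integral_sub_left_eq_self _ volume x]
    refine integral_congr_ae (Eventually.of_forall fun t => ?_)
    simp [ContinuousLinearMap.precompL_apply, mul_comm]
  rw [h5, mollify_apply_euclidean h.locallyIntegrable_grad, mollify_eq_swap]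
  have hφ : IsTestFunction fun y : Sp N => mollifier volume n (x - y) :=
    ⟨(mollifier_contDiff n).comp (contDiff_const.sub contDiff_id),
      (mollifier_hasCompactSupport n).comp_homeomorph (Homeomorph.subLeft x)⟩
  have h6 := h.integral_eq _ hφ i
  have h7 : ∀ y : Sp N, fderiv ℝ (fun y => mollifier volume n (x - y)) y e =
      -fderiv ℝ (mollifier (volume : Measure (Sp N)) n) (x - y) e := by
    intro y
    have h8 : HasFDerivAt (fun y : Sp N => mollifier volume n (x - y))
        ((fderiv ℝ (mollifier volume n) (x - y)).comp (-ContinuousLinearMap.id ℝ (Sp N))) y :=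
      (((mollifier_contDiff n).differentiable (by simp)) _).hasFDerivAt.comp y
        ((hasFDerivAt_id y).const_sub x)
    rw [h8.fderiv]
    simp
  simp only [smul_eq_mul]
  change ∫ y, m y * fderiv ℝ (fun y => mollifier volume n (x - y)) y e = _ at h6
  simp_rw [h7, mul_neg, integral_neg, neg_inj] at h6
  exact h6

theorem HasWeakGradient.fderiv_mollify {m : Sp N → ℝ} {G : Sp N → Sp N}
    (h : HasWeakGradient m G) (n : ℕ) (x v : Sp N) :
    fderiv ℝ (mollify volume n m) x v = inner ℝ (mollify volume n G x) v := by
  have hv : v = ∑ i, v i • EuclideanSpace.single i (1 : ℝ) := by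
    ext j; simp [Finset.sum_apply, Pi.single_apply]
  conv_lhs => rw [hv, map_sum]
  simp only [map_smul, h.fderiv_mollify_single, smul_eq_mul]
  rw [PiLp.inner_apply]
  simp

theorem HasWeakGradient.norm_fderiv_mollify_le {m : Sp N → ℝ} {G : Sp N → Sp N}
    (h : HasWeakGradient m G) (n : ℕ) (x : Sp N) :
    ‖fderiv ℝ (mollify volume n m) x‖ ≤ ‖mollify volume n G x‖ :=
  ContinuousLinearMap.opNorm_le_bound _ (norm_nonneg _) fun v => by
    rw [h.fderiv_mollify]
    exact norm_inner_le_norm _ _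

end WeakGradient

/-! ### Morrey estimate for log m -/

section LocalBound

variable {N : ℕ} {m : Sp N → ℝ} {G : Sp N → Sp N}

/-- For N ≥ 2 the given r already exceeds 2. For N = 1 it may not, and then q = 2 is available
because G is locally in L² and m is bounded below. -/
theorem HypothesisH1.exists_exponent (hN : 1 ≤ N) (h : HypothesisH1 m G) :
    ∃ q : ℝ, 2 ≤ q ∧ (N : ℝ) < q ∧ IsLpLoc (ENNReal.ofReal q) (logGrad m G) := by
  obtain ⟨r, hr, hloc⟩ := h.memLrLoc_logGrad
  rcases Nat.lt_or_ge 1 N with h2 | h2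
  · exact ⟨r, le_trans (by exact_mod_cast h2) hr.le, hr, hloc⟩
  · have hN1 : N = 1 := le_antisymm h2 hN
    refine ⟨2, le_rfl, by rw [hN1]; norm_num, fun K hK => ?_⟩
    obtain ⟨c, hc, hcm⟩ := h.pos_on_compacts K hK
    have h3 : ENNReal.ofReal 2 = 2 := by norm_num
    rw [h3]
    refine (h.memL2Loc_grad K hK).of_le_mul (c := c⁻¹) (hloc K hK).1 ?_
    filter_upwards [hcm] with x hx
    rw [logGrad, norm_smul, norm_inv, Real.norm_of_nonneg (hc.le.trans hx)]
    gcongr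

theorem abs_log_sub_log_le {a b c : ℝ} (hc : 0 < c) (ha : c ≤ a) (hb : c ≤ b) :
    |Real.log a - Real.log b| ≤ c⁻¹ * |a - b| := by
  have key : ∀ {a b : ℝ}, c ≤ a → c ≤ b → Real.log a - Real.log b ≤ c⁻¹ * |a - b| := by
    intro a b ha hb
    have ha0 := hc.trans_le ha
    have hb0 := hc.trans_le hb
    rw [← Real.log_div ha0.ne' hb0.ne']
    refine (Real.log_le_sub_one_of_pos (div_pos ha0 hb0)).trans ?_
    rw [show a / b - 1 = b⁻¹ * (a - b) by field_simp]
    calc _ ≤ b⁻¹ * |a - b| := by gcongr; exact le_abs_self _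
      _ ≤ _ := by gcongr
  rw [abs_le]
  exact ⟨by have := key hb ha; rw [abs_sub_comm] at this; linarith, key ha hb⟩

/-- The cutoff function equal to `1` on the ball of radius `R` and supported in the ball of radius
`R + 1`. -/
noncomputable def cutoff (N : ℕ) (R : ℝ) (hR : 0 < R) : ContDiffBump (0 : Sp N) :=
  ⟨R, R + 1, hR, by linarith⟩

theorem cutoff_eq_one {R : ℝ} (hR : 0 < R) {x : Sp N} (hx : ‖x‖ ≤ R) : cutoff N R hR x = 1 :=
  (cutoff N R hR).one_of_mem_closedBall (mem_closedBall_zero_iff.2 hx)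

theorem tsupport_cutoff {R : ℝ} (hR : 0 < R) :
    tsupport (cutoff N R hR) = Metric.closedBall 0 (R + 1) :=
  (cutoff N R hR).tsupport_eq

theorem abs_log_le {c q t : ℝ} (hc : 0 < c) (hq : 0 < q) (hx : c ≤ t) :
    |Real.log t| ≤ |Real.log c| + q * t ^ (1 / q) := by
  have hx0 : 0 < t := hc.trans_le hx
  have hp : 0 ≤ t ^ (1 / q) := Real.rpow_nonneg hx0.le _
  have hqp : 0 ≤ q * t ^ (1 / q) := mul_nonneg hq.le hp
  rw [abs_le]
  constructor
  · have := Real.log_le_log hc hx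
    have := neg_abs_le (Real.log c)
    linarith
  · have h2 := Real.log_le_rpow_div hx0.le (ε := 1 / q) (by positivity)
    rw [div_div_eq_mul_div, div_one, mul_comm] at h2
    linarith [abs_nonneg (Real.log c)]

/-- The logarithm grows more slowly than the power 1/q, so integrability of m puts log m in L^q. -/
theorem memLp_log {K : Set (Sp N)} (hm : IntegrableOn m K) {c : ℝ} (hc : 0 < c)
    (hcm : ∀ᵐ x ∂(volume.restrict K), c ≤ m x) (hK : volume K ≠ ⊤) {q : ℝ} (hq : 0 < q) :
    MemLp (fun x => Real.log (m x)) (ENNReal.ofReal q) (volume.restrict K) := by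
  have : IsFiniteMeasure (volume.restrict K) := isFiniteMeasure_restrict.2 hK
  have hma : AEMeasurable m (volume.restrict K) := hm.aestronglyMeasurable.aemeasurable
  have h1 : MemLp (fun x => m x ^ (1 / q)) (ENNReal.ofReal q) (volume.restrict K) := by
    rw [← integrable_norm_rpow_iff (hma.pow_const _).aestronglyMeasurable (by simpa using hq)
      ENNReal.ofReal_ne_top]
    refine hm.congr ?_
    filter_upwards [hcm] with x hx
    have hx0 : 0 ≤ m x := hc.le.trans hx
    rw [Real.norm_of_nonneg (Real.rpow_nonneg hx0 _), ← Real.rpow_mul hx0,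
      ENNReal.toReal_ofReal hq.le, one_div_mul_cancel hq.ne', Real.rpow_one]
  have h2 : MemLp (fun x => |Real.log c| + q * m x ^ (1 / q)) (ENNReal.ofReal q)
    (volume.restrict K) := MemLp.add (memLp_const _) (h1.const_mul q)
  refine h2.mono' (Real.measurable_log.comp_aemeasurable hma).aestronglyMeasurable ?_
  filter_upwards [hcm] with x hx
  exact abs_log_le hc hq hx

theorem lintegral_rpow_lt_top_of_memLp {E : Type*} [NormedAddCommGroup E] {f : Sp N → E} {q : ℝ}
    (hq : 0 < q) (hf : MemLp f (ENNReal.ofReal q) volume) : ∫⁻ x, ‖f x‖ₑ ^ q < ⊤ := by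
  have := lintegral_rpow_enorm_lt_top_of_eLpNorm_lt_top (by simpa using hq) ENNReal.ofReal_ne_top
    hf.2
  rwa [ENNReal.toReal_ofReal hq.le] at this

theorem memLp_of_le_indicator {E : Type*} [NormedAddCommGroup E] {f : Sp N → E} {g : Sp N → ℝ}
    {K : Set (Sp N)} (hK : MeasurableSet K) {p : ℝ≥0∞} (hf : MemLp f p (volume.restrict K))
    (hg : AEStronglyMeasurable g volume) {D : ℝ} (hgf : ∀ x ∈ K, |g x| ≤ D * ‖f x‖)
    (h0 : ∀ x ∉ K, g x = 0) : MemLp g p volume := by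
  refine ((memLp_indicator_iff_restrict hK).2 hf).of_le_mul (c := D) hg
    (Eventually.of_forall fun x => ?_)
  by_cases hx : x ∈ K
  · rw [Set.indicator_of_mem hx]; exact hgf x hx
  · rw [Set.indicator_of_notMem hx, h0 x hx]; simp

theorem HypothesisH1.mollify_pos (h : HypothesisH1 m G) (n : ℕ) (x : Sp N) :
    0 < mollify volume n m x := by
  obtain ⟨c, hc, hcm⟩ := h.pos_on_compacts _ (isCompact_closedBall x 1)
  exact hc.trans_le (le_mollify h.hasWeakGradient.locallyIntegrable hcm n)

theorem HypothesisH1.exists_le_mollify (h : HypothesisH1 m G) {K : Set (Sp N)} (hK : IsCompact K) :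
    ∃ c : ℝ, 0 < c ∧ (∀ n, ∀ x ∈ K, c ≤ mollify volume n m x) ∧
      ∀ᵐ x ∂(volume.restrict K), c ≤ m x := by
  obtain ⟨c, hc, hcm⟩ := h.pos_on_compacts _ (hK.cthickening (r := 1))
  refine ⟨c, hc, fun n x hx => le_mollify h.hasWeakGradient.locallyIntegrable ?_ n,
    ae_restrict_of_ae_restrict_of_subset (Metric.self_subset_cthickening K) hcm⟩
  refine ae_restrict_of_ae_restrict_of_subset (fun y hy => ?_) hcm
  exact Metric.mem_cthickening_of_dist_le y x 1 K hx hy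

theorem HypothesisH1.tendsto_log_mollify (h : HypothesisH1 m G) {K : Set (Sp N)}
    (hK : IsCompact K) :
    Tendsto (fun n => ∫⁻ x in K, ‖Real.log (mollify volume n m x) - Real.log (m x)‖ₑ) atTop
      (𝓝 0) := by
  obtain ⟨c, hc, hcn, hcm⟩ := h.exists_le_mollify hK
  have h1 := ENNReal.Tendsto.const_mul (a := ENNReal.ofReal c⁻¹)
    (mollify_tendsto_setLIntegral h.hasWeakGradient.locallyIntegrable hK)
    (Or.inr ENNReal.ofReal_ne_top)
  rw [mul_zero] at h1
  refine tendsto_of_tendsto_of_tendsto_of_le_of_le tendsto_const_nhds h1 (fun _ => zero_le)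
    fun n => ?_
  rw [← lintegral_const_mul' _ _ ENNReal.ofReal_ne_top]
  refine lintegral_mono_ae ?_
  filter_upwards [hcm, ae_restrict_mem hK.isClosed.measurableSet] with x hx hxK
  rw [← ofReal_norm, ← ofReal_norm, ← ENNReal.ofReal_mul (by positivity)]
  exact ENNReal.ofReal_le_ofReal (abs_log_sub_log_le hc (hcn n x hxK) hx)

/-- With a and M the mollifications of G and m, ‖a‖/M - ‖G‖/m = (‖a‖ - ‖G‖)/M + ‖G‖(1/M - 1/m). The
first term is small in L¹ since M is bounded below; the second tends to zero by domination by a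
multiple of ‖G‖. -/
theorem HypothesisH1.tendsto_logGrad_mollify (h : HypothesisH1 m G) {K : Set (Sp N)}
    (hK : IsCompact K) :
    Tendsto (fun n => ∫⁻ x in K, ‖‖mollify volume n G x‖ * (mollify volume n m x)⁻¹ -
      ‖G x‖ * (m x)⁻¹‖ₑ) atTop (𝓝 0) := by
  obtain ⟨c, hc, hcn, hcm⟩ := h.exists_le_mollify hK
  have hKm := hK.isClosed.measurableSet
  have h1 := ENNReal.Tendsto.const_mul (a := ENNReal.ofReal c⁻¹)
    (mollify_tendsto_setLIntegral h.hasWeakGradient.locallyIntegrable_grad hK)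
    (Or.inr ENNReal.ofReal_ne_top)
  rw [mul_zero] at h1
  have hGi : IntegrableOn G K := h.hasWeakGradient.locallyIntegrable_grad.integrableOn_isCompact hK
  have hma : AEMeasurable m (volume.restrict K) :=
    (h.hasWeakGradient.locallyIntegrable.integrableOn_isCompact hK).aestronglyMeasurable.aemeasurable
  have hMm : ∀ n, Measurable (mollify (volume : Measure (Sp N)) n m) := fun n =>
    (mollify_contDiff h.hasWeakGradient.locallyIntegrable n).continuous.measurable
  have h2 : Tendsto (fun n => ∫⁻ x in K, ‖G x‖ₑ * ‖(mollify volume n m x)⁻¹ - (m x)⁻¹‖ₑ) atTop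
      (𝓝 (∫⁻ x in K, 0)) := by
    refine tendsto_lintegral_of_dominated_convergence' (fun x => ‖G x‖ₑ * ENNReal.ofReal (2 * c⁻¹))
      (fun n => ?_) (fun n => ?_) ?_ ?_
    · exact hGi.aestronglyMeasurable.enorm.mul
        (((hMm n).inv.aemeasurable.sub hma.inv).enorm)
    · filter_upwards [hcm, ae_restrict_mem hKm] with x hx hxK
      gcongr
      rw [← ofReal_norm]
      refine ENNReal.ofReal_le_ofReal ((norm_sub_le _ _).trans ?_)
      have e1 : ∀ a, c ≤ a → ‖a⁻¹‖ ≤ c⁻¹ := fun a ha => by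
        rw [norm_inv, Real.norm_of_nonneg (hc.le.trans ha)]
        gcongr
      linarith [e1 _ (hcn n x hxK), e1 _ hx]
    · rw [lintegral_mul_const' _ _ ENNReal.ofReal_ne_top]
      exact ENNReal.mul_ne_top hGi.2.ne ENNReal.ofReal_ne_top
    · filter_upwards [hcm, ae_restrict_of_ae
        (mollify_ae_tendsto h.hasWeakGradient.locallyIntegrable)] with x hx hlim
      have h3 := ((hlim.inv₀ (hc.trans_le hx).ne').sub_const (m x)⁻¹).enorm
      have h4 := ENNReal.Tendsto.const_mul (a := ‖G x‖ₑ) h3 (Or.inr enorm_ne_top)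
      simpa using h4
  have h5 := h1.add h2
  rw [lintegral_zero, add_zero] at h5
  refine tendsto_of_tendsto_of_tendsto_of_le_of_le tendsto_const_nhds h5 (fun _ => zero_le)
    fun n => ?_
  rw [← lintegral_const_mul' _ _ ENNReal.ofReal_ne_top]
  have hmG : Measurable (mollify (volume : Measure (Sp N)) n G) :=
    (mollify_contDiff h.hasWeakGradient.locallyIntegrable_grad n).continuous.measurable
  have hme : AEMeasurable (fun x => ENNReal.ofReal c⁻¹ * ‖mollify volume n G x - G x‖ₑ)
      (volume.restrict K) :=
    ((hmG.aemeasurable.sub hGi.aestronglyMeasurable.aemeasurable).enorm).const_mul _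
  rw [← lintegral_add_left' hme]
  refine lintegral_mono_ae ?_
  filter_upwards [ae_restrict_mem hKm] with x hxK
  set a := mollify volume n G x
  set M := mollify volume n m x with hM
  have hcM : c ≤ M := hcn n x hxK
  rw [← ofReal_norm, ← ofReal_norm, ← ofReal_norm, ← ofReal_norm,
    ← ENNReal.ofReal_mul (by positivity), ← ENNReal.ofReal_mul (by positivity),
    ← ENNReal.ofReal_add (by positivity) (by positivity)]
  refine ENNReal.ofReal_le_ofReal ?_
  have e1 : ‖a‖ * M⁻¹ - ‖G x‖ * (m x)⁻¹ = (‖a‖ - ‖G x‖) * M⁻¹ + ‖G x‖ * (M⁻¹ - (m x)⁻¹) := by ring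
  rw [e1]
  refine (norm_add_le _ _).trans ?_
  rw [norm_mul, norm_mul, norm_norm, mul_comm c⁻¹]
  gcongr
  · exact abs_norm_sub_norm_le a (G x)
  · rw [norm_inv, Real.norm_of_nonneg (hc.le.trans hcM)]
    gcongr

/-- A density satisfying (H1) is locally bounded. -/
theorem HypothesisH1.exists_ae_le (hN : 1 ≤ N) (h : HypothesisH1 m G) {K : Set (Sp N)}
    (hK : IsCompact K) : ∃ C : ℝ, 0 < C ∧ ∀ᵐ x ∂(volume.restrict K), m x ≤ C := by
  obtain ⟨R, hR0, hKR⟩ := hK.isBounded.subset_closedBall_lt 0 0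
  set χ := cutoff N R hR0
  set S : Set (Sp N) := Metric.closedBall 0 (R + 1) with hS
  have hSc : IsCompact S := isCompact_closedBall _ _
  have hSm : MeasurableSet S := hSc.isClosed.measurableSet
  obtain ⟨q, hq2, hqN, hLq⟩ := h.exists_exponent hN
  have hq0 : 0 < q := by linarith
  obtain ⟨c, hc, hcn, hcm⟩ := h.exists_le_mollify hSc
  have hmL := h.hasWeakGradient.locallyIntegrable
  have hGL := h.hasWeakGradient.locallyIntegrable_grad
  -- measurable representatives
  set m' := hmL.aestronglyMeasurable.mk m
  have hm'm : Measurable m' := hmL.aestronglyMeasurable.stronglyMeasurable_mk.measurable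
  have hmm' : m =ᵐ[volume] m' := hmL.aestronglyMeasurable.ae_eq_mk
  set G' := hGL.aestronglyMeasurable.mk G
  have hG'm : Measurable G' := hGL.aestronglyMeasurable.stronglyMeasurable_mk.measurable
  have hGG' : G =ᵐ[volume] G' := hGL.aestronglyMeasurable.ae_eq_mk
  have hχ : ContDiff ℝ ∞ χ := χ.contDiff
  have hχd : Continuous (fderiv ℝ χ) := hχ.continuous_fderiv (by simp)
  have hχ1 : ∀ x, |χ x| ≤ 1 := fun x => by rw [abs_of_nonneg χ.nonneg]; exact χ.le_one
  obtain ⟨D, hD⟩ := (χ.hasCompactSupport.fderiv (𝕜 := ℝ)).exists_bound_of_continuous hχd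
  have hD0 : 0 ≤ D := (norm_nonneg _).trans (hD 0)
  have hts : tsupport χ = S := tsupport_cutoff hR0
  have hχ0 : ∀ x ∉ S, χ x = 0 := fun x hx => image_eq_zero_of_notMem_tsupport (hts ▸ hx)
  have hχd0 : ∀ x ∉ S, fderiv ℝ χ x = 0 := fun x hx =>
    image_eq_zero_of_notMem_tsupport fun h' => hx (hts ▸ tsupport_fderiv_subset ℝ h')
  have hMsm : ∀ n, ContDiff ℝ ∞ (mollify (volume : Measure (Sp N)) n m) := fun n =>
    mollify_contDiff hmL n
  have hGsm : ∀ n, Continuous (mollify (volume : Measure (Sp N)) n G) := fun n =>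
    (mollify_contDiff hGL n).continuous
  -- Morrey's estimate is applied to log m, not to m: the gradient of log m is locally in L^q with q
  -- > N by hypothesis, while for ∇m this would require the bound being proved.
  let f : ℕ → Sp N → ℝ := fun n x => χ x * Real.log (mollify volume n m x)
  have hf : ∀ n, ContDiff ℝ ∞ (f n) := fun n =>
    hχ.mul ((hMsm n).log fun x => (h.mollify_pos n x).ne')
  let F : Sp N → ℝ := fun x => χ x * Real.log (m' x)
  -- g bounds the gradient of the limit χ log m, and r n is the error in that bound for the n-th
  -- approximation.
  let g : Sp N → ℝ := fun x => ‖fderiv ℝ χ x‖ * |Real.log (m' x)| + |χ x| * (‖G' x‖ * (m' x)⁻¹)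
  let r : ℕ → Sp N → ℝ := fun n x => ‖fderiv ℝ χ x‖ *
    |Real.log (mollify volume n m x) - Real.log (m' x)| + |χ x| *
      |‖mollify volume n G x‖ * (mollify volume n m x)⁻¹ - ‖G' x‖ * (m' x)⁻¹|
  have hFm : Measurable F := χ.continuous.measurable.mul (Real.measurable_log.comp hm'm)
  have hlm : Measurable fun x => Real.log (m' x) := Real.measurable_log.comp hm'm
  have hgm : Measurable g := by
    refine (hχd.norm.measurable.mul hlm.abs).add
      (χ.continuous.measurable.abs.mul (hG'm.norm.mul hm'm.inv))
  have hrm : ∀ n, Measurable (r n) := fun n => by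
    have e1 := (hMsm n).continuous.measurable
    have e2 := (hGsm n).measurable
    exact (hχd.norm.measurable.mul ((Real.measurable_log.comp e1).sub hlm).abs).add
      (χ.continuous.measurable.abs.mul ((e2.norm.mul e1.inv).sub (hG'm.norm.mul hm'm.inv)).abs)
  have hgr : ∀ n x, ‖fderiv ℝ (f n) x‖ₑ ≤ ‖g x‖ₑ + ‖r n x‖ₑ := by
    intro n x
    have hM := h.mollify_pos n x
    have e1 : HasFDerivAt (f n) (χ x • ((mollify volume n m x)⁻¹ •
        fderiv ℝ (mollify volume n m) x) + Real.log (mollify volume n m x) • fderiv ℝ χ x) x :=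
      ((hχ.differentiable (by simp)) x).hasFDerivAt.mul
        (((hMsm n).differentiable (by simp)) x |>.hasFDerivAt.log hM.ne')
    have e2 : ‖fderiv ℝ (f n) x‖ ≤ g x + r n x := by
      rw [e1.fderiv]
      refine (norm_add_le _ _).trans ?_
      rw [norm_smul, norm_smul, norm_smul, norm_inv, Real.norm_of_nonneg hM.le]
      have e3 := h.hasWeakGradient.norm_fderiv_mollify_le n x
      have e4 : |χ x| * ((mollify volume n m x)⁻¹ * ‖fderiv ℝ (mollify volume n m) x‖) ≤
          |χ x| * (‖G' x‖ * (m' x)⁻¹) + |χ x| *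
          |‖mollify volume n G x‖ * (mollify volume n m x)⁻¹ - ‖G' x‖ * (m' x)⁻¹| := by
        rw [← mul_add]
        gcongr
        calc _ ≤ (mollify volume n m x)⁻¹ * ‖mollify volume n G x‖ := by gcongr
          _ ≤ _ := by
            rw [mul_comm]
            linarith [le_abs_self (‖mollify volume n G x‖ * (mollify volume n m x)⁻¹ -
              ‖G' x‖ * (m' x)⁻¹)]
      have e5 : |Real.log (mollify volume n m x)| * ‖fderiv ℝ χ x‖ ≤
          ‖fderiv ℝ χ x‖ * |Real.log (m' x)| + ‖fderiv ℝ χ x‖ *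
          |Real.log (mollify volume n m x) - Real.log (m' x)| := by
        rw [mul_comm, ← mul_add]
        gcongr
        calc _ = |Real.log (m' x) + (Real.log (mollify volume n m x) - Real.log (m' x))| := by
              rw [add_sub_cancel]
          _ ≤ _ := abs_add_le _ _
      simp only [Real.norm_eq_abs] at e4 e5 ⊢
      simp only [g, r]
      linarith
    calc ‖fderiv ℝ (f n) x‖ₑ ≤ ‖g x + r n x‖ₑ := by
          rw [← ofReal_norm, ← ofReal_norm]
          exact ENNReal.ofReal_le_ofReal (e2.trans (le_abs_self _))
      _ ≤ _ := enorm_add_le _ _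
  have hlog := h.tendsto_log_mollify hSc
  have hlimF : Tendsto (fun n => ∫⁻ x, ‖f n x - F x‖ₑ) atTop (𝓝 0) := by
    refine tendsto_of_tendsto_of_tendsto_of_le_of_le tendsto_const_nhds hlog (fun _ => zero_le)
      fun n => ?_
    rw [← lintegral_indicator hSm]
    refine lintegral_mono_ae ?_
    filter_upwards [hmm'] with x hx
    simp only [f, F]
    rw [← hx, ← mul_sub, enorm_mul]
    by_cases hxS : x ∈ S
    · rw [Set.indicator_of_mem hxS]
      calc _ ≤ 1 * ‖Real.log (mollify volume n m x) - Real.log (m x)‖ₑ := by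
            gcongr
            rw [← ofReal_norm]
            exact ENNReal.ofReal_le_one.2 (hχ1 x)
        _ = _ := one_mul _
    · rw [hχ0 x hxS]; simp
  have hlimr : Tendsto (fun n => ∫⁻ x, ‖r n x‖ₑ) atTop (𝓝 0) := by
    have e1 := (ENNReal.Tendsto.const_mul (a := ENNReal.ofReal D) hlog
      (Or.inr ENNReal.ofReal_ne_top)).add (h.tendsto_logGrad_mollify hSc)
    rw [mul_zero, add_zero] at e1
    refine tendsto_of_tendsto_of_tendsto_of_le_of_le tendsto_const_nhds e1 (fun _ => zero_le)
      fun n => ?_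
    rw [← lintegral_const_mul' _ _ ENNReal.ofReal_ne_top, ← lintegral_add_left']
    · rw [← lintegral_indicator hSm]
      refine lintegral_mono_ae ?_
      filter_upwards [hmm', hGG'] with x hx hx'
      simp only [r]
      rw [← hx, ← hx']
      by_cases hxS : x ∈ S
      · rw [Set.indicator_of_mem hxS]
        refine (enorm_add_le _ _).trans ?_
        rw [enorm_mul, enorm_mul, enorm_norm, Real.enorm_abs, Real.enorm_abs, Real.enorm_abs]
        gcongr
        · rw [← ofReal_norm]
          exact ENNReal.ofReal_le_ofReal (hD x)
        · calc _ ≤ 1 * ‖‖mollify volume n G x‖ * (mollify volume n m x)⁻¹ -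
                ‖G x‖ * (m x)⁻¹‖ₑ := by
                gcongr
                rw [← ofReal_norm]
                exact ENNReal.ofReal_le_one.2 (hχ1 x)
            _ = _ := one_mul _
      · rw [hχ0 x hxS, hχd0 x hxS]; simp
    · have hma : AEMeasurable m (volume.restrict S) := (hmL.aestronglyMeasurable.aemeasurable).restrict
      exact (((Real.measurable_log.comp (hMsm n).continuous.measurable).aemeasurable.sub
        (Real.measurable_log.comp_aemeasurable hma)).enorm).const_mul _
  have hSfin : volume S ≠ ⊤ := hSc.measure_lt_top.ne
  have hlogq : MemLp (fun x => Real.log (m' x)) (ENNReal.ofReal q) (volume.restrict S) := by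
    refine (memLp_log (hmL.integrableOn_isCompact hSc) hc hcm hSfin hq0).ae_eq ?_
    filter_upwards [ae_restrict_of_ae hmm'] with x hx
    rw [hx]
  have hFq : MemLp F (ENNReal.ofReal q) volume := by
    refine memLp_of_le_indicator hSm hlogq hFm.aestronglyMeasurable (D := 1) (fun x _ => ?_)
      (fun x hx => by simp [F, hχ0 x hx])
    simp only [F, abs_mul]
    exact mul_le_mul_of_nonneg_right (hχ1 x) (abs_nonneg _)
  have hgq : MemLp g (ENNReal.ofReal q) volume := by
    refine MemLp.add ?_ ?_
    · refine memLp_of_le_indicator hSm hlogq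
        (hχd.norm.measurable.mul hlm.abs).aestronglyMeasurable (D := D) (fun x _ => ?_)
        (fun x hx => by simp [hχd0 x hx])
      rw [abs_mul, abs_norm, abs_abs]
      exact mul_le_mul_of_nonneg_right (hD x) (abs_nonneg _)
    · have e1 : MemLp (fun x => ‖G' x‖ * (m' x)⁻¹) (ENNReal.ofReal q) (volume.restrict S) := by
        refine (hLq S hSc).of_le_mul (c := 1) (hG'm.norm.mul hm'm.inv).aestronglyMeasurable ?_
        filter_upwards [ae_restrict_of_ae hmm', ae_restrict_of_ae hGG'] with x hx hx'
        rw [logGrad, norm_smul, norm_mul, norm_norm, ← hx, ← hx', one_mul, mul_comm]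
      refine memLp_of_le_indicator hSm e1
        (χ.continuous.measurable.abs.mul (hG'm.norm.mul hm'm.inv)).aestronglyMeasurable (D := 1)
        (fun x _ => ?_) (fun x hx => by simp [hχ0 x hx])
      rw [abs_mul, abs_abs]
      exact mul_le_mul_of_nonneg_right (hχ1 x) (abs_nonneg _)
  have hfin : (Module.finrank ℝ (Sp N) : ℝ) = N := by simp
  obtain ⟨C₁, hC₁⟩ := ballAvg_le_of_lintegral_rpow volume hFm.enorm (by linarith)
    (lintegral_rpow_lt_top_of_memLp hq0 hFq)
  obtain ⟨C₂, hC₂⟩ := ballAvg_le_of_lintegral_rpow volume hgm.enorm (by linarith)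
    (lintegral_rpow_lt_top_of_memLp hq0 hgq)
  obtain ⟨B, hB⟩ := exists_ae_bound_of_morrey (μ := volume) (fun n => (hf n).of_le (by simp)) hFm
    hgm.enorm (fun n => (hrm n).enorm) hgr hlimF hlimr (α := Module.finrank ℝ (Sp N) / q)
    (by rw [hfin, div_lt_one hq0]; exact hqN) (C₁ := C₁) (C₂ := C₂)
    (fun x => by simpa using hC₁ 1 one_ne_zero x) hC₂
  refine ⟨Real.exp B, Real.exp_pos _, ?_⟩
  filter_upwards [ae_restrict_of_ae hB, ae_restrict_of_ae hmm', ae_restrict_mem hK.isClosed.measurableSet,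
    ae_restrict_of_ae_restrict_of_subset (hKR.trans (Metric.closedBall_subset_closedBall
      (by linarith))) hcm] with x hx hxm hxK hxc
  have hχx : χ x = 1 := cutoff_eq_one hR0 (by simpa using hKR hxK)
  have hx0 : 0 < m x := hc.trans_le hxc
  simp only [F, hχx, one_mul, ← hxm] at hx
  rw [← ofReal_norm, ENNReal.ofReal_le_coe] at hx
  have h2 : Real.log (m x) ≤ B := (le_abs_self _).trans (by simpa using hx)
  rwa [← Real.log_le_iff_le_exp hx0]

/-- The logarithmic gradient is locally a Morrey weight. -/
theorem HypothesisH1.exists_morreyWeight (hN : 1 ≤ N) (h : HypothesisH1 m G) {K : Set (Sp N)}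
    (hK : IsCompact K) : ∃ W : Sp N → ℝ≥0∞, ∃ α : ℝ, α < 1 ∧ IsMorreyWeight volume W α ∧
      ∀ᵐ x, x ∈ K → ‖logGrad m G x‖ₑ ^ 2 = W x := by
  obtain ⟨q, hq2, hqN, hLq⟩ := h.exists_exponent hN
  have hq0 : 0 < q := by linarith
  have hKm := hK.isClosed.measurableSet
  have h1 : MemLp (K.indicator (logGrad m G)) (ENNReal.ofReal q) volume :=
    (memLp_indicator_iff_restrict hKm).2 (hLq K hK)
  set b := h1.1.mk _ with hb
  have hbm : StronglyMeasurable b := h1.1.stronglyMeasurable_mk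
  have hbe : K.indicator (logGrad m G) =ᵐ[volume] b := h1.1.ae_eq_mk
  have h2 := lintegral_rpow_lt_top_of_memLp hq0 (h1.ae_eq hbe)
  have hWm : Measurable fun x => ‖b x‖ₑ ^ 2 := hbm.measurable.enorm.pow_const 2
  -- The squared drift is in L^(q/2), with Morrey exponent N/(q/2) = 2(N/q); so α = N/q, which is
  -- less than 1.
  obtain ⟨C, hC⟩ := ballAvg_le_of_lintegral_rpow volume hWm (q := q / 2) (by linarith) (by
    refine lt_of_le_of_lt (lintegral_mono fun x => le_of_eq ?_) h2
    rw [← ENNReal.rpow_natCast, ← ENNReal.rpow_mul]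
    congr 1; push_cast; ring)
  have hfin : (Module.finrank ℝ (Sp N) : ℝ) = N := by simp
  refine ⟨fun x => ‖b x‖ₑ ^ 2, N / q, by rw [div_lt_one hq0]; exact hqN, ⟨hWm, C, fun s hs x => ?_⟩, ?_⟩
  · convert hC s hs x using 4
    rw [hfin]; field_simp
  · filter_upwards [hbe] with x hx hxK
    rw [← hx, Set.indicator_of_mem hxK]

end LocalBound

/-! ### Partial derivatives and integration by parts -/

section PartialDerivatives

variable {N : ℕ}

/-- The partial derivative `∂ᵢ f`. -/
noncomputable def pd (i : Fin N) (f : Sp N → ℝ) (x : Sp N) : ℝ :=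
  fderiv ℝ f x (EuclideanSpace.single i 1)

/-- The scalar product of the gradients of `f` and `g`. -/
noncomputable def gradDot (f g : Sp N → ℝ) (x : Sp N) : ℝ := ∑ i, pd i f x * pd i g x

variable {f g : Sp N → ℝ}

theorem contDiff_pd (hf : ContDiff ℝ ∞ f) (i : Fin N) : ContDiff ℝ ∞ (pd i f) :=
  (hf.fderiv_right (m := ∞) (by simp)).clm_apply contDiff_const

theorem IsTestFunction.pd (hf : IsTestFunction f) (i : Fin N) : IsTestFunction (pd i f) :=
  ⟨contDiff_pd hf.1 i, hf.2.fderiv_apply (𝕜 := ℝ) _⟩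

theorem IsTestFunction.continuous {𝕜 : Type*} [RCLike 𝕜] {f : Sp N → 𝕜} (hf : IsTestFunction f) :
    Continuous f := hf.1.continuous

theorem IsTestFunction.mul_left (hf : IsTestFunction f) (hg : ContDiff ℝ ∞ g) :
    IsTestFunction fun x => g x * f x :=
  ⟨hg.mul hf.1, hf.2.mul_left⟩

theorem IsTestFunction.const_mul (hf : IsTestFunction f) (c : ℝ) :
    IsTestFunction fun x => c * f x := hf.mul_left contDiff_const

theorem IsTestFunction.add (hf : IsTestFunction f) (hg : IsTestFunction g) :
    IsTestFunction fun x => f x + g x := ⟨hf.1.add hg.1, hf.2.add hg.2⟩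

theorem IsTestFunction.sub (hf : IsTestFunction f) (hg : IsTestFunction g) :
    IsTestFunction fun x => f x - g x := ⟨hf.1.sub hg.1, hf.2.sub hg.2⟩

theorem IsTestFunction.sum {ι : Type*} (s : Finset ι) {F : ι → Sp N → ℝ}
    (hF : ∀ i ∈ s, IsTestFunction (F i)) : IsTestFunction fun x => ∑ i ∈ s, F i x := by
  classical
  induction s using Finset.induction_on with
  | empty =>
    simp only [Finset.sum_empty]
    exact ⟨contDiff_const, HasCompactSupport.zero⟩
  | insert a s ha ih =>
    simp only [Finset.sum_insert ha]
    exact (hF a (by simp)).add (ih fun i hi => hF i (by simp [hi]))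

theorem IsTestFunction.exists_norm_le {𝕜 : Type*} [RCLike 𝕜] {f : Sp N → 𝕜}
    (hf : IsTestFunction f) : ∃ C, ∀ x, ‖f x‖ ≤ C :=
  hf.2.exists_bound_of_continuous hf.continuous

theorem fderiv_apply_eq_sum (f : Sp N → ℝ) (x v : Sp N) :
    fderiv ℝ f x v = ∑ i, pd i f x * v i := by
  have hv : v = ∑ i, v i • EuclideanSpace.single i (1 : ℝ) := by
    ext j; simp [Finset.sum_apply, Pi.single_apply]
  conv_lhs => rw [hv, map_sum]
  simp only [map_smul, smul_eq_mul, pd, mul_comm]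

theorem norm_fderiv_sq (f : Sp N → ℝ) (x : Sp N) : ‖fderiv ℝ f x‖ ^ 2 = gradDot f f x := by
  set v : Sp N := WithLp.toLp 2 fun i => pd i f x with hv
  have h1 : ∀ w, fderiv ℝ f x w = inner ℝ v w := fun w => by
    rw [fderiv_apply_eq_sum, PiLp.inner_apply]
    simp [hv, mul_comm]
  have h2 : ‖fderiv ℝ f x‖ = ‖v‖ := by
    rw [show fderiv ℝ f x = innerSL ℝ v from ContinuousLinearMap.ext h1, innerSL_apply_norm]
  rw [h2, EuclideanSpace.norm_sq_eq]
  simp [gradDot, hv, sq]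

theorem laplacian_eq_sum (hf : ContDiff ℝ ∞ f) (x : Sp N) :
    Laplacian.laplacian f x = ∑ i, pd i (pd i f) x := by
  rw [InnerProductSpace.laplacian_eq_iteratedFDeriv_orthonormalBasis f
    (EuclideanSpace.basisFun (Fin N) ℝ)]
  refine Finset.sum_congr rfl fun i _ => ?_
  rw [iteratedFDeriv_two_apply]
  have h1 : DifferentiableAt ℝ (fderiv ℝ f) x :=
    ((hf.fderiv_right (m := ∞) (by simp)).differentiable (by simp)) x
  simp only [EuclideanSpace.basisFun_apply, Matrix.cons_val_zero, Matrix.cons_val_one]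
  change _ = fderiv ℝ (fun y => fderiv ℝ f y (EuclideanSpace.single i 1)) x _
  rw [fderiv_clm_apply h1 (differentiableAt_const _)]
  simp

theorem pd_mul (hf : ContDiff ℝ ∞ f) (hg : ContDiff ℝ ∞ g) (i : Fin N) (x : Sp N) :
    pd i (fun y => f y * g y) x = f x * pd i g x + g x * pd i f x := by
  have := fderiv_fun_mul ((hf.differentiable (by simp)) x) ((hg.differentiable (by simp)) x)
  simp [pd, this]

theorem pd_add (hf : ContDiff ℝ ∞ f) (hg : ContDiff ℝ ∞ g) (i : Fin N) (x : Sp N) :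
    pd i (fun y => f y + g y) x = pd i f x + pd i g x := by
  have := fderiv_fun_add ((hf.differentiable (by simp)) x) ((hg.differentiable (by simp)) x)
  simp [pd, this]

theorem pd_sub (hf : ContDiff ℝ ∞ f) (hg : ContDiff ℝ ∞ g) (i : Fin N) (x : Sp N) :
    pd i (fun y => f y - g y) x = pd i f x - pd i g x := by
  have := fderiv_fun_sub ((hf.differentiable (by simp)) x) ((hg.differentiable (by simp)) x)
  simp [pd, this]

theorem pd_const_mul (hf : ContDiff ℝ ∞ f) (c : ℝ) (i : Fin N) (x : Sp N) :
    pd i (fun y => c * f y) x = c * pd i f x := by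
  have := fderiv_const_mul ((hf.differentiable (by simp)) x) c
  simp [pd, this]

theorem pd_comm (hf : ContDiff ℝ ∞ f) (i j : Fin N) (x : Sp N) :
    pd i (pd j f) x = pd j (pd i f) x := by
  have h1 : DifferentiableAt ℝ (fderiv ℝ f) x :=
    ((hf.fderiv_right (m := ∞) (by simp)).differentiable (by simp)) x
  have h2 : ∀ i j, pd i (pd j f) x =
      fderiv ℝ (fderiv ℝ f) x (EuclideanSpace.single i 1) (EuclideanSpace.single j 1) := by
    intro i j
    change fderiv ℝ (fun y => fderiv ℝ f y (EuclideanSpace.single j 1)) x _ = _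
    rw [fderiv_clm_apply h1 (differentiableAt_const _)]
    simp
  rw [h2, h2]
  exact ((hf.of_le (m := 2) (WithTop.coe_le_coe.2 le_top)).contDiffAt.isSymmSndFDerivAt (by simp)) _ _

theorem gradDot_comm (f g : Sp N → ℝ) (x : Sp N) : gradDot f g x = gradDot g f x :=
  Finset.sum_congr rfl fun _ _ => mul_comm _ _

theorem laplacian_mul (hf : ContDiff ℝ ∞ f) (hg : ContDiff ℝ ∞ g) (x : Sp N) :
    Laplacian.laplacian (fun y => f y * g y) x = f x * Laplacian.laplacian g x +
      2 * gradDot f g x + g x * Laplacian.laplacian f x := by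
  rw [laplacian_eq_sum (hf.mul hg), laplacian_eq_sum hf, laplacian_eq_sum hg, gradDot,
    Finset.mul_sum, Finset.mul_sum, Finset.mul_sum, ← Finset.sum_add_distrib,
    ← Finset.sum_add_distrib]
  refine Finset.sum_congr rfl fun i _ => ?_
  have h1 : pd i (fun y => f y * g y) = fun y => f y * pd i g y + g y * pd i f y :=
    funext fun y => pd_mul hf hg i y
  have hfi := contDiff_pd hf i
  have hgi := contDiff_pd hg i
  rw [h1, pd_add (hf.mul hgi) (hg.mul hfi), pd_mul hf hgi, pd_mul hg hfi]
  ring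

theorem IsTestFunction.integrable_mul {u : Sp N → ℝ} {ν : Measure (Sp N)} (hf : IsTestFunction f)
    (hu : LocallyIntegrable u ν) : Integrable (fun x => f x * u x) ν :=
  hu.integrable_smul_left_of_hasCompactSupport hf.continuous hf.2

theorem integral_pd_mul (hf : IsTestFunction f) (hg : ContDiff ℝ ∞ g) (i : Fin N) :
    ∫ x, pd i f x * g x = -∫ x, f x * pd i g x := by
  have := integral_mul_fderiv_eq_neg_fderiv_mul_of_integrable (μ := volume) (f := f) (g := g)
    (v := EuclideanSpace.single i 1)
    ((hf.pd i).integrable_mul hg.continuous.locallyIntegrable)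
    (hf.integrable_mul (contDiff_pd hg i).continuous.locallyIntegrable)
    (hf.integrable_mul hg.continuous.locallyIntegrable)
    (fun x _ => (hf.1.differentiable (by simp)) x) (fun x _ => (hg.differentiable (by simp)) x)
  simp only [pd]
  rw [this, neg_neg]

end PartialDerivatives

/-! ### Integration by parts against the density -/

section WeightedParts

variable {N : ℕ} {m : Sp N → ℝ} {G : Sp N → Sp N} {f g : Sp N → ℝ}

theorem HypothesisH1.ae_pos (h : HypothesisH1 m G) : ∀ᵐ x, 0 < m x := by
  have h1 : ∀ n : ℕ, ∀ᵐ x, x ∈ Metric.closedBall (0 : Sp N) n → 0 < m x := fun n => by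
    obtain ⟨c, hc, hcm⟩ := h.pos_on_compacts _ (isCompact_closedBall (0 : Sp N) n)
    rw [ae_restrict_iff' measurableSet_closedBall] at hcm
    filter_upwards [hcm] with x hx hxn using hc.trans_le (hx hxn)
  filter_upwards [ae_all_iff.2 h1] with x hx
  obtain ⟨n, hn⟩ := exists_nat_ge ‖x‖
  exact hx n (mem_closedBall_zero_iff.2 hn)

theorem HypothesisH1.locallyIntegrable_grad_apply (h : HypothesisH1 m G) (i : Fin N) :
    LocallyIntegrable fun x => G x i := fun x => by
  obtain ⟨s, hs, hi⟩ := h.hasWeakGradient.locallyIntegrable_grad x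
  exact ⟨s, hs, (EuclideanSpace.proj (𝕜 := ℝ) i).integrable_comp hi⟩

theorem kolmogorovExpr_real (hf : ContDiff ℝ ∞ f) (x : Sp N) :
    kolmogorovExpr m G f x = ∑ i, (pd i (pd i f) x + pd i f x * ((m x)⁻¹ * G x i)) := by
  rw [kolmogorovExpr, laplacian_eq_sum hf, fderiv_apply_eq_sum, ← Finset.sum_add_distrib]
  rfl

/-- Integration by parts with respect to the density `m`. -/
theorem HypothesisH1.integral_kolmogorovExpr_mul (h : HypothesisH1 m G) (hf : ContDiff ℝ ∞ f)
    (hg : IsTestFunction g) :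
    Integrable (fun x => kolmogorovExpr m G f x * g x * m x) ∧
    Integrable (fun x => gradDot f g x * m x) ∧
    ∫ x, kolmogorovExpr m G f x * g x * m x = -∫ x, gradDot f g x * m x := by
  have hm := h.hasWeakGradient.locallyIntegrable
  have hφ : ∀ i, IsTestFunction fun x => pd i f x * g x := fun i => hg.mul_left (contDiff_pd hf i)
  have hi1 : ∀ i : Fin N, Integrable fun x => pd i f x * g x * G x i := fun i =>
    (hφ i).integrable_mul (h.locallyIntegrable_grad_apply i)
  have hi2 : ∀ i : Fin N, Integrable fun x => pd i (fun y => pd i f y * g y) x * m x := fun i =>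
    ((hφ i).pd i).integrable_mul hm
  have hi3 : ∀ i : Fin N, Integrable fun x => pd i f x * pd i g x * m x := fun i =>
    ((hg.pd i).mul_left (contDiff_pd hf i)).integrable_mul hm
  -- The density cancels the denominator of ∇m/m. What remains is the weak gradient of m tested
  -- against ∂ᵢf · g, up to the Dirichlet term.
  have hae : (fun x => kolmogorovExpr m G f x * g x * m x) =ᵐ[volume] fun x => ∑ i,
      (pd i (fun y => pd i f y * g y) x * m x + pd i f x * g x * G x i -
        pd i f x * pd i g x * m x) := by
    filter_upwards [h.ae_pos] with x hx
    rw [kolmogorovExpr_real hf, Finset.sum_mul, Finset.sum_mul]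
    refine Finset.sum_congr rfl fun i _ => ?_
    rw [pd_mul (contDiff_pd hf i) hg.1]
    field_simp
    ring
  have hi4 : ∀ i : Fin N, Integrable fun x => pd i (fun y => pd i f y * g y) x * m x +
      pd i f x * g x * G x i - pd i f x * pd i g x * m x :=
    fun i => ((hi2 i).add (hi1 i)).sub (hi3 i)
  have hgd : (fun x => gradDot f g x * m x) = fun x => ∑ i, pd i f x * pd i g x * m x :=
    funext fun x => by rw [gradDot, Finset.sum_mul]
  refine ⟨(integrable_finsetSum _ fun i _ => hi4 i).congr hae.symm, ?_, ?_⟩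
  · rw [hgd]; exact integrable_finsetSum _ fun i _ => hi3 i
  · rw [integral_congr_ae hae, hgd, integral_finsetSum _ fun i _ => hi4 i,
      integral_finsetSum _ fun i _ => hi3 i, ← Finset.sum_neg_distrib]
    refine Finset.sum_congr rfl fun i _ => ?_
    have e1 := h.hasWeakGradient.integral_eq _ (hφ i) i
    have e2 : ∫ x, pd i (fun y => pd i f y * g y) x * m x = -∫ x, pd i f x * g x * G x i := by
      rw [← e1]
      exact integral_congr_ae (Eventually.of_forall fun x => mul_comm _ _)
    have e3 := integral_sub ((hi2 i).add (hi1 i)) (hi3 i)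
    have e4 := integral_add (hi2 i) (hi1 i)
    simp only [Pi.add_apply] at e3
    rw [e3, e4, e2]
    ring

end WeightedParts

/-! ### Very weak solutions of `λ w - Δ w = 0` -/

section FreeEquation

variable {N : ℕ}

/-- Cutoff functions with uniformly decaying gradients. -/
theorem exists_cutoffs (N : ℕ) : ∃ (C : ℝ) (φ : ℕ → Sp N → ℝ), 0 ≤ C ∧ ∀ n, IsTestFunction (φ n) ∧
    (∀ x, 0 ≤ φ n x) ∧ (∀ x, φ n x ≤ 1) ∧ (∀ x, ‖x‖ ≤ n + 1 → φ n x = 1) ∧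
    ∀ x, gradDot (φ n) (φ n) x ≤ C / ((n : ℝ) + 1) ^ 2 := by
  set χ := cutoff N 1 one_pos
  have hχ : ContDiff ℝ ∞ χ := χ.contDiff
  obtain ⟨D, hD⟩ := (χ.hasCompactSupport.fderiv (𝕜 := ℝ)).exists_bound_of_continuous
    (hχ.continuous_fderiv (by simp))
  have hD0 : 0 ≤ D := (norm_nonneg _).trans (hD 0)
  refine ⟨D ^ 2, fun n x => χ (((n : ℝ) + 1)⁻¹ • x), by positivity, fun n => ?_⟩
  have hn : (0 : ℝ) < (n : ℝ) + 1 := by positivity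
  refine ⟨⟨hχ.comp (contDiff_const_smul _),
    χ.hasCompactSupport.comp_homeomorph (Homeomorph.smulOfNeZero _ (inv_ne_zero hn.ne'))⟩,
    fun x => χ.nonneg, fun x => χ.le_one, fun x hx => cutoff_eq_one one_pos ?_, fun x => ?_⟩
  · rw [norm_smul, norm_inv, Real.norm_of_nonneg hn.le]
    rwa [inv_mul_le_iff₀ hn, mul_one]
  · rw [← norm_fderiv_sq]
    have h1 : HasFDerivAt (fun x : Sp N => χ (((n : ℝ) + 1)⁻¹ • x))
        ((fderiv ℝ χ (((n : ℝ) + 1)⁻¹ • x)).comp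
          (((n : ℝ) + 1)⁻¹ • ContinuousLinearMap.id ℝ (Sp N))) x :=
      ((hχ.differentiable (by simp)) _).hasFDerivAt.comp x
        ((hasFDerivAt_id x).const_smul (((n : ℝ) + 1)⁻¹))
    rw [h1.fderiv, ContinuousLinearMap.comp_smul, ContinuousLinearMap.comp_id, norm_smul, mul_pow,
      norm_inv, Real.norm_of_nonneg hn.le, div_eq_inv_mul, inv_pow]
    gcongr
    exact hD _

/-- The convolution of a kernel with a function. -/
noncomputable def kernelConv (k w : Sp N → ℝ) (x : Sp N) : ℝ := ∫ y, k (x - y) * w y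

theorem IsTestFunction.comp_sub_left {k : Sp N → ℝ} (hk : IsTestFunction k) (x : Sp N) :
    IsTestFunction fun y => k (x - y) :=
  ⟨hk.1.comp (contDiff_const.sub contDiff_id), hk.2.comp_homeomorph (Homeomorph.subLeft x)⟩

theorem pd_kernelConv {k w : Sp N → ℝ} (hk : IsTestFunction k) (hw : LocallyIntegrable w)
    (i : Fin N) : pd i (kernelConv k w) = kernelConv (pd i k) w := by
  funext x
  have h0 : kernelConv k w = convolution k w (ContinuousLinearMap.lsmul ℝ ℝ) volume := by
    funext x
    exact (convolution_eq_swap (ContinuousLinearMap.lsmul ℝ ℝ) (f := k) (g := w)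
      (μ := volume)).symm
  have h1 := hk.2.hasFDerivAt_convolution_left
    (ContinuousLinearMap.lsmul ℝ ℝ) (hk.1.of_le (by simp)) hw x
  have h4 : ConvolutionExistsAt (fderiv ℝ k) w x
      ((ContinuousLinearMap.lsmul ℝ ℝ).precompL (Sp N)) volume :=
    (hk.2.fderiv (𝕜 := ℝ)).convolutionExists_left _ (hk.1.continuous_fderiv (by simp)) hw x
  rw [pd, h0, h1.fderiv, convolution_def, ContinuousLinearMap.integral_apply h4, kernelConv,
    ← integral_sub_left_eq_self _ volume x]
  refine integral_congr_ae (Eventually.of_forall fun t => ?_)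
  simp [ContinuousLinearMap.precompL_apply, pd]

theorem pd_comp_sub_left {k : Sp N → ℝ} (hk : ContDiff ℝ ∞ k) (i : Fin N) (x y : Sp N) :
    pd i (fun y => k (x - y)) y = -pd i k (x - y) := by
  have h8 : HasFDerivAt (fun y : Sp N => k (x - y))
      ((fderiv ℝ k (x - y)).comp (-ContinuousLinearMap.id ℝ (Sp N))) y :=
    ((hk.differentiable (by simp)) _).hasFDerivAt.comp y ((hasFDerivAt_id y).const_sub x)
  rw [pd, h8.fderiv]
  simp [pd]

theorem laplacian_comp_sub_left {k : Sp N → ℝ} (hk : IsTestFunction k) (x y : Sp N) :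
    Laplacian.laplacian (fun y => k (x - y)) y = Laplacian.laplacian k (x - y) := by
  rw [laplacian_eq_sum (hk.comp_sub_left x).1, laplacian_eq_sum hk.1]
  refine Finset.sum_congr rfl fun i _ => ?_
  have h1 : pd i (fun y => k (x - y)) = fun y => (-1) * pd i k (x - y) :=
    funext fun y => by rw [pd_comp_sub_left hk.1]; ring
  rw [h1, pd_const_mul ((hk.pd i).comp_sub_left x).1, pd_comp_sub_left (hk.pd i).1]
  ring

theorem isTestFunction_mollifier (n : ℕ) : IsTestFunction (mollifier (volume : Measure (Sp N)) n) :=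
  ⟨mollifier_contDiff n, mollifier_hasCompactSupport n⟩

theorem mollify_eq_kernelConv (n : ℕ) (w : Sp N → ℝ) :
    mollify volume n w = kernelConv (mollifier volume n) w :=
  funext fun x => mollify_eq_swap n w x

theorem laplacian_mollify {w : Sp N → ℝ} (hw : LocallyIntegrable w) (n : ℕ) (x : Sp N) :
    Laplacian.laplacian (mollify volume n w) x =
      ∫ y, Laplacian.laplacian (fun y => mollifier volume n (x - y)) y * w y := by
  have hk := isTestFunction_mollifier (N := N) n
  rw [laplacian_eq_sum (mollify_contDiff hw n), mollify_eq_kernelConv]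
  simp_rw [laplacian_comp_sub_left hk, laplacian_eq_sum hk.1, Finset.sum_mul]
  rw [integral_finsetSum]
  · refine Finset.sum_congr rfl fun i _ => ?_
    rw [pd_kernelConv hk hw, pd_kernelConv (hk.pd i) hw, kernelConv]
  · exact fun i _ => (((hk.pd i).pd i).comp_sub_left x).integrable_mul hw

/-- Jensen's inequality, from expanding ∫ k (w - W)² ≥ 0 with W the mean of w. It keeps
mollifications of L² functions square integrable. -/
theorem mollify_sq_le {w : Sp N → ℝ} (hw : LocallyIntegrable w)
    (hw2 : LocallyIntegrable fun x => w x ^ 2) (n : ℕ) (x : Sp N) :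
    mollify volume n w x ^ 2 ≤ mollify volume n (fun y => w y ^ 2) x := by
  set k : Sp N → ℝ := fun t => mollifier volume n (x - t)
  set W := mollify volume n w x with hW
  have h1 : Integrable fun t => k t * w t := integrable_mollifier_smul hw n x
  have h2 : Integrable fun t => k t * w t ^ 2 := integrable_mollifier_smul hw2 n x
  have h3 : Integrable k := (mollifier_integrable n).comp_sub_left x
  have h4 : ∫ t, k t = 1 := by
    rw [integral_sub_left_eq_self (mollifier volume n) volume x, mollifier_integral]
  have h5 : ∫ t, k t * w t = W := (mollify_eq_swap n w x).symm
  have h6 : mollify volume n (fun y => w y ^ 2) x = ∫ t, k t * w t ^ 2 := mollify_eq_swap n _ x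
  have h7 : 0 ≤ ∫ t, k t * (w t - W) ^ 2 :=
    integral_nonneg fun t => mul_nonneg (mollifier_nonneg n _) (sq_nonneg _)
  have h8 : ∫ t, k t * (w t - W) ^ 2 = ∫ t, (k t * w t ^ 2 - (2 * W) * (k t * w t) + W ^ 2 * k t) :=
    integral_congr_ae (Eventually.of_forall fun t => by ring)
  have h9 : Integrable fun t => k t * w t ^ 2 - (2 * W) * (k t * w t) := h2.sub (h1.const_mul _)
  rw [h8, integral_add h9 (h3.const_mul _), integral_sub h2 (h1.const_mul _),
    integral_const_mul, integral_const_mul, h4, h5] at h7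
  rw [h6]
  linarith

/-- Testing with φ²W gives l ∫ φ²W² ≤ ∫ |∇φ|² W², and the cutoffs have gradients of order 1/n. -/
theorem eq_zero_of_classical {W : Sp N → ℝ} (hW : ContDiff ℝ ∞ W)
    (hi : Integrable fun x => W x ^ 2) {l : ℝ} (hl : 0 < l)
    (heq : ∀ x, Laplacian.laplacian W x = l * W x) : ∀ x, W x = 0 := by
  obtain ⟨C, φ, hC, hφ⟩ := exists_cutoffs N
  set I := ∫ x, W x ^ 2
  have key : ∀ n, l * ∫ x, φ n x ^ 2 * W x ^ 2 ≤ C / ((n : ℝ) + 1) ^ 2 * I := by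
    intro n
    obtain ⟨ht, h0, h1, -, hg⟩ := hφ n
    have ht2 : IsTestFunction fun x => φ n x * φ n x := ht.mul_left ht.1
    have htW : IsTestFunction fun x => W x * (φ n x * φ n x) := ht2.mul_left hW
    have e0 : ∀ i, Integrable fun x => pd i (fun x => W x * (φ n x * φ n x)) x * pd i W x :=
      fun i => (htW.pd i).integrable_mul (contDiff_pd hW i).continuous.locallyIntegrable
    have e0' : ∀ i, Integrable fun x => (W x * (φ n x * φ n x)) * pd i (pd i W) x :=
      fun i => htW.integrable_mul (contDiff_pd (contDiff_pd hW i) i).continuous.locallyIntegrable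
    have e1 : ∫ x, l * (φ n x ^ 2 * W x ^ 2) =
        -∑ i, ∫ x, pd i (fun x => W x * (φ n x * φ n x)) x * pd i W x := by
      rw [← Finset.sum_neg_distrib]
      simp_rw [integral_pd_mul htW (contDiff_pd hW _), neg_neg]
      rw [← integral_finsetSum _ fun i _ => e0' i]
      refine integral_congr_ae (Eventually.of_forall fun x => ?_)
      simp only
      rw [← Finset.mul_sum, ← laplacian_eq_sum hW, heq]
      ring
    rw [← integral_const_mul, e1, ← integral_finsetSum _ fun i _ => e0 i, ← integral_neg,
      ← integral_const_mul]
    refine integral_mono (integrable_finsetSum _ fun i _ => e0 i).neg (hi.const_mul _) fun x => ?_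
    refine le_trans ?_ (mul_le_mul_of_nonneg_right (hg x) (sq_nonneg (W x)))
    simp only
    rw [gradDot, Finset.sum_mul, ← Finset.sum_neg_distrib]
    refine Finset.sum_le_sum fun i _ => ?_
    rw [pd_mul hW ht2.1, pd_mul ht.1 ht.1]
    -- Completing the square absorbs the cross term 2Wφ ∂ᵢφ ∂ᵢW.
    nlinarith [sq_nonneg (W x * pd i (φ n) x + φ n x * pd i W x)]
  have lim1 : Tendsto (fun n => l * ∫ x, φ n x ^ 2 * W x ^ 2) atTop (𝓝 (l * I)) := by
    refine Tendsto.const_mul _ (tendsto_integral_of_dominated_convergence (fun x => W x ^ 2)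
      (fun n => ?_) hi (fun n => Eventually.of_forall fun x => ?_) (Eventually.of_forall fun x => ?_))
    · exact (((hφ n).1.continuous.pow 2).mul (hW.continuous.pow 2)).aestronglyMeasurable
    · obtain ⟨-, h0, h1, -⟩ := hφ n
      rw [Real.norm_of_nonneg (by positivity)]
      exact mul_le_of_le_one_left (sq_nonneg _) (pow_le_one₀ (h0 x) (h1 x))
    · obtain ⟨k, hk⟩ := exists_nat_ge ‖x‖
      refine tendsto_const_nhds.congr' ?_
      filter_upwards [eventually_ge_atTop k] with n hn
      have : (k : ℝ) ≤ n := by exact_mod_cast hn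
      rw [(hφ n).2.2.2.1 x (by linarith)]
      ring
  have lim2 : Tendsto (fun n : ℕ => C / ((n : ℝ) + 1) ^ 2 * I) atTop (𝓝 (0 * I)) := by
    refine Tendsto.mul_const _ (Tendsto.div_atTop tendsto_const_nhds ?_)
    exact (tendsto_pow_atTop two_ne_zero).comp
      (tendsto_atTop_add_const_right _ _ tendsto_natCast_atTop_atTop)
  have hI : l * I ≤ 0 * I := le_of_tendsto_of_tendsto' lim1 lim2 key
  have hI0 : 0 ≤ I := integral_nonneg fun x => sq_nonneg _
  have hI1 : I = 0 := by nlinarith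
  have hae : (fun x => W x ^ 2) =ᵐ[volume] 0 :=
    (integral_eq_zero_iff_of_nonneg (fun x => sq_nonneg _) hi).1 hI1
  have := (Continuous.ae_eq_iff_eq volume (hW.continuous.pow 2) continuous_const).1 hae
  intro x
  exact pow_eq_zero_iff two_ne_zero |>.1 (congrFun this x)

/-- Very weak solutions of `λ w - Δ w = 0` in `L²` vanish. -/
theorem eq_zero_of_veryWeak {w : Sp N → ℝ} (hw : MemLp w 2 volume) {l : ℝ} (hl : 0 < l)
    (heq : ∀ f : Sp N → ℝ, IsTestFunction f →
      ∫ x, (l * f x - Laplacian.laplacian f x) * w x = 0) : w =ᵐ[volume] 0 := by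
  have hwl : LocallyIntegrable w := hw.locallyIntegrable (by norm_num)
  have hw2 : Integrable fun x => w x ^ 2 := hw.integrable_sq
  have hn : ∀ n x, mollify volume n w x = 0 := by
    intro n
    have hW := mollify_contDiff (μ := (volume : Measure (Sp N))) hwl n
    refine eq_zero_of_classical hW ?_ hl fun x => ?_
    · refine (mollify_integrable hw2 n).mono' (hW.continuous.pow 2).aestronglyMeasurable
        (Eventually.of_forall fun x => ?_)
      rw [Real.norm_of_nonneg (sq_nonneg _)]
      exact mollify_sq_le hwl hw2.locallyIntegrable n x
    -- Testing the equation with the kernel y ↦ ρ_n(x - y) shows that the mollification is a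
    -- classical solution.
    · have hk := (isTestFunction_mollifier (N := N) n).comp_sub_left x
      have h1 := heq _ hk
      have i1 := hk.integrable_mul hwl
      have i2 : Integrable fun y =>
          Laplacian.laplacian (fun y => mollifier volume n (x - y)) y * w y := by
        simp_rw [laplacian_eq_sum hk.1]
        exact (IsTestFunction.sum _ fun i _ => (hk.pd i).pd i).integrable_mul hwl
      simp_rw [sub_mul, mul_assoc] at h1
      rw [integral_sub (i1.const_mul l) i2, integral_const_mul] at h1
      rw [laplacian_mollify hwl, mollify_eq_kernelConv, kernelConv]
      linarith
  filter_upwards [mollify_ae_tendsto hwl] with x hx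
  simp only [hn] at hx
  exact tendsto_nhds_unique hx tendsto_const_nhds |>.symm ▸ rfl

end FreeEquation

/-! ### Very weak solutions of `λ w - Δ w + div (b w) = 0` -/

section Perturbation

variable {N : ℕ}

/-- Multiplication by `b` is form bounded with respect to the Dirichlet form, with bound `0`. -/
structure IsFormBounded (b : Sp N → Sp N) : Prop where
  aestronglyMeasurable : AEStronglyMeasurable b volume
  exists_le : ∀ ε : ℝ, 0 < ε → ∃ K : ℝ, 0 ≤ K ∧ ∀ f : Sp N → ℝ, IsTestFunction f →
    Integrable (fun x => ‖b x‖ ^ 2 * f x ^ 2) ∧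
    ∫ x, ‖b x‖ ^ 2 * f x ^ 2 ≤ ε * (∫ x, gradDot f f x) + K * ∫ x, f x ^ 2

theorem IsTestFunction.integrable {ν : Measure (Sp N)} [IsFiniteMeasureOnCompacts ν] {f : Sp N → ℝ}
    (hf : IsTestFunction f) : Integrable f ν :=
  hf.continuous.integrable_of_hasCompactSupport hf.2

theorem IsTestFunction.mul {f g : Sp N → ℝ} (hf : IsTestFunction f) (hg : IsTestFunction g) :
    IsTestFunction fun x => f x * g x := hg.mul_left hf.1

theorem IsTestFunction.sq {f : Sp N → ℝ} (hf : IsTestFunction f) :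
    IsTestFunction fun x => f x ^ 2 := by
  simpa only [pow_two] using hf.mul hf

theorem IsTestFunction.gradDot {f g : Sp N → ℝ} (hf : IsTestFunction f) (hg : IsTestFunction g) :
    IsTestFunction (gradDot f g) :=
  IsTestFunction.sum _ fun i _ => (hf.pd i).mul (hg.pd i)

theorem IsTestFunction.laplacian {f : Sp N → ℝ} (hf : IsTestFunction f) :
    IsTestFunction (Laplacian.laplacian f) := by
  rw [show Laplacian.laplacian f = fun x => ∑ i, BiKolmogorov.pd i (BiKolmogorov.pd i f) x from
    funext fun x => laplacian_eq_sum hf.1 x]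
  exact IsTestFunction.sum _ fun i _ => (hf.pd i).pd i

theorem HypothesisH1.isFormBounded (hN : 1 ≤ N) {m : Sp N → ℝ} {G : Sp N → Sp N}
    (h : HypothesisH1 m G) {K : Set (Sp N)} (hK : IsCompact K) :
    IsFormBounded (K.indicator (logGrad m G)) := by
  have hKm := hK.isClosed.measurableSet
  have hbm : AEStronglyMeasurable (K.indicator (logGrad m G)) volume := by
    obtain ⟨q, -, -, hLq⟩ := h.exists_exponent hN
    exact (aestronglyMeasurable_indicator_iff hKm).2 (hLq K hK).1
  refine ⟨hbm, fun ε hε => ?_⟩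
  obtain ⟨W, α, hα, hW, hae⟩ := h.exists_morreyWeight hN hK
  obtain ⟨K', hK'⟩ := hW.exists_lintegral_le hα (ε := ε.toNNReal) (Real.toNNReal_pos.2 hε)
  refine ⟨K', K'.2, fun f hf => ?_⟩
  have h1 := hK' f (hf.1.of_le (by simp))
  have e1 : ∫⁻ x, ‖fderiv ℝ f x‖ₑ ^ 2 = ENNReal.ofReal (∫ x, gradDot f f x) := by
    rw [ofReal_integral_eq_lintegral_ofReal (hf.gradDot hf).integrable (Eventually.of_forall
      fun x => by rw [← norm_fderiv_sq]; positivity)]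
    refine lintegral_congr fun x => ?_
    rw [← norm_fderiv_sq, ENNReal.ofReal_pow (norm_nonneg _), ofReal_norm]
  have e2 : ∫⁻ x, ‖f x‖ₑ ^ 2 = ENNReal.ofReal (∫ x, f x ^ 2) := by
    rw [ofReal_integral_eq_lintegral_ofReal hf.sq.integrable (Eventually.of_forall
      fun x => sq_nonneg _)]
    refine lintegral_congr fun x => ?_
    rw [← sq_abs, ENNReal.ofReal_pow (abs_nonneg _), ← Real.norm_eq_abs, ofReal_norm]
  have n1 : 0 ≤ ∫ x, gradDot f f x := integral_nonneg fun x => by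
    rw [← norm_fderiv_sq]; positivity
  have n2 : 0 ≤ ∫ x, f x ^ 2 := integral_nonneg fun x => sq_nonneg _
  rw [e1, e2, ← ENNReal.ofReal_coe_nnreal, ← ENNReal.ofReal_coe_nnreal (p := K'),
    Real.coe_toNNReal _ hε.le, ← ENNReal.ofReal_mul hε.le, ← ENNReal.ofReal_mul K'.coe_nonneg,
    ← ENNReal.ofReal_add (by positivity) (mul_nonneg K'.coe_nonneg n2)] at h1
  have e3 : ∀ x, ENNReal.ofReal (‖K.indicator (logGrad m G) x‖ ^ 2 * f x ^ 2) =
      ‖K.indicator (logGrad m G) x‖ₑ ^ 2 * ‖f x‖ₑ ^ 2 := fun x => by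
    rw [ENNReal.ofReal_mul (by positivity), ENNReal.ofReal_pow (norm_nonneg _), ofReal_norm,
      ← sq_abs (f x), ENNReal.ofReal_pow (abs_nonneg _), ← Real.norm_eq_abs, ofReal_norm]
  have h2 : ∫⁻ x, ENNReal.ofReal (‖K.indicator (logGrad m G) x‖ ^ 2 * f x ^ 2) ≤ _ :=
    le_trans (lintegral_mono_ae (by
      filter_upwards [hae] with x hx
      rw [e3]
      by_cases hxK : x ∈ K
      · rw [Set.indicator_of_mem hxK, hx hxK]
      · rw [Set.indicator_of_notMem hxK]; simp)) h1
  have hme : AEStronglyMeasurable (fun x => ‖K.indicator (logGrad m G) x‖ ^ 2 * f x ^ 2) volume :=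
    (hbm.norm.pow 2).mul (hf.continuous.pow 2).aestronglyMeasurable
  have hnn : ∀ x, 0 ≤ ‖K.indicator (logGrad m G) x‖ ^ 2 * f x ^ 2 := fun x => by positivity
  refine ⟨⟨hme, ?_⟩, ?_⟩
  · rw [hasFiniteIntegral_iff_ofReal (Eventually.of_forall hnn)]
    exact h2.trans_lt ENNReal.ofReal_lt_top
  · rw [integral_eq_lintegral_of_nonneg_ae (Eventually.of_forall hnn) hme]
    exact ENNReal.toReal_le_of_le_ofReal (add_nonneg (by positivity) (mul_nonneg K'.coe_nonneg n2)) h2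

theorem integral_mul_laplacian {f g : Sp N → ℝ} (hf : ContDiff ℝ ∞ f) (hg : IsTestFunction g) :
    ∫ x, g x * Laplacian.laplacian f x = -∫ x, gradDot g f x := by
  simp_rw [laplacian_eq_sum hf, gradDot, Finset.mul_sum]
  rw [integral_finsetSum _ fun i _ => hg.integrable_mul
      (contDiff_pd (contDiff_pd hf i) i).continuous.locallyIntegrable,
    integral_finsetSum _ fun i _ => (hg.pd i).integrable_mul
      (contDiff_pd hf i).continuous.locallyIntegrable, ← Finset.sum_neg_distrib]
  exact Finset.sum_congr rfl fun i _ => by rw [integral_pd_mul hg (contDiff_pd hf i), neg_neg]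

/-- Two integrations by parts turn ∂ᵢ∂ᵢf ∂ⱼ∂ⱼf into (∂ⱼ∂ᵢf)². The Laplacian thus controls all second
derivatives in L². -/
theorem integral_laplacian_sq {f : Sp N → ℝ} (hf : IsTestFunction f) :
    ∫ x, Laplacian.laplacian f x ^ 2 = ∑ i, ∫ x, gradDot (pd i f) (pd i f) x := by
  have h1 : ∀ i j : Fin N, ∫ x, pd i (pd i f) x * pd j (pd j f) x =
      ∫ x, pd j (pd i f) x * pd j (pd i f) x := by
    intro i j
    have e1 : pd i (pd j (pd j f)) = pd j (pd j (pd i f)) := by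
      funext x
      rw [pd_comm (hf.pd j).1, show pd i (pd j f) = pd j (pd i f) from
        funext fun y => pd_comm hf.1 i j y]
    have e2 := integral_pd_mul (hf.pd i) ((hf.pd j).pd j).1 i
    have e3 := integral_pd_mul (hf.pd i) ((hf.pd i).pd j).1 j
    rw [e2, e1, e3]
  simp_rw [laplacian_eq_sum hf.1, pow_two, Finset.sum_mul_sum, gradDot]
  rw [integral_finsetSum _ fun i _ => (IsTestFunction.sum _ fun j _ =>
    ((hf.pd i).pd i).mul ((hf.pd j).pd j)).integrable]
  refine Finset.sum_congr rfl fun i _ => ?_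
  rw [integral_finsetSum _ fun j _ => (((hf.pd i).pd i).mul ((hf.pd j).pd j)).integrable,
    integral_finsetSum _ fun j _ => (((hf.pd i).pd j).mul ((hf.pd i).pd j)).integrable]
  exact Finset.sum_congr rfl fun j _ => h1 i j

theorem integral_resolvent_sq {f : Sp N → ℝ} (hf : IsTestFunction f) (l : ℝ) :
    ∫ x, (l * f x - Laplacian.laplacian f x) ^ 2 = l ^ 2 * (∫ x, f x ^ 2) +
      2 * l * (∫ x, gradDot f f x) + ∑ i, ∫ x, gradDot (pd i f) (pd i f) x := by
  have h1 := integral_mul_laplacian hf.1 hf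
  have e1 : ∀ x, (l * f x - Laplacian.laplacian f x) ^ 2 = l ^ 2 * f x ^ 2 +
      (-(2 * l)) * (f x * Laplacian.laplacian f x) + Laplacian.laplacian f x ^ 2 :=
    fun x => by ring
  have i1 := hf.sq.integrable (ν := volume) |>.const_mul (l ^ 2)
  have i2 := (hf.mul hf.laplacian).integrable (ν := volume) |>.const_mul (-(2 * l))
  have i12 : Integrable fun x => l ^ 2 * f x ^ 2 + (-(2 * l)) * (f x * Laplacian.laplacian f x) :=
    i1.add i2
  simp_rw [e1]
  rw [integral_add i12 hf.laplacian.sq.integrable, integral_add i1 i2, integral_const_mul,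
    integral_const_mul, h1, integral_laplacian_sq hf]
  ring

theorem sq_fderiv_apply_le (f : Sp N → ℝ) (x v : Sp N) :
    (fderiv ℝ f x v) ^ 2 ≤ ∑ i, ‖v‖ ^ 2 * pd i f x ^ 2 := by
  have h1 : |fderiv ℝ f x v| ≤ ‖fderiv ℝ f x‖ * ‖v‖ := (fderiv ℝ f x).le_opNorm v
  rw [← sq_abs, ← Finset.mul_sum]
  calc _ ≤ (‖fderiv ℝ f x‖ * ‖v‖) ^ 2 := by gcongr
    _ = _ := by rw [mul_pow, norm_fderiv_sq, mul_comm, gradDot]; simp_rw [pow_two (pd _ f x)]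

/-- Form boundedness with ε = 1/4 is applied to each ∂ᵢf. The second derivatives are then absorbed
exactly, and K ∫ |∇f|² is absorbed by the term 2l ∫ |∇f|² of `integral_resolvent_sq`, as K ≤ l/2.
The factor 1/4 on squares is a factor 1/2 on norms, so the drift is a strict perturbation of l - Δ.
-/
theorem IsFormBounded.exists_drift_le {b : Sp N → Sp N} (hb : IsFormBounded b) :
    ∃ l : ℝ, 0 < l ∧ ∀ f : Sp N → ℝ, IsTestFunction f →
      MemLp (fun x => fderiv ℝ f x (b x)) 2 volume ∧
      ∫ x, (fderiv ℝ f x (b x)) ^ 2 ≤ 1 / 4 * ∫ x, (l * f x - Laplacian.laplacian f x) ^ 2 := by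
  obtain ⟨K, hK0, hK⟩ := hb.exists_le (1 / 4) (by norm_num)
  refine ⟨2 * K + 1, by positivity, fun f hf => ?_⟩
  have hint : ∀ i, Integrable fun x => ‖b x‖ ^ 2 * pd i f x ^ 2 := fun i => (hK _ (hf.pd i)).1
  have hint2 := integrable_finsetSum Finset.univ fun i _ => hint i
  have hme : AEStronglyMeasurable (fun x => fderiv ℝ f x (b x)) volume :=
    (isBoundedBilinearMap_apply (𝕜 := ℝ) (E := Sp N) (F := ℝ)).continuous.comp_aestronglyMeasurable
      ((hf.1.continuous_fderiv (by simp)).aestronglyMeasurable.prodMk hb.aestronglyMeasurable)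
  have hi : Integrable fun x => (fderiv ℝ f x (b x)) ^ 2 :=
    hint2.mono' (hme.pow 2) (Eventually.of_forall fun x => by
      rw [Real.norm_of_nonneg (sq_nonneg _)]; exact sq_fderiv_apply_le f x (b x))
  refine ⟨(memLp_two_iff_integrable_sq hme).2 hi, ?_⟩
  have h1 : ∫ x, (fderiv ℝ f x (b x)) ^ 2 ≤ ∑ i, ∫ x, ‖b x‖ ^ 2 * pd i f x ^ 2 := by
    rw [← integral_finsetSum _ fun i _ => hint i]
    exact integral_mono hi hint2 fun x => sq_fderiv_apply_le f x (b x)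
  have h2 : ∑ i, ∫ x, ‖b x‖ ^ 2 * pd i f x ^ 2 ≤
      1 / 4 * (∑ i, ∫ x, gradDot (pd i f) (pd i f) x) + K * ∫ x, gradDot f f x := by
    have e1 : ∫ x, gradDot f f x = ∑ i, ∫ x, pd i f x ^ 2 := by
      simp_rw [gradDot, pow_two]
      exact integral_finsetSum _ fun i _ => ((hf.pd i).mul (hf.pd i)).integrable
    rw [e1, Finset.mul_sum, Finset.mul_sum, ← Finset.sum_add_distrib]
    exact Finset.sum_le_sum fun i _ => (hK _ (hf.pd i)).2
  have n1 : 0 ≤ ∫ x, gradDot f f x := integral_nonneg fun x => by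
    rw [← norm_fderiv_sq]; positivity
  have n2 : 0 ≤ ∫ x, f x ^ 2 := integral_nonneg fun x => sq_nonneg _
  rw [integral_resolvent_sq hf]
  have : 0 ≤ (2 * K + 1) ^ 2 * ∫ x, f x ^ 2 := by positivity
  nlinarith

theorem inner_toLp {ν : Measure (Sp N)} {f g : Sp N → ℝ} (hf : MemLp f 2 ν) (hg : MemLp g 2 ν) :
    inner ℝ (hf.toLp f) (hg.toLp g) = ∫ x, f x * g x ∂ν := by
  rw [L2.inner_def]
  refine integral_congr_ae ?_
  filter_upwards [hf.coeFn_toLp, hg.coeFn_toLp] with x h1 h2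
  rw [h1, h2]
  simp [mul_comm]

theorem norm_toLp_sq {ν : Measure (Sp N)} {f : Sp N → ℝ} (hf : MemLp f 2 ν) :
    ‖hf.toLp f‖ ^ 2 = ∫ x, f x ^ 2 ∂ν := by
  rw [← real_inner_self_eq_norm_sq, inner_toLp]
  simp_rw [pow_two]

theorem IsTestFunction.memLp {ν : Measure (Sp N)} [IsFiniteMeasureOnCompacts ν] {f : Sp N → ℝ}
    (hf : IsTestFunction f) {p : ℝ≥0∞} : MemLp f p ν :=
  hf.continuous.memLp_of_hasCompactSupport hf.2

/-- Functions of the form `λ f - Δ f` with `f` a test function. -/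
noncomputable def freeRange (N : ℕ) (l : ℝ) : Submodule ℝ (Lp ℝ 2 (volume : Measure (Sp N))) where
  carrier := {u | ∃ f : Sp N → ℝ, IsTestFunction f ∧
    u =ᵐ[volume] fun x => l * f x - Laplacian.laplacian f x}
  zero_mem' := by
    refine ⟨fun _ => 0, ⟨contDiff_const, HasCompactSupport.zero⟩,
      (Lp.coeFn_zero _ _ _).trans (Eventually.of_forall fun x => ?_)⟩
    simp [InnerProductSpace.laplacian_const]
  add_mem' := by
    rintro u v ⟨f, hf, hu⟩ ⟨g, hg, hv⟩
    refine ⟨_, hf.add hg, (Lp.coeFn_add u v).trans ?_⟩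
    filter_upwards [hu, hv] with x h1 h2
    simp only [Pi.add_apply, h1, h2, laplacian_eq_sum (hf.add hg).1, laplacian_eq_sum hf.1,
      laplacian_eq_sum hg.1]
    have e1 : ∀ i, pd i (fun x => f x + g x) = fun x => pd i f x + pd i g x :=
      fun i => funext fun x => pd_add hf.1 hg.1 i x
    simp_rw [e1, pd_add (hf.pd _).1 (hg.pd _).1, Finset.sum_add_distrib]
    ring
  smul_mem' := by
    rintro c u ⟨f, hf, hu⟩
    refine ⟨_, hf.const_mul c, (Lp.coeFn_smul c u).trans ?_⟩
    filter_upwards [hu] with x h1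
    simp only [Pi.smul_apply, h1, laplacian_eq_sum (hf.const_mul c).1, laplacian_eq_sum hf.1]
    have e1 : ∀ i, pd i (fun x => c * f x) = fun x => c * pd i f x :=
      fun i => funext fun x => pd_const_mul hf.1 c i x
    simp_rw [e1, pd_const_mul (hf.pd _).1, ← Finset.mul_sum, smul_eq_mul]
    ring

theorem freeRange_dense {l : ℝ} (hl : 0 < l) : (freeRange N l).topologicalClosure = ⊤ := by
  rw [Submodule.topologicalClosure_eq_top_iff, Submodule.eq_bot_iff]
  intro w hw
  rw [Lp.eq_zero_iff_ae_eq_zero]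
  refine eq_zero_of_veryWeak (Lp.memLp w) hl fun f hf => ?_
  have hm : MemLp (fun x => l * f x - Laplacian.laplacian f x) 2 volume :=
    ((hf.const_mul l).sub hf.laplacian).memLp
  have := (Submodule.mem_orthogonal _ _).1 hw (hm.toLp _) ⟨f, hf, hm.coeFn_toLp⟩
  rw [← Lp.toLp_coeFn w (Lp.memLp w), inner_toLp] at this
  exact this

/-- Uniqueness of very weak solutions of `λ w - Δ w + div (b w) = 0` in `L²`. -/
theorem IsFormBounded.exists_eq_zero {b : Sp N → Sp N} (hb : IsFormBounded b) :
    ∃ l : ℝ, 0 < l ∧ ∀ w : Sp N → ℝ, MemLp w 2 volume → (∀ f : Sp N → ℝ, IsTestFunction f →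
      ∫ x, (l * f x - Laplacian.laplacian f x - fderiv ℝ f x (b x)) * w x = 0) →
      w =ᵐ[volume] 0 := by
  obtain ⟨l, hl, hle⟩ := hb.exists_drift_le
  refine ⟨l, hl, fun w hw heq => ?_⟩
  set v := hw.toLp w with hv
  have hmem : v ∈ closure (freeRange N l : Set (Lp ℝ 2 (volume : Measure (Sp N)))) := by
    have : v ∈ (freeRange N l).topologicalClosure := by rw [freeRange_dense hl]; trivial
    exact this
  obtain ⟨u, hu, hlim⟩ := mem_closure_iff_seq_limit.1 hmem
  -- By the equation, the pairing of lf - Δf with w equals that of b·∇f, whose norm is at most half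
  -- that of lf - Δf. As u n → v this gives ‖v‖² ≤ ‖v‖²/2.
  have key : ∀ n, inner ℝ (u n) v ≤ 1 / 2 * ‖u n‖ * ‖v‖ := by
    intro n
    obtain ⟨f, hf, hfu'⟩ := hu n
    have hm : MemLp (fun x => l * f x - Laplacian.laplacian f x) 2 volume :=
      ((hf.const_mul l).sub hf.laplacian).memLp
    have hfu : hm.toLp _ = u n := Lp.ext (hm.coeFn_toLp.trans hfu'.symm)
    obtain ⟨hmb, hbd⟩ := hle f hf
    have h1 : inner ℝ (u n) v = inner ℝ (hmb.toLp _) v := by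
      have h2 : inner ℝ (u n) v - inner ℝ (hmb.toLp _) v = 0 := by
        rw [← hfu, ← inner_sub_left, ← MemLp.toLp_sub, hv, inner_toLp]
        exact heq f hf
      linarith
    rw [h1]
    refine (real_inner_le_norm _ _).trans ?_
    gcongr
    refine abs_le_of_sq_le_sq' ?_ (by positivity) |>.2
    rw [norm_toLp_sq, mul_pow, ← hfu, norm_toLp_sq]
    linarith
  have h1 : Tendsto (fun n => inner ℝ (u n) v) atTop (𝓝 (inner ℝ v v)) :=
    hlim.inner tendsto_const_nhds
  have h2 : Tendsto (fun n => 1 / 2 * ‖u n‖ * ‖v‖) atTop (𝓝 (1 / 2 * ‖v‖ * ‖v‖)) :=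
    (hlim.norm.const_mul _).mul_const _
  have h3 := le_of_tendsto_of_tendsto' h1 h2 key
  rw [real_inner_self_eq_norm_sq] at h3
  have h4 : ‖v‖ = 0 := by nlinarith [norm_nonneg v]
  exact hw.coeFn_toLp.symm.trans (Lp.eq_zero_iff_ae_eq_zero.1 (norm_eq_zero.1 h4))

end Perturbation

/-! ### Extension of the density from a ball to a density which is constant near infinity -/

section Extension

variable {N : ℕ} {m : Sp N → ℝ} {G : Sp N → Sp N}

/-- The measure with density `m`. -/
noncomputable def densityMeasure (m : Sp N → ℝ) : Measure (Sp N) :=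
  volume.withDensity fun x => ENNReal.ofReal (m x)

theorem HypothesisH1.aemeasurable (h : HypothesisH1 m G) : AEMeasurable m :=
  h.hasWeakGradient.locallyIntegrable.aestronglyMeasurable.aemeasurable

theorem HypothesisH1.ae_iff (h : HypothesisH1 m G) {p : Sp N → Prop} :
    (∀ᵐ x ∂densityMeasure m, p x) ↔ ∀ᵐ x, p x := by
  rw [densityMeasure, ae_withDensity_iff_ae_restrict' h.aemeasurable.ennreal_ofReal]
  have h1 : (volume : Measure (Sp N)).restrict {x | ENNReal.ofReal (m x) ≠ 0} = volume := by
    refine Measure.restrict_eq_self_of_ae_mem ?_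
    filter_upwards [h.ae_pos] with x hx
    simpa using hx
  rw [h1]

theorem HypothesisH1.integral_densityMeasure (h : HypothesisH1 m G) (f : Sp N → ℝ) :
    ∫ x, f x ∂densityMeasure m = ∫ x, f x * m x := by
  rw [densityMeasure, integral_withDensity_eq_integral_toReal_smul₀ h.aemeasurable.ennreal_ofReal
    (Eventually.of_forall fun x => ENNReal.ofReal_lt_top)]
  refine integral_congr_ae ?_
  filter_upwards [h.ae_pos] with x hx
  rw [ENNReal.toReal_ofReal hx.le, smul_eq_mul, mul_comm]

theorem HypothesisH1.integrable_densityMeasure_iff (h : HypothesisH1 m G) {f : Sp N → ℝ} :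
    Integrable f (densityMeasure m) ↔ Integrable fun x => f x * m x := by
  rw [densityMeasure, integrable_withDensity_iff_integrable_smul₀' h.aemeasurable.ennreal_ofReal
    (Eventually.of_forall fun x => ENNReal.ofReal_lt_top)]
  refine integrable_congr ?_
  filter_upwards [h.ae_pos] with x hx
  rw [ENNReal.toReal_ofReal hx.le, smul_eq_mul, mul_comm]

/-- The gradient of a function, as a vector. -/
noncomputable def gradVec (f : Sp N → ℝ) (x : Sp N) : Sp N := WithLp.toLp 2 fun i => pd i f x

theorem continuous_gradVec {f : Sp N → ℝ} (hf : ContDiff ℝ ∞ f) : Continuous (gradVec f) :=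
  (PiLp.continuous_toLp 2 _).comp (continuous_pi fun i => (contDiff_pd hf i).continuous)

theorem locallyIntegrable_of_isLpLoc {F : Type*} [NormedAddCommGroup F] {f : Sp N → F}
    (hf : IsLpLoc 2 f) : LocallyIntegrable f := by
  rw [locallyIntegrable_iff]
  intro K hK
  have : IsFiniteMeasure (volume.restrict K) := isFiniteMeasure_restrict.2 hK.measure_lt_top.ne
  exact (hf K hK).integrable (by norm_num)

/-- M = χm + (1 - χ) is a convex combination of m and 1, hence bounded above and below because m is
so on the support of χ. Its drift inherits the local L^r bound: χm ≤ M controls χ∇m/M by ∇m/m, and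
the term (m - 1)∇χ is bounded. -/
theorem HypothesisH1.exists_extension (hN : 1 ≤ N) (h : HypothesisH1 m G) {R : ℝ} (hR : 0 < R) :
    ∃ (M : Sp N → ℝ) (Γ : Sp N → Sp N) (c C : ℝ), 0 < c ∧ HypothesisH1 M Γ ∧
      (∀ᵐ x, c ≤ M x ∧ M x ≤ C) ∧ (∀ x, R + 1 < ‖x‖ → Γ x = 0) ∧
      ∀ x, ‖x‖ < R → M x = m x ∧ Γ x = G x := by
  set χ := cutoff N R hR
  have hχ : IsTestFunction χ := ⟨χ.contDiff, χ.hasCompactSupport⟩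
  set S : Set (Sp N) := Metric.closedBall 0 (R + 1) with hS
  have hSc : IsCompact S := isCompact_closedBall _ _
  have hSm : MeasurableSet S := hSc.isClosed.measurableSet
  have hts : tsupport χ = S := tsupport_cutoff hR
  have hχ0 : ∀ x ∉ S, χ x = 0 := fun x hx => image_eq_zero_of_notMem_tsupport (hts ▸ hx)
  have hχd0 : ∀ x ∉ S, gradVec χ x = 0 := fun x hx => by
    have : fderiv ℝ χ x = 0 :=
      image_eq_zero_of_notMem_tsupport fun h' => hx (hts ▸ tsupport_fderiv_subset ℝ h')
    ext i
    simp [gradVec, pd, this]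
  obtain ⟨C₀, hC₀, hmC⟩ := h.exists_ae_le hN hSc
  obtain ⟨c₀, hc₀, hmc⟩ := h.pos_on_compacts S hSc
  obtain ⟨D, hD⟩ : ∃ D, ∀ x, ‖gradVec χ x‖ ≤ D := by
    refine HasCompactSupport.exists_bound_of_continuous ?_ (continuous_gradVec hχ.1)
    exact HasCompactSupport.intro hSc hχd0
  have hD0 : 0 ≤ D := (norm_nonneg _).trans (hD 0)
  have hm := h.hasWeakGradient.locallyIntegrable
  let M : Sp N → ℝ := fun x => χ x * m x + (1 - χ x)
  let Γ : Sp N → Sp N := fun x => χ x • G x + (m x - 1) • gradVec χ x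
  have hMc : ∀ᵐ x, min c₀ 1 ≤ M x ∧ M x ≤ max C₀ 1 ∧ χ x * m x ≤ M x ∧ (x ∈ S → |m x - 1| ≤ C₀ + 1) := by
    rw [ae_restrict_iff' hSm] at hmC hmc
    filter_upwards [hmC, hmc] with x h1 h2
    have n0 : 0 ≤ χ x := χ.nonneg
    have n1 : χ x ≤ 1 := χ.le_one
    simp only [M]
    by_cases hx : x ∈ S
    · have e1 : min c₀ 1 ≤ m x := (min_le_left _ _).trans (h2 hx)
      have e2 : m x ≤ max C₀ 1 := (h1 hx).trans (le_max_left _ _)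
      have e3 : min c₀ 1 ≤ 1 := min_le_right _ _
      have e4 : 1 ≤ max C₀ 1 := le_max_right _ _
      refine ⟨by nlinarith, by nlinarith, by linarith, fun _ => ?_⟩
      rw [abs_le]
      constructor <;> linarith [h1 hx, h2 hx]
    · rw [hχ0 x hx]
      simp [hx]
  have hmχ : ∀ x, |χ x * m x| ≤ 1 * |m x| := fun x => by
    rw [abs_mul, abs_of_nonneg χ.nonneg]
    exact mul_le_mul_of_nonneg_right χ.le_one (abs_nonneg _)
  have hML : IsLpLoc 2 M := fun K hK => by
    have : IsFiniteMeasure (volume.restrict K) := isFiniteMeasure_restrict.2 hK.measure_lt_top.ne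
    refine MemLp.add ((h.memL2Loc K hK).of_le_mul (c := 1) ?_ (Eventually.of_forall hmχ)) ?_
    · exact χ.continuous.aestronglyMeasurable.mul (h.memL2Loc K hK).1
    · refine MemLp.of_bound (C := 1) (continuous_const.sub χ.continuous).aestronglyMeasurable (Eventually.of_forall fun x => ?_)
      rw [Real.norm_of_nonneg (by linarith [χ.le_one (x := x)])]
      linarith [χ.nonneg (x := x)]
  have hΓme : ∀ K, IsCompact K → AEStronglyMeasurable Γ (volume.restrict K) := fun K hK =>
    (χ.continuous.aestronglyMeasurable.smul (h.memL2Loc_grad K hK).1).add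
      (((h.memL2Loc K hK).1.sub aestronglyMeasurable_const).smul
        (continuous_gradVec hχ.1).aestronglyMeasurable)
  have hΓL : IsLpLoc 2 Γ := fun K hK => by
    have : IsFiniteMeasure (volume.restrict K) := isFiniteMeasure_restrict.2 hK.measure_lt_top.ne
    refine MemLp.of_le_mul (c := 1) (g := fun x => ‖G x‖ + D * |m x - 1|)
      ((h.memL2Loc_grad K hK).norm.add
        (((h.memL2Loc K hK).sub (memLp_const 1)).norm.const_mul D)) (hΓme K hK)
      (Eventually.of_forall fun x => ?_)
    rw [one_mul, Real.norm_of_nonneg (by positivity)]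
    refine (norm_add_le _ _).trans ?_
    rw [norm_smul, norm_smul, Real.norm_of_nonneg (χ.nonneg), mul_comm D]
    exact add_le_add (mul_le_of_le_one_left (norm_nonneg _) χ.le_one)
      (mul_le_mul_of_nonneg_left (hD x) (abs_nonneg _))
  have hpos : ∀ K : Set (Sp N), IsCompact K →
      ∃ c : ℝ, 0 < c ∧ ∀ᵐ x ∂(volume.restrict K), c ≤ M x := fun K _ =>
    ⟨min c₀ 1, by positivity, ae_restrict_of_ae (hMc.mono fun x hx => hx.1)⟩
  have hwg : HasWeakGradient M Γ := by
    refine ⟨locallyIntegrable_of_isLpLoc hML, locallyIntegrable_of_isLpLoc hΓL, fun φ hφ i => ?_⟩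
    have hχφ : IsTestFunction fun x => χ x * φ x := hχ.mul hφ
    have e1 := h.hasWeakGradient.integral_eq _ hχφ i
    have e2 := integral_pd_mul hφ (contDiff_const.sub hχ.1 : ContDiff ℝ ∞ fun x => 1 - χ x) i
    have e3 : ∀ x, pd i (fun x => 1 - χ x) x = -pd i χ x := fun x => by
      rw [pd_sub contDiff_const hχ.1]
      simp [pd]
    have i1 : Integrable fun x => pd i (fun x => χ x * φ x) x * m x :=
      (hχφ.pd i).integrable_mul hm
    have i2 : Integrable fun x => (φ x * pd i χ x) * m x := (hφ.mul (hχ.pd i)).integrable_mul hm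
    have i3 : Integrable fun x => pd i φ x * (1 - χ x) :=
      (hφ.pd i).integrable_mul (contDiff_const.sub hχ.1 : ContDiff ℝ ∞
        fun x => 1 - χ x).continuous.locallyIntegrable
    have i4 : Integrable fun x => (χ x * φ x) * G x i :=
      hχφ.integrable_mul (h.locallyIntegrable_grad_apply i)
    have i5 : Integrable fun x => φ x * pd i χ x := (hφ.mul (hχ.pd i)).integrable
    have l1 : ∫ x, M x * fderiv ℝ φ x (EuclideanSpace.single i 1) =
        ∫ x, (pd i (fun x => χ x * φ x) x * m x - (φ x * pd i χ x) * m x +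
          pd i φ x * (1 - χ x)) := by
      refine integral_congr_ae (Eventually.of_forall fun x => ?_)
      simp only [M]
      rw [pd_mul hχ.1 hφ.1]
      simp only [pd]
      ring
    have r1 : ∫ x, φ x * Γ x i =
        ∫ x, ((χ x * φ x) * G x i + (φ x * pd i χ x) * m x - φ x * pd i χ x) := by
      refine integral_congr_ae (Eventually.of_forall fun x => ?_)
      simp only [Γ, gradVec, PiLp.add_apply, PiLp.smul_apply, smul_eq_mul]
      ring
    have i12 : Integrable fun x => pd i (fun x => χ x * φ x) x * m x - (φ x * pd i χ x) * m x :=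
      i1.sub i2
    have i42 : Integrable fun x => (χ x * φ x) * G x i + (φ x * pd i χ x) * m x := i4.add i2
    rw [l1, r1, integral_add i12 i3, integral_sub i1 i2, integral_sub i42 i5, integral_add i4 i2, e2]
    simp_rw [e3, mul_neg, integral_neg]
    have e1' : ∫ x, pd i (fun x => χ x * φ x) x * m x = -∫ x, χ x * φ x * G x i := by
      rw [← e1]
      exact integral_congr_ae (Eventually.of_forall fun x => mul_comm _ _)
    rw [e1']
    ring
  refine ⟨M, Γ, min c₀ 1, max C₀ 1, by positivity, ⟨hwg, hML, hΓL, ?_, hpos⟩,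
    hMc.mono fun x hx => ⟨hx.1, hx.2.1⟩, fun x hx => ?_, fun x hx => ?_⟩
  · obtain ⟨r, hr, hloc⟩ := h.memLrLoc_logGrad
    refine ⟨r, hr, fun K hK => ?_⟩
    have : IsFiniteMeasure (volume.restrict K) := isFiniteMeasure_restrict.2 hK.measure_lt_top.ne
    refine MemLp.of_le_mul (c := 1)
      (g := fun x => ‖logGrad m G x‖ + (min c₀ 1)⁻¹ * ((C₀ + 1) * D))
      ((hloc K hK).norm.add (memLp_const _)) ?_ (ae_restrict_of_ae ?_)
    · exact (hML K hK).1.aemeasurable.inv.aestronglyMeasurable.smul (hΓme K hK)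
    filter_upwards [hMc, h.ae_pos] with x hx1 hx
    obtain ⟨h1, -, h3, h4⟩ := hx1
    have hc : 0 < min c₀ 1 := by positivity
    have hM0 : 0 < M x := hc.trans_le h1
    rw [one_mul, Real.norm_of_nonneg (by positivity)]
    by_cases hxS : x ∈ S
    · have e1 : logGrad M Γ x = (M x)⁻¹ • (χ x • G x) +
          (M x)⁻¹ • ((m x - 1) • gradVec χ x) := smul_add _ _ _
      rw [e1]
      refine (norm_add_le _ _).trans ?_
      simp only [logGrad, norm_smul, norm_inv, Real.norm_of_nonneg hM0.le,
        Real.norm_of_nonneg hx.le, Real.norm_of_nonneg (χ.nonneg (x := x))]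
      refine add_le_add ?_ ?_
      · rw [← mul_assoc]
        refine mul_le_mul_of_nonneg_right ?_ (norm_nonneg _)
        rw [inv_mul_le_iff₀ hM0, ← div_eq_mul_inv, le_div_iff₀ hx]
        exact h3
      · exact mul_le_mul (inv_anti₀ hc h1) (mul_le_mul (h4 hxS) (hD x) (norm_nonneg _)
          (by positivity)) (by positivity) (by positivity)
    · have : logGrad M Γ x = 0 := by simp [logGrad, Γ, hχ0 x hxS, hχd0 x hxS]
      rw [this, norm_zero]
      positivity
  · have hxS : x ∉ S := fun h' => by
      rw [hS, mem_closedBall_zero_iff] at h'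
      linarith
    simp [Γ, hχ0 x hxS, hχd0 x hxS]
  · have e1 : χ =ᶠ[𝓝 x] fun _ => 1 := by
      filter_upwards [(continuous_norm.isOpen_preimage _ isOpen_Iio).mem_nhds
        (show x ∈ norm ⁻¹' Set.Iio R from hx)] with y hy
      exact cutoff_eq_one hR (le_of_lt hy)
    have e2 : gradVec χ x = 0 := by
      ext i
      simp [gradVec, pd, e1.fderiv_eq]
    simp [M, Γ, e1.eq_of_nhds, e2]

end Extension

/-! ### `H¹` regularity of weak solutions for a density bounded from above and below -/

/-- A bounded functional on the range of `J` is represented by an element of the closure of the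
range. -/
theorem exists_mem_closure_range_inner_eq {T H : Type*} [AddCommGroup T] [Module ℝ T]
    [NormedAddCommGroup H] [InnerProductSpace ℝ H] [CompleteSpace H] (J : T →ₗ[ℝ] H)
    (ℓ : T →ₗ[ℝ] ℝ) {C : ℝ} (h : ∀ f, |ℓ f| ≤ C * ‖J f‖) :
    ∃ z ∈ closure (Set.range J), ∀ f, inner ℝ z (J f) = ℓ f := by
  set K := (LinearMap.range J).topologicalClosure
  have hK : IsClosed (K : Set H) := Submodule.isClosed_topologicalClosure _
  have : CompleteSpace K := hK.completeSpace_coe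
  let e : T →ₗ[ℝ] K := J.codRestrict K fun f => Submodule.le_topologicalClosure _ ⟨f, rfl⟩
  have hd : DenseRange e := by
    intro z
    rw [closure_subtype]
    have hz : (z : H) ∈ closure (Set.range J) := z.2
    convert hz using 2
    ext y
    constructor
    · rintro ⟨_, ⟨f, rfl⟩, rfl⟩
      exact ⟨f, rfl⟩
    · rintro ⟨f, rfl⟩
      exact ⟨e f, ⟨f, rfl⟩, rfl⟩
  have he := ℓ.extendOfNorm_eq hd ⟨C, fun f => h f⟩
  refine ⟨((InnerProductSpace.toDual ℝ K).symm (ℓ.extendOfNorm e) : K), ?_, fun f => ?_⟩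
  · exact ((InnerProductSpace.toDual ℝ K).symm (ℓ.extendOfNorm e)).2
  · rw [← he f]
    have : J f = (e f : H) := rfl
    rw [this, ← Submodule.coe_inner, InnerProductSpace.toDual_symm_apply]

section Regularity

variable {N : ℕ} {M : Sp N → ℝ} {Γ : Sp N → Sp N}

theorem kolmogorovExpr_add_real {f g : Sp N → ℝ} (hf : ContDiff ℝ ∞ f) (hg : ContDiff ℝ ∞ g) (x : Sp N) :
    kolmogorovExpr M Γ (fun x => f x + g x) x = kolmogorovExpr M Γ f x + kolmogorovExpr M Γ g x := by
  rw [kolmogorovExpr_real (hf.add hg), kolmogorovExpr_real hf, kolmogorovExpr_real hg,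
    ← Finset.sum_add_distrib]
  have e1 : ∀ i, pd i (fun x => f x + g x) = fun x => pd i f x + pd i g x :=
    fun i => funext fun x => pd_add hf hg i x
  simp_rw [e1, pd_add (contDiff_pd hf _) (contDiff_pd hg _)]
  exact Finset.sum_congr rfl fun i _ => by ring

theorem kolmogorovExpr_const_mul_real {f : Sp N → ℝ} (hf : ContDiff ℝ ∞ f) (c : ℝ) (x : Sp N) :
    kolmogorovExpr M Γ (fun x => c * f x) x = c * kolmogorovExpr M Γ f x := by
  rw [kolmogorovExpr_real (contDiff_const.mul hf), kolmogorovExpr_real hf, Finset.mul_sum]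
  have e1 : ∀ i, pd i (fun x => c * f x) = fun x => c * pd i f x :=
    fun i => funext fun x => pd_const_mul hf c i x
  simp_rw [e1, pd_const_mul (contDiff_pd hf _)]
  exact Finset.sum_congr rfl fun i _ => by ring

/-- The space of real test functions. -/
def testSpace (N : ℕ) : Submodule ℝ (Sp N → ℝ) where
  carrier := {f | IsTestFunction f}
  zero_mem' := ⟨contDiff_const, HasCompactSupport.zero⟩
  add_mem' hf hg := hf.add hg
  smul_mem' c _ hf := hf.const_mul c

/-- A linear map with values in `L²`, given by a linear expression in a test function. -/
noncomputable def testSpaceToLp {ν : Measure (Sp N)} (a : (Sp N → ℝ) → Sp N → ℝ)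
    (ha : ∀ f, IsTestFunction f → MemLp (a f) 2 ν)
    (hadd : ∀ f g, IsTestFunction f → IsTestFunction g → ∀ x, a (fun x => f x + g x) x = a f x + a g x)
    (hmul : ∀ f, IsTestFunction f → ∀ (c : ℝ) x, a (fun x => c * f x) x = c * a f x) :
    testSpace N →ₗ[ℝ] Lp ℝ 2 ν where
  toFun f := (ha f f.2).toLp _
  map_add' f g := by
    rw [← MemLp.toLp_add]
    exact MemLp.toLp_congr _ _ (Eventually.of_forall fun x => hadd f g f.2 g.2 x)
  map_smul' c f := by
    rw [RingHom.id_apply, ← MemLp.toLp_const_smul]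
    exact MemLp.toLp_congr _ _ (Eventually.of_forall fun x => hmul f f.2 c x)

theorem HypothesisH1.isFiniteMeasureOnCompacts (h : HypothesisH1 M Γ) :
    IsFiniteMeasureOnCompacts (densityMeasure M) := by
  refine ⟨fun K hK => ?_⟩
  rw [densityMeasure, withDensity_apply _ hK.isClosed.measurableSet]
  exact (h.hasWeakGradient.locallyIntegrable.integrableOn_isCompact hK).lintegral_lt_top

theorem memLp_densityMeasure {f : Sp N → ℝ} {p : ℝ≥0∞} (hf : MemLp f p volume) {C : ℝ}
    (hC : ∀ᵐ x, M x ≤ C) : MemLp f p (densityMeasure M) := by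
  refine hf.of_measure_le_smul (c := ENNReal.ofReal C) ENNReal.ofReal_ne_top ?_
  rw [densityMeasure, ← withDensity_const]
  exact withDensity_mono (hC.mono fun x hx => ENNReal.ofReal_le_ofReal hx)

theorem memLp_of_densityMeasure {f : Sp N → ℝ} {p : ℝ≥0∞} (hf : MemLp f p (densityMeasure M)) {c : ℝ} (hc : 0 < c) (hM : ∀ᵐ x, c ≤ M x) :
    MemLp f p volume := by
  refine hf.of_measure_le_smul (c := ENNReal.ofReal c⁻¹) ENNReal.ofReal_ne_top ?_
  rw [densityMeasure, ← withDensity_smul' _ _ ENNReal.ofReal_ne_top]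
  conv_lhs => rw [← withDensity_one (μ := volume)]
  refine withDensity_mono ?_
  filter_upwards [hM] with x hx
  rw [Pi.smul_apply, smul_eq_mul, ← ENNReal.ofReal_mul (by positivity), Pi.one_apply]
  rw [← ENNReal.ofReal_one]
  exact ENNReal.ofReal_le_ofReal (by rw [← div_eq_inv_mul, le_div_iff₀ hc]; linarith)

theorem IsFormBounded.memLp_kolmogorovExpr (hb : IsFormBounded (logGrad M Γ)) {f : Sp N → ℝ}
    (hf : IsTestFunction f) : MemLp (kolmogorovExpr M Γ f) 2 volume := by
  obtain ⟨l, hl, hle⟩ := hb.exists_drift_le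
  exact hf.laplacian.memLp.add (hle f hf).1

/-- The hypothesis `hD` says that f ↦ ∫ (lf - Lf) w dν is bounded in the H¹ norm, so the Riesz
theorem represents it by an element of the H¹ closure of the test functions. The zeroth component of
that element satisfies the same very weak equation as w, and `huniq` identifies the two. So w is an
L² limit of test functions with convergent gradients. -/
theorem HypothesisH1.exists_tendsto_testFunction (h : HypothesisH1 M Γ)
    [IsFiniteMeasureOnCompacts (densityMeasure M)]
    {c C : ℝ} (hc : 0 < c) (hM : ∀ᵐ x, c ≤ M x ∧ M x ≤ C) (hb : IsFormBounded (logGrad M Γ))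
    {l : ℝ} (hl : 0 < l) (huniq : ∀ w : Sp N → ℝ, MemLp w 2 volume →
      (∀ f : Sp N → ℝ, IsTestFunction f → ∫ x, (l * f x - Laplacian.laplacian f x -
        fderiv ℝ f x (logGrad M Γ x)) * w x = 0) → w =ᵐ[volume] 0)
    {w : Sp N → ℝ} (hw : MemLp w 2 (densityMeasure M)) {D : ℝ} (hD0 : 0 ≤ D)
    (hD : ∀ f, IsTestFunction f →
      |∫ x, (l * f x - kolmogorovExpr M Γ f x) * w x ∂densityMeasure M| ^ 2 ≤
        D * (l * (∫ x, f x ^ 2 ∂densityMeasure M) + ∫ x, gradDot f f x ∂densityMeasure M)) :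
    ∃ (f : ℕ → Sp N → ℝ) (hf : ∀ n, IsTestFunction (f n)) (p : Fin N → Lp ℝ 2 (densityMeasure M)),
      Tendsto (fun n => (hf n).memLp.toLp (f n)) atTop (𝓝 (hw.toLp w)) ∧
      ∀ i, Tendsto (fun n => ((hf n).pd i).memLp.toLp (pd i (f n))) atTop (𝓝 (p i)) := by
  set ν := densityMeasure M with hν
  have hKm : ∀ f, IsTestFunction f → MemLp (fun x => l * f x - kolmogorovExpr M Γ f x) 2 ν :=
    fun f hf => (hf.const_mul l).memLp.sub
      (memLp_densityMeasure (hb.memLp_kolmogorovExpr hf) (hM.mono fun x hx => hx.2))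
  let A : testSpace N →ₗ[ℝ] Lp ℝ 2 ν := testSpaceToLp _ hKm
    (fun f g hf hg x => by rw [kolmogorovExpr_add_real hf.1 hg.1]; ring)
    (fun f hf c x => by rw [kolmogorovExpr_const_mul_real hf.1]; ring)
  let J₀ : testSpace N →ₗ[ℝ] Lp ℝ 2 ν := testSpaceToLp (fun f => f) (fun f hf => hf.memLp)
    (fun f g hf hg x => rfl) (fun f hf c x => rfl)
  let J' : Fin N → testSpace N →ₗ[ℝ] Lp ℝ 2 ν := fun i => testSpaceToLp (pd i)
    (fun f hf => (hf.pd i).memLp) (fun f g hf hg x => pd_add hf.1 hg.1 i x)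
    (fun f hf c x => pd_const_mul hf.1 c i x)
  -- The component `none` carries √l f and `some i` carries ∂ᵢf, so that the pairing of J f and J g
  -- is l(f | g) + (∇f | ∇g) = (f | lg - Lg).
  let J : testSpace N →ₗ[ℝ] PiLp 2 (fun _ : Option (Fin N) => Lp ℝ 2 ν) :=
    (WithLp.linearEquiv 2 ℝ (∀ _ : Option (Fin N), Lp ℝ 2 ν)).symm.toLinearMap.comp
      (LinearMap.pi fun o => o.elim (Real.sqrt l • J₀) J')
  have hJ0 : ∀ f, J f none = Real.sqrt l • J₀ f := fun f => rfl
  have hJi : ∀ f i, J f (some i) = J' i f := fun f i => rfl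
  have hsq : Real.sqrt l * Real.sqrt l = l := Real.mul_self_sqrt hl.le
  have hJJ : ∀ f g : testSpace N, inner ℝ (J f) (J g) = inner ℝ (J₀ f) (A g) := by
    intro f g
    have hg : IsTestFunction (g : Sp N → ℝ) := g.2
    have hf : IsTestFunction (f : Sp N → ℝ) := f.2
    rw [PiLp.inner_apply, Fintype.sum_option, hJ0, hJ0, real_inner_smul_left,
      real_inner_smul_right, ← mul_assoc, hsq]
    have e1 : inner ℝ (J₀ f) (J₀ g) = ∫ x, (f : Sp N → ℝ) x * (g : Sp N → ℝ) x ∂ν :=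
      inner_toLp hf.memLp hg.memLp
    have e2 : ∀ i, inner ℝ (J f (some i)) (J g (some i)) =
        ∫ x, pd i (f : Sp N → ℝ) x * pd i (g : Sp N → ℝ) x ∂ν :=
      fun i => inner_toLp (hf.pd i).memLp (hg.pd i).memLp
    have e3 : inner ℝ (J₀ f) (A g) = ∫ x, (f : Sp N → ℝ) x *
        (l * (g : Sp N → ℝ) x - kolmogorovExpr M Γ (g : Sp N → ℝ) x) ∂ν :=
      inner_toLp hf.memLp (hKm g hg)
    obtain ⟨i1, i2, e4⟩ := h.integral_kolmogorovExpr_mul hg.1 hf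
    rw [← h.integrable_densityMeasure_iff] at i1
    rw [← h.integral_densityMeasure, ← h.integral_densityMeasure] at e4
    have e5 : ∫ x, gradDot (g : Sp N → ℝ) f x ∂ν =
        ∑ i, ∫ x, pd i (f : Sp N → ℝ) x * pd i (g : Sp N → ℝ) x ∂ν := by
      rw [← integral_finsetSum _ fun i _ => ((hf.pd i).mul (hg.pd i)).integrable]
      simp_rw [gradDot_comm (g : Sp N → ℝ), gradDot]
    have i3 : Integrable (fun x => l * ((f : Sp N → ℝ) x * (g : Sp N → ℝ) x)) ν :=
      (hf.mul hg).integrable.const_mul l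
    rw [e1, e3, Finset.sum_congr rfl fun i _ => e2 i, ← e5, ← integral_const_mul]
    have e6 : ∫ x, (f : Sp N → ℝ) x * (l * (g : Sp N → ℝ) x -
        kolmogorovExpr M Γ (g : Sp N → ℝ) x) ∂ν = ∫ x, (l * ((f : Sp N → ℝ) x * (g : Sp N → ℝ) x) -
        kolmogorovExpr M Γ (g : Sp N → ℝ) x * (f : Sp N → ℝ) x) ∂ν :=
      integral_congr_ae (Eventually.of_forall fun x => by ring)
    rw [e6, integral_sub i3 i1, e4, sub_neg_eq_add]
  let ℓ : testSpace N →ₗ[ℝ] ℝ := (innerSL ℝ (hw.toLp w)).toLinearMap.comp A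
  have hℓ : ∀ f : testSpace N, ℓ f = inner ℝ (hw.toLp w) (A f) := fun f => rfl
  have hbound : ∀ f, |ℓ f| ≤ Real.sqrt D * ‖J f‖ := by
    intro f
    have hf : IsTestFunction (f : Sp N → ℝ) := f.2
    refine abs_le_of_sq_le_sq ?_ (by positivity)
    have e0 : ℓ f = ∫ x, (l * (f : Sp N → ℝ) x - kolmogorovExpr M Γ (f : Sp N → ℝ) x) * w x ∂ν := by
      rw [hℓ, real_inner_comm]
      exact inner_toLp (hKm f hf) hw
    have e1 : ‖J f‖ ^ 2 = l * (∫ x, (f : Sp N → ℝ) x ^ 2 ∂ν) +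
        ∫ x, gradDot (f : Sp N → ℝ) f x ∂ν := by
      rw [PiLp.norm_sq_eq_of_L2, Fintype.sum_option, hJ0, norm_smul, mul_pow,
        Real.norm_of_nonneg (Real.sqrt_nonneg l), Real.sq_sqrt hl.le]
      congr 1
      · congr 1
        exact norm_toLp_sq hf.memLp
      · simp_rw [gradDot]
        rw [integral_finsetSum _ fun i _ => ((hf.pd i).mul (hf.pd i)).integrable]
        refine Finset.sum_congr rfl fun i _ => ?_
        rw [hJi]
        refine (norm_toLp_sq (hf.pd i).memLp).trans ?_
        simp_rw [pow_two]
    rw [mul_pow, Real.sq_sqrt hD0, e1, e0, ← sq_abs]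
    exact hD f hf
  obtain ⟨z, hz, hzℓ⟩ := exists_mem_closure_range_inner_eq J ℓ hbound
  obtain ⟨u, hu, hlim⟩ := mem_closure_iff_seq_limit.1 hz
  choose f hf using hu
  have hlim' : ∀ o, Tendsto (fun n => J (f n) o) atTop (𝓝 (z o)) := fun o => by
    have := ((PiLp.continuous_apply 2 (fun _ : Option (Fin N) => Lp ℝ 2 ν) o).tendsto z).comp hlim
    refine this.congr fun n => ?_
    simp only [Function.comp_apply, ← hf n]
  set p₀ := (Real.sqrt l)⁻¹ • z none
  have hs0 : Real.sqrt l ≠ 0 := (Real.sqrt_pos.2 hl).ne'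
  have hlim0 : Tendsto (fun n => J₀ (f n)) atTop (𝓝 p₀) := by
    refine ((hlim' none).const_smul (Real.sqrt l)⁻¹).congr fun n => ?_
    rw [hJ0, smul_smul, inv_mul_cancel₀ hs0, one_smul]
  have hzA : ∀ g, inner ℝ z (J g) = inner ℝ p₀ (A g) := fun g => by
    have h1 : Tendsto (fun n => inner ℝ (u n) (J g)) atTop (𝓝 (inner ℝ z (J g))) :=
      hlim.inner tendsto_const_nhds
    have h2 : Tendsto (fun n => inner ℝ (J₀ (f n)) (A g)) atTop (𝓝 (inner ℝ p₀ (A g))) :=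
      hlim0.inner tendsto_const_nhds
    refine tendsto_nhds_unique h1 (h2.congr fun n => ?_)
    rw [← hf n, hJJ]
  -- The difference q is orthogonal to all lg - Lg in L²_ν. Multiplied by the density, it becomes a
  -- very weak solution with respect to Lebesgue measure, in L² because M is bounded.
  have hp₀ : p₀ = hw.toLp w := by
    set q := p₀ - hw.toLp w with hq
    have hqm : MemLp q 2 volume := memLp_of_densityMeasure (Lp.memLp q) hc (hM.mono fun x hx => hx.1)
    have hqM : MemLp (fun x => q x * M x) 2 volume := by
      refine hqm.of_le_mul (c := C) (hqm.1.mul h.aemeasurable.aestronglyMeasurable) ?_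
      filter_upwards [hM] with x hx
      rw [norm_mul, mul_comm, Real.norm_of_nonneg (hc.le.trans hx.1)]
      exact mul_le_mul_of_nonneg_right hx.2 (norm_nonneg _)
    have hq0 : ∀ g : Sp N → ℝ, IsTestFunction g → ∫ x, (l * g x - Laplacian.laplacian g x -
        fderiv ℝ g x (logGrad M Γ x)) * (q x * M x) = 0 := by
      intro g hg
      have h1 : inner ℝ (A ⟨g, hg⟩) q = 0 := by
        rw [real_inner_comm, hq, inner_sub_left, ← hzA, hzℓ, hℓ, sub_self]
      have h2 : inner ℝ (A ⟨g, hg⟩) q = ∫ x, (l * g x - kolmogorovExpr M Γ g x) * q x ∂ν := by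
        conv_lhs => rw [← Lp.toLp_coeFn q (Lp.memLp q)]
        exact inner_toLp (hKm g hg) (Lp.memLp q)
      rw [h2, h.integral_densityMeasure] at h1
      rw [← h1]
      refine integral_congr_ae (Eventually.of_forall fun x => ?_)
      simp only [kolmogorovExpr]
      ring
    have h0 := huniq _ hqM hq0
    have h3 : q =ᵐ[ν] 0 := by
      have h4 : ∀ᵐ x, q x = 0 := by
        filter_upwards [h0, hM] with x hx hx'
        exact (mul_eq_zero.1 hx).resolve_right (hc.trans_le hx'.1).ne'
      exact h.ae_iff.2 h4
    exact sub_eq_zero.1 ((Lp.eq_zero_iff_ae_eq_zero).2 h3)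
  refine ⟨fun n => f n, fun n => (f n).2, fun i => z (some i), ?_, fun i => hlim' (some i)⟩
  rw [← hp₀]
  exact hlim0

end Regularity

/-! ### Square integrable weak solutions of `v - L v = 0` vanish -/

section WeakResolvent

variable {N : ℕ} {m : Sp N → ℝ} {G : Sp N → Sp N}

theorem kolmogorovExpr_eq_zero {𝕜 : Type*} [RCLike 𝕜] {f : Sp N → 𝕜} {x : Sp N}
    (hx : x ∉ tsupport f) : kolmogorovExpr m G f x = 0 := by
  have h1 : f =ᶠ[𝓝 x] fun _ => 0 := notMem_tsupport_iff_eventuallyEq.1 hx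
  have h2 : Laplacian.laplacian f x = 0 := by
    rw [(InnerProductSpace.laplacian_congr_nhds h1).eq_of_nhds, InnerProductSpace.laplacian_const]
    rfl
  rw [kolmogorovExpr, h2, h1.fderiv_eq]
  simp

theorem memLp_of_tsupport {F : Type*} [NormedAddCommGroup F] {ν : Measure (Sp N)} {f : Sp N → F}
    {K : Set (Sp N)} (hK : MeasurableSet K) (h0 : ∀ x ∉ K, f x = 0) {p : ℝ≥0∞}
    (hf : MemLp f p (ν.restrict K)) : MemLp f p ν := by
  have : K.indicator f = f := Set.indicator_eq_self.2 fun x hx => by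
    by_contra hxK; exact hx (h0 x hxK)
  rw [← this]
  exact (memLp_indicator_iff_restrict hK).2 hf

theorem HypothesisH1.memLp_restrict (hN : 1 ≤ N) (h : HypothesisH1 m G) {F : Type*}
    [NormedAddCommGroup F] {f : Sp N → F} {K : Set (Sp N)} (hK : IsCompact K) {p : ℝ≥0∞}
    (hf : MemLp f p (volume.restrict K)) : MemLp f p ((densityMeasure m).restrict K) := by
  have hKm := hK.isClosed.measurableSet
  obtain ⟨C, hC, hmC⟩ := h.exists_ae_le hN hK
  refine hf.of_measure_le_smul (c := ENNReal.ofReal C) ENNReal.ofReal_ne_top ?_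
  rw [densityMeasure, restrict_withDensity hKm, ← withDensity_const]
  exact withDensity_mono (hmC.mono fun x hx => ENNReal.ofReal_le_ofReal hx)

/-- The drift is locally in L² for Lebesgue measure and the density is locally bounded. So every
test function does lie in the domain of L. -/
theorem HypothesisH1.memLp_kolmogorovExpr (hN : 1 ≤ N) (h : HypothesisH1 m G) {𝕜 : Type*}
    [RCLike 𝕜] {f : Sp N → 𝕜} (hf : IsTestFunction f) :
    MemLp (kolmogorovExpr m G f) 2 (densityMeasure m) := by
  set K := tsupport f
  have hK : IsCompact K := hf.2
  have hKm := hK.isClosed.measurableSet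
  have : IsFiniteMeasure (volume.restrict K) := isFiniteMeasure_restrict.2 hK.measure_lt_top.ne
  refine memLp_of_tsupport hKm (fun x hx => kolmogorovExpr_eq_zero hx) (h.memLp_restrict hN hK ?_)
  obtain ⟨q, hq, -, hL⟩ := h.exists_exponent hN
  have hb : MemLp (logGrad m G) 2 (volume.restrict K) := by
    refine (hL K hK).mono_exponent ?_
    rw [← ENNReal.ofReal_ofNat]
    exact ENNReal.ofReal_le_ofReal hq
  have hfd : Continuous (fderiv ℝ f) := hf.1.continuous_fderiv (by simp)
  obtain ⟨D, hD⟩ := (hf.2.fderiv (𝕜 := ℝ)).exists_bound_of_continuous hfd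
  have hΔ : Continuous (Laplacian.laplacian f) := by
    rw [InnerProductSpace.laplacian_eq_iteratedFDeriv_stdOrthonormalBasis]
    have h2 : Continuous (iteratedFDeriv ℝ 2 f) :=
      hf.1.continuous_iteratedFDeriv (m := 2) (WithTop.coe_le_coe.2 le_top)
    exact continuous_finsetSum _ fun i _ => by fun_prop
  have hΔ0 : ∀ x ∉ K, Laplacian.laplacian f x = 0 := fun x hx => by
    have h1 : f =ᶠ[𝓝 x] fun _ => 0 := notMem_tsupport_iff_eventuallyEq.1 hx
    rw [(InnerProductSpace.laplacian_congr_nhds h1).eq_of_nhds, InnerProductSpace.laplacian_const]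
    rfl
  refine MemLp.add (hΔ.memLp_of_hasCompactSupport (HasCompactSupport.intro hK hΔ0))
    (hb.of_le_mul (c := D) ?_ (Eventually.of_forall fun x => ?_))
  · exact (isBoundedBilinearMap_apply (𝕜 := ℝ) (E := Sp N) (F := 𝕜)).continuous.comp_aestronglyMeasurable
      (hfd.aestronglyMeasurable.prodMk hb.1)
  · exact ((fderiv ℝ f x).le_opNorm _).trans (mul_le_mul_of_nonneg_right (hD x) (norm_nonneg _))

theorem kolmogorovExpr_mul {f g : Sp N → ℝ} (hf : ContDiff ℝ ∞ f) (hg : ContDiff ℝ ∞ g) (x : Sp N) :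
    kolmogorovExpr m G (fun x => f x * g x) x = f x * kolmogorovExpr m G g x +
      2 * gradDot f g x + g x * kolmogorovExpr m G f x := by
  have := fderiv_fun_mul ((hf.differentiable (by simp)) x) ((hg.differentiable (by simp)) x)
  rw [kolmogorovExpr, kolmogorovExpr, kolmogorovExpr, laplacian_mul hf hg, this]
  simp only [add_apply, smul_apply, smul_eq_mul]
  ring

theorem sq_gradDot_le (f g : Sp N → ℝ) (x : Sp N) :
    gradDot f g x ^ 2 ≤ gradDot f f x * gradDot g g x := by
  have := Finset.sum_mul_sq_le_sq_mul_sq Finset.univ (fun i => pd i f x) (fun i => pd i g x)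
  simpa only [gradDot, pow_two] using this

theorem gradDot_self_nonneg (f : Sp N → ℝ) (x : Sp N) : 0 ≤ gradDot f f x :=
  Finset.sum_nonneg fun _ _ => mul_self_nonneg _

theorem tendsto_integral_mul {ν : Measure (Sp N)} {u : ℕ → Sp N → ℝ} (hu : ∀ n, MemLp (u n) 2 ν)
    {U : Lp ℝ 2 ν} (hlim : Tendsto (fun n => (hu n).toLp (u n)) atTop (𝓝 U)) {k : Sp N → ℝ}
    (hk : MemLp k 2 ν) : Tendsto (fun n => ∫ x, k x * u n x ∂ν) atTop (𝓝 (∫ x, k x * U x ∂ν)) := by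
  have h1 : Tendsto (fun n => inner ℝ (hk.toLp k) ((hu n).toLp (u n))) atTop
      (𝓝 (inner ℝ (hk.toLp k) U)) := tendsto_const_nhds.inner hlim
  have h2 : inner ℝ (hk.toLp k) U = ∫ x, k x * U x ∂ν := by
    conv_lhs => rw [← Lp.toLp_coeFn U (Lp.memLp U)]
    exact inner_toLp hk (Lp.memLp U)
  rw [← h2]
  exact h1.congr fun n => inner_toLp hk (hu n)

theorem IsTestFunction.mul_memLp {ν : Measure (Sp N)} {f u : Sp N → ℝ} (hf : IsTestFunction f)
    (hu : MemLp u 2 ν) : MemLp (fun x => f x * u x) 2 ν := by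
  obtain ⟨C, hC⟩ := hf.exists_norm_le
  refine hu.of_le_mul (c := C) (hf.continuous.aestronglyMeasurable.mul hu.1)
    (Eventually.of_forall fun x => ?_)
  rw [norm_mul]
  exact mul_le_mul_of_nonneg_right (hC x) (norm_nonneg _)

theorem integral_mul_sq_le {ν : Measure (Sp N)} {f g : Sp N → ℝ} (hf : MemLp f 2 ν)
    (hg : MemLp g 2 ν) :
    |∫ x, f x * g x ∂ν| ^ 2 ≤ (∫ x, f x ^ 2 ∂ν) * ∫ x, g x ^ 2 ∂ν := by
  rw [← inner_toLp hf hg, ← norm_toLp_sq hf, ← norm_toLp_sq hg, ← mul_pow]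
  exact pow_le_pow_left₀ (abs_nonneg _) (abs_real_inner_le_norm _ _) 2

/-- The local energy estimate behind uniqueness, for very weak solutions. -/
theorem HypothesisH1.integral_sq_mul_sq_le (hN : 1 ≤ N) (h : HypothesisH1 m G) {v : Sp N → ℝ}
    (hv : MemLp v 2 (densityMeasure m)) (heq : ∀ f : Sp N → ℝ, IsTestFunction f →
      ∫ x, (f x - kolmogorovExpr m G f x) * v x ∂densityMeasure m = 0)
    {φ : Sp N → ℝ} (hφ : IsTestFunction φ) :
    ∫ x, φ x ^ 2 * v x ^ 2 ∂densityMeasure m ≤ ∫ x, gradDot φ φ x * v x ^ 2 ∂densityMeasure m := by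
  obtain ⟨ρ, hρ, hφρ⟩ := (show IsCompact (tsupport φ) from hφ.2).isBounded.subset_closedBall_lt 0 0
  have hρ1 : 0 < ρ + 1 := by linarith
  set ψ := cutoff N (ρ + 1) hρ1
  have hψ : IsTestFunction ψ := ⟨ψ.contDiff, ψ.hasCompactSupport⟩
  have hψ1 : ∀ x, ‖x‖ ≤ ρ → ψ x = 1 := fun x hx => cutoff_eq_one hρ1 (by linarith)
  have hψs : tsupport ψ = Metric.closedBall 0 (ρ + 1 + 1) := tsupport_cutoff hρ1
  -- Nested radii: φ lives in the ball of radius ρ, ψ is 1 on radius ρ + 1 and vanishes beyond ρ +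
  -- 2, and M agrees with m inside ρ + 3. Integrals containing φ or ψ are then the same for both
  -- measures.
  obtain ⟨M, Γ, c, C, hc, hH, hM, hΓ0, hMm⟩ := h.exists_extension hN (R := ρ + 3) (by linarith)
  have hfm := hH.isFiniteMeasureOnCompacts
  have hfm' := h.isFiniteMeasureOnCompacts
  set μ := densityMeasure m
  set ν := densityMeasure M
  have hC0 : 0 ≤ C := by
    obtain ⟨x, hx⟩ := hM.exists
    linarith [hx.1, hx.2]
  -- comparison of the two measures
  have hswap : ∀ k : Sp N → ℝ, (∀ x, ρ + 3 ≤ ‖x‖ → k x = 0) → ∫ x, k x ∂ν = ∫ x, k x ∂μ := by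
    intro k hk
    rw [h.integral_densityMeasure, hH.integral_densityMeasure]
    refine integral_congr_ae (Eventually.of_forall fun x => ?_)
    rcases lt_or_ge ‖x‖ (ρ + 3) with hx | hx
    · simp only [(hMm x hx).1]
    · simp only [hk x hx, zero_mul]
  have hswapi : ∀ k : Sp N → ℝ, (∀ x, ρ + 3 ≤ ‖x‖ → k x = 0) → Integrable k ν → Integrable k μ := by
    intro k hk hi
    rw [hH.integrable_densityMeasure_iff] at hi
    rw [h.integrable_densityMeasure_iff]
    refine hi.congr (Eventually.of_forall fun x => ?_)
    rcases lt_or_ge ‖x‖ (ρ + 3) with hx | hx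
    · simp only [(hMm x hx).1]
    · simp only [hk x hx, zero_mul]
  have hexpr : ∀ (f : Sp N → ℝ) x, ‖x‖ < ρ + 3 → kolmogorovExpr M Γ f x = kolmogorovExpr m G f x :=
    fun f x hx => by simp only [kolmogorovExpr, logGrad, (hMm x hx).1, (hMm x hx).2]
  have hψ0 : ∀ x, ρ + 3 ≤ ‖x‖ → x ∉ tsupport ψ := fun x hx hx' => by
    rw [hψs, mem_closedBall_zero_iff] at hx'
    linarith
  -- the drift
  set S : Set (Sp N) := Metric.closedBall 0 (ρ + 3 + 1)
  have hbS : S.indicator (logGrad M Γ) = logGrad M Γ := Set.indicator_eq_self.2 fun x hx => by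
    by_contra hxS
    rw [mem_closedBall_zero_iff, not_le] at hxS
    exact hx (by simp [logGrad, hΓ0 x hxS])
  have hb : IsFormBounded (logGrad M Γ) := hbS ▸ hH.isFormBounded hN (isCompact_closedBall _ _)
  obtain ⟨l, hl, huniq⟩ := hb.exists_eq_zero
  -- the localized solution
  have hvm : AEStronglyMeasurable v volume := hv.1.mono_ac
    (Measure.ae_le_iff_absolutelyContinuous.1 fun s hs => (h.ae_iff (p := (· ∈ s))).1 hs)
  have hac : ν ≪ volume := withDensity_absolutelyContinuous _ _
  have hwm : AEStronglyMeasurable (fun x => ψ x * v x) ν :=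
    ψ.continuous.aestronglyMeasurable.mul (hvm.mono_ac hac)
  have hv2 := hv.integrable_sq
  have hw : MemLp (fun x => ψ x * v x) 2 ν := by
    rw [memLp_two_iff_integrable_sq hwm, hH.integrable_densityMeasure_iff]
    have h1 := h.integrable_densityMeasure_iff.1 (hψ.mul_memLp hv).integrable_sq
    refine h1.congr (Eventually.of_forall fun x => ?_)
    rcases lt_or_ge ‖x‖ (ρ + 3) with hx | hx
    · simp only [(hMm x hx).1]
    · simp [image_eq_zero_of_notMem_tsupport (hψ0 x hx)]
  -- the functional is bounded in `H¹`
  obtain ⟨D, hD0, hD⟩ : ∃ D : ℝ, 0 ≤ D ∧ ∀ f, IsTestFunction f →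
      |∫ x, (l * f x - kolmogorovExpr M Γ f x) * (ψ x * v x) ∂ν| ^ 2 ≤
        D * (l * (∫ x, f x ^ 2 ∂ν) + ∫ x, gradDot f f x ∂ν) := by
    obtain ⟨D₁, hD₁⟩ := ((hψ.const_mul (l - 1)).add hψ.laplacian).exists_norm_le
    obtain ⟨D₂, hD₂⟩ := (hψ.gradDot hψ).exists_norm_le
    have hD₂0 : 0 ≤ D₂ := (norm_nonneg _).trans (hD₂ 0)
    obtain ⟨K, hK0, hK⟩ := hb.exists_le 1 one_pos
    set V := ∫ x, v x ^ 2 ∂μ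
    have hV : 0 ≤ V := integral_nonneg fun x => sq_nonneg _
    refine ⟨V * (C * c⁻¹ * ((3 * D₁ ^ 2 + 3 * D₂ * K) / l + 15 * D₂)), by positivity,
      fun f hf => ?_⟩
    -- By the product rule, ψ(lf - Lf) = (ψf - L(ψf)) + q. The first part integrates to zero against
    -- v by the equation, and q involves only first derivatives of f.
    let q : Sp N → ℝ := fun x => f x * ((l - 1) * ψ x) + 2 * gradDot ψ f x +
      f x * kolmogorovExpr M Γ ψ x
    have hψ00 : ∀ x, ρ + 3 ≤ ‖x‖ → ψ x = 0 := fun x hx => image_eq_zero_of_notMem_tsupport (hψ0 x hx)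
    have hq0 : ∀ x, ρ + 3 ≤ ‖x‖ → q x = 0 := fun x hx => by
      have e1 : fderiv ℝ ψ x = 0 :=
        image_eq_zero_of_notMem_tsupport fun h' => hψ0 x hx (tsupport_fderiv_subset ℝ h')
      simp [q, hψ00 x hx, kolmogorovExpr_eq_zero (hψ0 x hx), gradDot, pd, e1]
    have hqle : ∀ x, q x ^ 2 ≤ 3 * D₁ ^ 2 * f x ^ 2 + 12 * D₂ * gradDot f f x +
        3 * D₂ * (‖logGrad M Γ x‖ ^ 2 * f x ^ 2) := fun x => by
      set d := fderiv ℝ ψ x (logGrad M Γ x) with hd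
      have e1 : q x = f x * ((l - 1) * ψ x + Laplacian.laplacian (ψ : Sp N → ℝ) x) + 2 * gradDot ψ f x +
          f x * d := by
        simp only [q, kolmogorovExpr, ← hd]
        ring
      have e2 : ((l - 1) * ψ x + Laplacian.laplacian (ψ : Sp N → ℝ) x) ^ 2 ≤ D₁ ^ 2 := by
        rw [← sq_abs]
        exact pow_le_pow_left₀ (abs_nonneg _) (hD₁ x) 2
      have e5 : gradDot ψ ψ x ≤ D₂ := (le_abs_self _).trans (hD₂ x)
      have e3 : gradDot ψ f x ^ 2 ≤ D₂ * gradDot f f x :=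
        (sq_gradDot_le ψ f x).trans (mul_le_mul_of_nonneg_right e5 (gradDot_self_nonneg f x))
      have e4 : d ^ 2 ≤ D₂ * ‖logGrad M Γ x‖ ^ 2 := by
        have : |d| ≤ ‖fderiv ℝ ψ x‖ * ‖logGrad M Γ x‖ := (fderiv ℝ ψ x).le_opNorm _
        calc d ^ 2 = |d| ^ 2 := (sq_abs d).symm
          _ ≤ (‖fderiv ℝ ψ x‖ * ‖logGrad M Γ x‖) ^ 2 := by gcongr
          _ = gradDot ψ ψ x * ‖logGrad M Γ x‖ ^ 2 := by rw [mul_pow, norm_fderiv_sq]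
          _ ≤ _ := by gcongr
      set s₁ := (l - 1) * ψ x + Laplacian.laplacian (ψ : Sp N → ℝ) x
      have e6 : (f x * s₁ + 2 * gradDot ψ f x + f x * d) ^ 2 ≤
          3 * ((f x * s₁) ^ 2 + (2 * gradDot ψ f x) ^ 2 + (f x * d) ^ 2) := by
        nlinarith [sq_nonneg (f x * s₁ - 2 * gradDot ψ f x), sq_nonneg (f x * s₁ - f x * d),
          sq_nonneg (2 * gradDot ψ f x - f x * d)]
      have e7 : (f x * s₁) ^ 2 ≤ D₁ ^ 2 * f x ^ 2 := by
        rw [mul_pow, mul_comm]; gcongr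
      have e8 : (f x * d) ^ 2 ≤ D₂ * (‖logGrad M Γ x‖ ^ 2 * f x ^ 2) := by
        rw [mul_pow, mul_comm, ← mul_assoc]; gcongr
      rw [e1]
      nlinarith
    have i1 := hf.sq.integrable (ν := volume)
    have i2 := (hf.gradDot hf).integrable (ν := volume)
    obtain ⟨i3, hKf⟩ := hK f hf
    have i4 : Integrable fun x => 3 * D₁ ^ 2 * f x ^ 2 + 12 * D₂ * gradDot f f x :=
      (i1.const_mul _).add (i2.const_mul _)
    have i5 : Integrable fun x => 3 * D₁ ^ 2 * f x ^ 2 + 12 * D₂ * gradDot f f x +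
        3 * D₂ * (‖logGrad M Γ x‖ ^ 2 * f x ^ 2) := i4.add (i3.const_mul _)
    have hqm : AEStronglyMeasurable q volume :=
      ((hf.continuous.aestronglyMeasurable.mul (hψ.const_mul (l - 1)).continuous.aestronglyMeasurable).add
        ((hψ.gradDot hf).continuous.aestronglyMeasurable.const_mul 2)).add
        (hf.continuous.aestronglyMeasurable.mul (hb.memLp_kolmogorovExpr hψ).1)
    have hqi : Integrable fun x => q x ^ 2 := i5.mono' (hqm.pow 2) (Eventually.of_forall fun x => by
      rw [Real.norm_of_nonneg (sq_nonneg _)]; exact hqle x)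
    have hqν : MemLp q 2 ν := memLp_densityMeasure ((memLp_two_iff_integrable_sq hqm).2 hqi)
      (hM.mono fun x hx => hx.2)
    have hqμ : MemLp q 2 μ := by
      have := hswapi (fun x => q x ^ 2) (fun x hx => by simp [hq0 x hx]) hqν.integrable_sq
      exact (memLp_two_iff_integrable_sq (hqm.mono_ac (withDensity_absolutelyContinuous _ _))).2 this
    have hψf : IsTestFunction fun x => ψ x * f x := hψ.mul hf
    have hψf0 : ∀ x, ρ + 3 ≤ ‖x‖ → x ∉ tsupport fun x => ψ x * f x := fun x hx hx' =>
      hψ0 x hx (tsupport_mul_subset_left hx')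
    have e1 : ∫ x, (l * f x - kolmogorovExpr M Γ f x) * (ψ x * v x) ∂ν = ∫ x, q x * v x ∂μ := by
      rw [hswap _ fun x hx => by rw [hψ00 x hx]; ring]
      have j1 : Integrable (fun x => (ψ x * f x - kolmogorovExpr m G (fun x => ψ x * f x) x) * v x) μ :=
        MemLp.integrable_mul (hψf.memLp.sub (h.memLp_kolmogorovExpr hN hψf)) hv
      have j2 : Integrable (fun x => q x * v x) μ := MemLp.integrable_mul hqμ hv
      have j3 := integral_add j1 j2
      rw [heq _ hψf, zero_add] at j3
      rw [← j3]
      refine integral_congr_ae (Eventually.of_forall fun x => ?_)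
      simp only
      rcases lt_or_ge ‖x‖ (ρ + 3) with hx | hx
      · rw [← hexpr _ x hx, kolmogorovExpr_mul hψ.1 hf.1]
        simp only [q]
        ring
      · rw [kolmogorovExpr_eq_zero (hψf0 x hx), hψ00 x hx, hq0 x hx]
        ring
    have e2 : ∫ x, q x ^ 2 ∂μ ≤ C * ∫ x, q x ^ 2 := by
      rw [← hswap (fun x => q x ^ 2) fun x hx => by simp [hq0 x hx], hH.integral_densityMeasure,
        ← integral_const_mul]
      refine integral_mono_ae (hH.integrable_densityMeasure_iff.1 hqν.integrable_sq)
        (hqi.const_mul C) ?_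
      filter_upwards [hM] with x hx
      rw [mul_comm]
      exact mul_le_mul_of_nonneg_right hx.2 (sq_nonneg _)
    -- The coefficient 15 is 12, from the term 2∇ψ·∇f, plus 3, from the form bound taken with ε = 1.
    have e3 : ∫ x, q x ^ 2 ≤ (3 * D₁ ^ 2 + 3 * D₂ * K) * (∫ x, f x ^ 2) +
        15 * D₂ * ∫ x, gradDot f f x := by
      refine (integral_mono hqi i5 hqle).trans ?_
      rw [integral_add i4 (i3.const_mul _), integral_add (i1.const_mul _) (i2.const_mul _),
        integral_const_mul, integral_const_mul, integral_const_mul]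
      nlinarith
    have hlow : ∀ k : Sp N → ℝ, IsTestFunction k → (∀ x, 0 ≤ k x) →
        ∫ x, k x ≤ c⁻¹ * ∫ x, k x ∂ν := by
      intro k hk hk0
      rw [hH.integral_densityMeasure, ← integral_const_mul]
      refine integral_mono_ae hk.integrable
        ((hH.integrable_densityMeasure_iff.1 hk.integrable).const_mul _) ?_
      filter_upwards [hM] with x hx
      rw [← mul_assoc, mul_comm c⁻¹, mul_assoc]
      refine le_mul_of_one_le_right (hk0 x) ?_
      rw [← div_eq_inv_mul, le_div_iff₀ hc, one_mul]
      exact hx.1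
    have e4 := hlow _ hf.sq fun x => sq_nonneg _
    have e5 := hlow _ (hf.gradDot hf) (gradDot_self_nonneg f)
    set X := ∫ x, f x ^ 2 ∂ν
    set Y := ∫ x, gradDot f f x ∂ν
    have hX : 0 ≤ X := integral_nonneg fun x => sq_nonneg _
    have hY : 0 ≤ Y := integral_nonneg fun x => gradDot_self_nonneg f x
    rw [e1]
    refine (integral_mul_sq_le hqμ hv).trans ?_
    rw [mul_comm, mul_assoc]
    refine mul_le_mul_of_nonneg_left ?_ hV
    calc ∫ x, q x ^ 2 ∂μ ≤ C * ((3 * D₁ ^ 2 + 3 * D₂ * K) * (c⁻¹ * X) + 15 * D₂ * (c⁻¹ * Y)) := by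
          refine e2.trans (mul_le_mul_of_nonneg_left (e3.trans ?_) hC0)
          gcongr
      _ = C * c⁻¹ * ((3 * D₁ ^ 2 + 3 * D₂ * K) * X + 15 * D₂ * Y) := by ring
      _ ≤ C * c⁻¹ * ((3 * D₁ ^ 2 + 3 * D₂ * K) * X + 15 * D₂ * Y +
            ((3 * D₁ ^ 2 + 3 * D₂ * K) / l * Y + 15 * D₂ * (l * X))) := by
          have : 0 ≤ (3 * D₁ ^ 2 + 3 * D₂ * K) / l * Y + 15 * D₂ * (l * X) := by positivity
          exact mul_le_mul_of_nonneg_left (by linarith) (by positivity)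
      _ = _ := by field_simp; ring
  obtain ⟨f, hf, p, hlim0, hlim⟩ := hH.exists_tendsto_testFunction hc hM hb hl huniq hw hD0 hD
  -- The equation in divergence form: on the ball of radius ρ the cutoff ψ is 1, and one derivative
  -- has been moved from g to the limit, whose gradient is p.
  have weak : ∀ g : Sp N → ℝ, IsTestFunction g → (tsupport g ⊆ Metric.closedBall 0 ρ) →
      ∫ x, g x * (ψ x * v x) ∂ν + ∑ i, ∫ x, pd i g x * p i x ∂ν = 0 := by
    intro g hg hgs
    have hgm := hg.memLp (ν := ν) (p := 2)
    have hLm : MemLp (kolmogorovExpr M Γ g) 2 ν :=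
      memLp_densityMeasure (hb.memLp_kolmogorovExpr hg) (hM.mono fun x hx => hx.2)
    have hkm : MemLp (fun x => g x - kolmogorovExpr M Γ g x) 2 ν := hgm.sub hLm
    have l1 := tendsto_integral_mul _ hlim0 hkm
    have e1 : ∫ x, (g x - kolmogorovExpr M Γ g x) * hw.toLp _ x ∂ν = 0 := by
      have e2 : ∫ x, (g x - kolmogorovExpr M Γ g x) * hw.toLp _ x ∂ν =
          ∫ x, (g x - kolmogorovExpr M Γ g x) * (ψ x * v x) ∂ν := by
        refine integral_congr_ae ?_
        filter_upwards [hw.coeFn_toLp] with x hx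
        rw [hx]
      rw [e2, hswap _ fun x hx => by rw [image_eq_zero_of_notMem_tsupport (hψ0 x hx)]; ring,
        ← heq g hg]
      refine integral_congr_ae (Eventually.of_forall fun x => ?_)
      simp only
      by_cases hx : x ∈ tsupport g
      · have hxρ : ‖x‖ ≤ ρ := mem_closedBall_zero_iff.1 (hgs hx)
        rw [hψ1 x hxρ, hexpr g x (by linarith), one_mul]
      · rw [image_eq_zero_of_notMem_tsupport hx, kolmogorovExpr_eq_zero hx,
          kolmogorovExpr_eq_zero hx]
        ring
    rw [e1] at l1
    have l2 := (tendsto_integral_mul _ hlim0 hgm).add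
      (tendsto_finsetSum Finset.univ fun i _ => tendsto_integral_mul _ (hlim i)
        ((hg.pd i).memLp (ν := ν) (p := 2)))
    have e3 : ∫ x, g x * hw.toLp _ x ∂ν = ∫ x, g x * (ψ x * v x) ∂ν := by
      refine integral_congr_ae ?_
      filter_upwards [hw.coeFn_toLp] with x hx
      rw [hx]
    rw [e3] at l2
    refine tendsto_nhds_unique l2 (l1.congr fun n => ?_)
    obtain ⟨j1, j2, e4⟩ := hH.integral_kolmogorovExpr_mul hg.1 (hf n)
    rw [← hH.integrable_densityMeasure_iff] at j1
    rw [← hH.integral_densityMeasure, ← hH.integral_densityMeasure] at e4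
    simp_rw [sub_mul]
    rw [integral_sub (hg.mul (hf n)).integrable j1, e4, sub_neg_eq_add]
    congr 1
    simp_rw [gradDot]
    exact integral_finsetSum _ fun i _ => ((hg.pd i).mul ((hf n).pd i)).integrable
  -- The weak form tested with φ² f n, where f n → ψv with gradients tending to p; in the limit this
  -- is the test with φ²v.
  have weak2 : ∀ n, ∫ x, (φ x ^ 2 * (ψ x * v x)) * f n x ∂ν +
      ∑ i, (∫ x, (φ x ^ 2 * p i x) * pd i (f n) x ∂ν +
        ∫ x, ((2 * φ x * pd i φ x) * p i x) * f n x ∂ν) = 0 := by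
    intro n
    have hg : IsTestFunction fun x => φ x * φ x * f n x := (hφ.mul hφ).mul (hf n)
    have hgs : tsupport (fun x => φ x * φ x * f n x) ⊆ Metric.closedBall 0 ρ := by
      refine (closure_mono fun x hx => ?_).trans hφρ
      simp only [Function.mem_support, ne_eq, mul_eq_zero, not_or] at hx ⊢
      exact hx.1.1
    have e1 := weak _ hg hgs
    rw [← e1]
    congr 1
    · exact integral_congr_ae (Eventually.of_forall fun x => by ring)
    · refine Finset.sum_congr rfl fun i _ => ?_
      rw [← integral_add]
      · refine integral_congr_ae (Eventually.of_forall fun x => ?_)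
        simp only
        rw [pd_mul (hφ.mul hφ).1 (hf n).1, pd_mul hφ.1 hφ.1]
        ring
      · exact MemLp.integrable_mul (hφ.sq.mul_memLp (Lp.memLp (p i)))
          (((hf n).pd i).memLp (p := 2))
      · exact MemLp.integrable_mul (((hφ.const_mul 2).mul (hφ.pd i)).mul_memLp (Lp.memLp (p i)))
          ((hf n).memLp (p := 2))
  have lim : ∫ x, (φ x ^ 2 * (ψ x * v x)) * (ψ x * v x) ∂ν +
      ∑ i, (∫ x, (φ x ^ 2 * p i x) * p i x ∂ν +
        ∫ x, ((2 * φ x * pd i φ x) * p i x) * (ψ x * v x) ∂ν) = 0 := by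
    have k1 : MemLp (fun x => φ x ^ 2 * (ψ x * v x)) 2 ν := hφ.sq.mul_memLp hw
    have k2 : ∀ i, MemLp (fun x => φ x ^ 2 * p i x) 2 ν := fun i =>
      hφ.sq.mul_memLp (Lp.memLp (p i))
    have k3 : ∀ i, MemLp (fun x => (2 * φ x * pd i φ x) * p i x) 2 ν := fun i =>
      ((hφ.const_mul 2).mul (hφ.pd i)).mul_memLp (Lp.memLp (p i))
    have l1 := (tendsto_integral_mul _ hlim0 k1).add (tendsto_finsetSum Finset.univ fun i _ =>
      (tendsto_integral_mul _ (hlim i) (k2 i)).add (tendsto_integral_mul _ hlim0 (k3 i)))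
    have e3 : ∀ k : Sp N → ℝ, ∫ x, k x * hw.toLp _ x ∂ν = ∫ x, k x * (ψ x * v x) ∂ν := fun k => by
      refine integral_congr_ae ?_
      filter_upwards [hw.coeFn_toLp] with x hx
      rw [hx]
    have l2 := tendsto_nhds_unique l1 (tendsto_const_nhds.congr fun n => (weak2 n).symm)
    simp_rw [← e3]
    exact l2
  have hφ0 : ∀ x, ρ + 3 ≤ ‖x‖ → x ∉ tsupport φ := fun x hx hx' => by
    have := mem_closedBall_zero_iff.1 (hφρ hx')
    linarith
  have a1 : ∫ x, φ x ^ 2 * v x ^ 2 ∂μ = ∫ x, (φ x ^ 2 * (ψ x * v x)) * (ψ x * v x) ∂ν := by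
    rw [hswap _ fun x hx => by rw [image_eq_zero_of_notMem_tsupport (hφ0 x hx)]; ring]
    refine integral_congr_ae (Eventually.of_forall fun x => ?_)
    simp only
    by_cases hx : x ∈ tsupport φ
    · rw [hψ1 x (mem_closedBall_zero_iff.1 (hφρ hx))]; ring
    · rw [image_eq_zero_of_notMem_tsupport hx]; ring
  have hpd0 : ∀ x ∉ tsupport φ, ∀ i, pd i φ x = 0 := fun x hx i => by
    have e1 : fderiv ℝ φ x = 0 :=
      image_eq_zero_of_notMem_tsupport fun h' => hx (tsupport_fderiv_subset ℝ h')
    simp [pd, e1]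
  have j3 : ∀ i, Integrable (fun x => (pd i φ x * (ψ x * v x)) ^ 2) ν := fun i =>
    ((hφ.pd i).mul_memLp hw).integrable_sq
  have a2 : ∫ x, gradDot φ φ x * v x ^ 2 ∂μ = ∑ i, ∫ x, (pd i φ x * (ψ x * v x)) ^ 2 ∂ν := by
    rw [← integral_finsetSum _ fun i _ => j3 i, hswap _ fun x hx =>
      Finset.sum_eq_zero fun i _ => by rw [hpd0 x (hφ0 x hx)]; ring]
    refine integral_congr_ae (Eventually.of_forall fun x => ?_)
    simp only [gradDot, Finset.sum_mul]
    refine Finset.sum_congr rfl fun i _ => ?_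
    by_cases hx : x ∈ tsupport φ
    · rw [hψ1 x (mem_closedBall_zero_iff.1 (hφρ hx))]; ring
    · rw [hpd0 x hx]; ring
  -- Completing the square: the integrand is (φ p_i + ∂ᵢφ ψv)².
  have a3 : ∀ i, 0 ≤ (∫ x, (φ x ^ 2 * p i x) * p i x ∂ν +
      ∫ x, ((2 * φ x * pd i φ x) * p i x) * (ψ x * v x) ∂ν) +
      ∫ x, (pd i φ x * (ψ x * v x)) ^ 2 ∂ν := fun i => by
    have j1 : Integrable (fun x => (φ x ^ 2 * p i x) * p i x) ν :=
      MemLp.integrable_mul (hφ.sq.mul_memLp (Lp.memLp (p i))) (Lp.memLp (p i))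
    have j2 : Integrable (fun x => ((2 * φ x * pd i φ x) * p i x) * (ψ x * v x)) ν :=
      MemLp.integrable_mul (((hφ.const_mul 2).mul (hφ.pd i)).mul_memLp (Lp.memLp (p i))) hw
    have j12 : Integrable (fun x => (φ x ^ 2 * p i x) * p i x +
      ((2 * φ x * pd i φ x) * p i x) * (ψ x * v x)) ν := j1.add j2
    rw [← integral_add j1 j2, ← integral_add j12 (j3 i)]
    refine integral_nonneg fun x => ?_
    have : φ x ^ 2 * p i x * p i x + 2 * φ x * pd i φ x * p i x * (ψ x * v x) +
      (pd i φ x * (ψ x * v x)) ^ 2 = (φ x * p i x + pd i φ x * (ψ x * v x)) ^ 2 := by ring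
    simp only [Pi.zero_apply, this]
    positivity
  have a4 := Finset.sum_nonneg fun i (_ : i ∈ Finset.univ) => a3 i
  rw [Finset.sum_add_distrib] at a4
  rw [a1, a2]
  linarith

/-- Square integrable weak solutions of `v - L v = 0` vanish. -/
theorem HypothesisH1.eq_zero_of_weak_resolvent (hN : 1 ≤ N) (h : HypothesisH1 m G) {v : Sp N → ℝ}
    (hv : MemLp v 2 (densityMeasure m)) (heq : ∀ f : Sp N → ℝ, IsTestFunction f →
      ∫ x, (f x - kolmogorovExpr m G f x) * v x ∂densityMeasure m = 0) :
    v =ᵐ[densityMeasure m] 0 := by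
  obtain ⟨C, φ, hC, hφ⟩ := exists_cutoffs N
  have hv2 := hv.integrable_sq
  set I := ∫ x, v x ^ 2 ∂densityMeasure m
  have hfm := h.isFiniteMeasureOnCompacts
  have key : ∀ n, ∫ x, φ n x ^ 2 * v x ^ 2 ∂densityMeasure m ≤ C / ((n : ℝ) + 1) ^ 2 * I := by
    intro n
    obtain ⟨ht, h0, h1, -, hg⟩ := hφ n
    refine (h.integral_sq_mul_sq_le hN hv heq ht).trans ?_
    rw [← integral_const_mul]
    refine integral_mono ((ht.gradDot ht).integrable_mul hv2.locallyIntegrable) (hv2.const_mul _)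
      fun x => mul_le_mul_of_nonneg_right (hg x) (sq_nonneg _)
  have lim1 : Tendsto (fun n => ∫ x, φ n x ^ 2 * v x ^ 2 ∂densityMeasure m) atTop (𝓝 I) := by
    refine tendsto_integral_of_dominated_convergence (fun x => v x ^ 2)
      (fun n => ?_) hv2 (fun n => Eventually.of_forall fun x => ?_) (Eventually.of_forall fun x => ?_)
    · exact ((hφ n).1.continuous.pow 2).aestronglyMeasurable.mul hv2.1
    · obtain ⟨-, h0, h1, -⟩ := hφ n
      rw [Real.norm_of_nonneg (by positivity)]
      exact mul_le_of_le_one_left (sq_nonneg _) (pow_le_one₀ (h0 x) (h1 x))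
    · obtain ⟨k, hk⟩ := exists_nat_ge ‖x‖
      refine tendsto_const_nhds.congr' ?_
      filter_upwards [eventually_ge_atTop k] with n hn
      have : (k : ℝ) ≤ n := by exact_mod_cast hn
      rw [(hφ n).2.2.2.1 x (by linarith)]
      ring
  have lim2 : Tendsto (fun n : ℕ => C / ((n : ℝ) + 1) ^ 2 * I) atTop (𝓝 (0 * I)) := by
    refine Tendsto.mul_const _ (Tendsto.div_atTop tendsto_const_nhds ?_)
    exact (tendsto_pow_atTop two_ne_zero).comp
      (tendsto_atTop_add_const_right _ _ tendsto_natCast_atTop_atTop)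
  have hI : I ≤ 0 * I := le_of_tendsto_of_tendsto' lim1 lim2 key
  have hI0 : 0 ≤ I := integral_nonneg fun x => sq_nonneg _
  have hI1 : I = 0 := by linarith
  have hae : (fun x => v x ^ 2) =ᵐ[densityMeasure m] 0 :=
    (integral_eq_zero_iff_of_nonneg (fun x => sq_nonneg _) hv2).1 hI1
  filter_upwards [hae] with x hx
  exact pow_eq_zero_iff two_ne_zero |>.1 hx

end WeakResolvent

/-! ### Essential self-adjointness of the Kolmogorov operator -/

section Scalars

variable {N : ℕ} {m : Sp N → ℝ} {G : Sp N → Sp N} {𝕜 𝕜' : Type*} [RCLike 𝕜] [RCLike 𝕜']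

theorem IsTestFunction.clm_comp {f : Sp N → 𝕜} (hf : IsTestFunction f) (l : 𝕜 →L[ℝ] 𝕜') :
    IsTestFunction fun x => l (f x) :=
  ⟨l.contDiff.comp hf.1, hf.2.comp_left (map_zero l)⟩

theorem kolmogorovExpr_clm_comp {f : Sp N → 𝕜} (hf : IsTestFunction f) (l : 𝕜 →L[ℝ] 𝕜')
    (x : Sp N) : kolmogorovExpr m G (fun y => l (f y)) x = l (kolmogorovExpr m G f x) := by
  have h2 : (2 : WithTop ℕ∞) ≤ ((⊤ : ℕ∞) : WithTop ℕ∞) := WithTop.coe_le_coe.2 le_top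
  have e1 : Laplacian.laplacian (fun y => l (f y)) x = l (Laplacian.laplacian f x) :=
    ((hf.1.of_le h2).contDiffAt (x := x)).laplacian_CLM_comp_left (l := l)
  have e2 : fderiv ℝ (fun y => l (f y)) x = l.comp (fderiv ℝ f x) :=
    (l.hasFDerivAt.comp x ((hf.1.differentiable (by simp)) x).hasFDerivAt).fderiv
  rw [kolmogorovExpr, kolmogorovExpr, e1, e2, map_add]
  rfl

theorem IsTestFunction.memLp_rclike {ν : Measure (Sp N)} [IsFiniteMeasureOnCompacts ν] {f : Sp N → 𝕜}
    (hf : IsTestFunction f) {p : ℝ≥0∞} : MemLp f p ν :=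
  hf.continuous.memLp_of_hasCompactSupport hf.2

theorem HypothesisH1.mem_kolmogorovGraph (hN : 1 ≤ N) (h : HypothesisH1 m G)
    [IsFiniteMeasureOnCompacts (densityMeasure m)] {f : Sp N → 𝕜} (hf : IsTestFunction f) :
    (hf.memLp_rclike.toLp f, (h.memLp_kolmogorovExpr hN hf).toLp _) ∈
      kolmogorovGraph 𝕜 (densityMeasure m) m G :=
  ⟨f, hf, hf.memLp_rclike.coeFn_toLp, (h.memLp_kolmogorovExpr hN hf).coeFn_toLp⟩

theorem re_inner_Lp {ν : Measure (Sp N)} (u v : Lp 𝕜 2 ν) : RCLike.re (inner 𝕜 u v) =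
    ∫ x, (RCLike.re (u x) * RCLike.re (v x) + RCLike.im (u x) * RCLike.im (v x)) ∂ν := by
  rw [L2.inner_def, ← integral_re (L2.integrable_inner u v)]
  refine integral_congr_ae (Eventually.of_forall fun x => ?_)
  simp [RCLike.inner_apply, mul_comm]

theorem im_inner_Lp {ν : Measure (Sp N)} (u v : Lp 𝕜 2 ν) : RCLike.im (inner 𝕜 u v) =
    ∫ x, (RCLike.re (u x) * RCLike.im (v x) - RCLike.im (u x) * RCLike.re (v x)) ∂ν := by
  rw [L2.inner_def, ← integral_im (L2.integrable_inner u v)]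
  refine integral_congr_ae (Eventually.of_forall fun x => ?_)
  simp [RCLike.inner_apply]
  ring

theorem HypothesisH1.integral_mul_kolmogorovExpr (h : HypothesisH1 m G) {f g : Sp N → ℝ}
    (hf : ContDiff ℝ ∞ f) (hg : IsTestFunction g) :
    ∫ x, g x * kolmogorovExpr m G f x ∂densityMeasure m =
      -∫ x, gradDot f g x ∂densityMeasure m := by
  rw [h.integral_densityMeasure, h.integral_densityMeasure,
    ← (h.integral_kolmogorovExpr_mul hf hg).2.2]
  exact integral_congr_ae (Eventually.of_forall fun x => by ring)

theorem HypothesisH1.integral_mul_kolmogorovExpr_comm (h : HypothesisH1 m G) {f g : Sp N → ℝ}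
    (hf : IsTestFunction f) (hg : IsTestFunction g) :
    ∫ x, kolmogorovExpr m G g x * f x ∂densityMeasure m =
      ∫ x, g x * kolmogorovExpr m G f x ∂densityMeasure m := by
  have e1 : ∫ x, kolmogorovExpr m G g x * f x ∂densityMeasure m =
      ∫ x, f x * kolmogorovExpr m G g x ∂densityMeasure m :=
    integral_congr_ae (Eventually.of_forall fun x => mul_comm _ _)
  rw [e1, h.integral_mul_kolmogorovExpr hf.1 hg, h.integral_mul_kolmogorovExpr hg.1 hf]
  simp_rw [gradDot_comm f g]

/-- L has real coefficients, so it commutes with real and imaginary parts and everything reduces to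
integration by parts for real test functions. -/
theorem HypothesisH1.isNonposSymmetricGraph (hN : 1 ≤ N) (h : HypothesisH1 m G) :
    IsNonposSymmetricGraph (kolmogorovGraph 𝕜 (densityMeasure m) m G) := by
  have hfm := h.isFiniteMeasureOnCompacts
  set μ := densityMeasure m
  have hre : ∀ f : Sp N → 𝕜, IsTestFunction f → IsTestFunction fun x => RCLike.re (f x) :=
    fun f hf => hf.clm_comp RCLike.reCLM
  have him : ∀ f : Sp N → 𝕜, IsTestFunction f → IsTestFunction fun x => RCLike.im (f x) :=
    fun f hf => hf.clm_comp RCLike.imCLM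
  have hreL : ∀ f : Sp N → 𝕜, IsTestFunction f → ∀ x, RCLike.re (kolmogorovExpr m G f x) =
      kolmogorovExpr m G (fun x => RCLike.re (f x)) x :=
    fun f hf x => (kolmogorovExpr_clm_comp hf RCLike.reCLM x).symm
  have himL : ∀ f : Sp N → 𝕜, IsTestFunction f → ∀ x, RCLike.im (kolmogorovExpr m G f x) =
      kolmogorovExpr m G (fun x => RCLike.im (f x)) x :=
    fun f hf x => (kolmogorovExpr_clm_comp hf RCLike.imCLM x).symm
  have hint : ∀ a b : Sp N → ℝ, IsTestFunction a → IsTestFunction b →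
      Integrable (fun x => a x * kolmogorovExpr m G b x) μ := fun a b ha hb =>
    MemLp.integrable_mul (ha.memLp (p := 2)) (h.memLp_kolmogorovExpr hN hb)
  have hint' : ∀ a b : Sp N → ℝ, IsTestFunction a → IsTestFunction b →
      Integrable (fun x => kolmogorovExpr m G a x * b x) μ := fun a b ha hb =>
    MemLp.integrable_mul (h.memLp_kolmogorovExpr hN ha) (hb.memLp (p := 2))
  constructor
  · rintro p ⟨f, hf, hp1, hp2⟩ q ⟨g, hg, hq1, hq2⟩
    have hs := fun a b (ha : IsTestFunction a) (hb : IsTestFunction b) =>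
      h.integral_mul_kolmogorovExpr_comm hb ha (f := b) (g := a)
    refine RCLike.ext ?_ ?_
    · rw [re_inner_Lp, re_inner_Lp]
      have e1 : ∫ x, (RCLike.re (p.2 x) * RCLike.re (q.1 x) + RCLike.im (p.2 x) * RCLike.im (q.1 x)) ∂μ
          = ∫ x, (kolmogorovExpr m G (fun x => RCLike.re (f x)) x * RCLike.re (g x) +
            kolmogorovExpr m G (fun x => RCLike.im (f x)) x * RCLike.im (g x)) ∂μ := by
        refine integral_congr_ae ?_
        filter_upwards [hp2, hq1] with x h1 h2
        rw [h1, h2, hreL f hf, himL f hf]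
      have e2 : ∫ x, (RCLike.re (p.1 x) * RCLike.re (q.2 x) + RCLike.im (p.1 x) * RCLike.im (q.2 x)) ∂μ
          = ∫ x, (RCLike.re (f x) * kolmogorovExpr m G (fun x => RCLike.re (g x)) x +
            RCLike.im (f x) * kolmogorovExpr m G (fun x => RCLike.im (g x)) x) ∂μ := by
        refine integral_congr_ae ?_
        filter_upwards [hp1, hq2] with x h1 h2
        rw [h1, h2, hreL g hg, himL g hg]
      rw [e1, e2, integral_add (hint' _ _ (hre f hf) (hre g hg)) (hint' _ _ (him f hf) (him g hg)),
        integral_add (hint _ _ (hre f hf) (hre g hg)) (hint _ _ (him f hf) (him g hg)),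
        hs _ _ (hre f hf) (hre g hg), hs _ _ (him f hf) (him g hg)]
    · rw [im_inner_Lp, im_inner_Lp]
      have e1 : ∫ x, (RCLike.re (p.2 x) * RCLike.im (q.1 x) - RCLike.im (p.2 x) * RCLike.re (q.1 x)) ∂μ
          = ∫ x, (kolmogorovExpr m G (fun x => RCLike.re (f x)) x * RCLike.im (g x) -
            kolmogorovExpr m G (fun x => RCLike.im (f x)) x * RCLike.re (g x)) ∂μ := by
        refine integral_congr_ae ?_
        filter_upwards [hp2, hq1] with x h1 h2
        rw [h1, h2, hreL f hf, himL f hf]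
      have e2 : ∫ x, (RCLike.re (p.1 x) * RCLike.im (q.2 x) - RCLike.im (p.1 x) * RCLike.re (q.2 x)) ∂μ
          = ∫ x, (RCLike.re (f x) * kolmogorovExpr m G (fun x => RCLike.im (g x)) x -
            RCLike.im (f x) * kolmogorovExpr m G (fun x => RCLike.re (g x)) x) ∂μ := by
        refine integral_congr_ae ?_
        filter_upwards [hp1, hq2] with x h1 h2
        rw [h1, h2, hreL g hg, himL g hg]
      rw [e1, e2, integral_sub (hint' _ _ (hre f hf) (him g hg)) (hint' _ _ (him f hf) (hre g hg)),
        integral_sub (hint _ _ (hre f hf) (him g hg)) (hint _ _ (him f hf) (hre g hg)),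
        hs _ _ (hre f hf) (him g hg), hs _ _ (him f hf) (hre g hg)]
  · rintro p ⟨f, hf, hp1, hp2⟩
    rw [re_inner_Lp]
    have e2 : ∫ x, (RCLike.re (p.1 x) * RCLike.re (p.2 x) + RCLike.im (p.1 x) * RCLike.im (p.2 x)) ∂μ
        = ∫ x, (RCLike.re (f x) * kolmogorovExpr m G (fun x => RCLike.re (f x)) x +
          RCLike.im (f x) * kolmogorovExpr m G (fun x => RCLike.im (f x)) x) ∂μ := by
      refine integral_congr_ae ?_
      filter_upwards [hp1, hp2] with x h1 h2
      rw [h1, h2, hreL f hf, himL f hf]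
    rw [e2, integral_add (hint _ _ (hre f hf) (hre f hf)) (hint _ _ (him f hf) (him f hf)),
      h.integral_mul_kolmogorovExpr (hre f hf).1 (hre f hf),
      h.integral_mul_kolmogorovExpr (him f hf).1 (him f hf)]
    have n1 : 0 ≤ ∫ x, gradDot (fun x => RCLike.re (f x)) (fun x => RCLike.re (f x)) x ∂μ :=
      integral_nonneg fun x => gradDot_self_nonneg _ x
    have n2 : 0 ≤ ∫ x, gradDot (fun x => RCLike.im (f x)) (fun x => RCLike.im (f x)) x ∂μ :=
      integral_nonneg fun x => gradDot_self_nonneg _ x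
    linarith

theorem inner_toLp_ofReal {ν : Measure (Sp N)} {f : Sp N → ℝ} {k : Sp N → 𝕜}
    (hk : MemLp k 2 ν) (hkf : ∀ x, k x = (f x : 𝕜)) (v : Lp 𝕜 2 ν) :
    inner 𝕜 (hk.toLp k) v = ∫ x, f x • v x ∂ν := by
  rw [L2.inner_def]
  refine integral_congr_ae ?_
  filter_upwards [hk.coeFn_toLp] with x hx
  rw [hx, hkf, RCLike.inner_apply, RCLike.conj_ofReal, mul_comm, RCLike.real_smul_eq_coe_mul]

theorem HypothesisH1.dense_testFunction (hN : 1 ≤ N) (h : HypothesisH1 m G) :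
    Dense {x | ∃ y, (x, y) ∈ kolmogorovGraph 𝕜 (densityMeasure m) m G} := by
  have hfm := h.isFiniteMeasureOnCompacts
  have hset : {x | ∃ y, (x, y) ∈ kolmogorovGraph 𝕜 (densityMeasure m) m G} =
      ((kolmogorovGraph 𝕜 (densityMeasure m) m G).map (LinearMap.fst 𝕜 _ _) : Set _) := by
    ext x; simp
  rw [hset, ← Submodule.dense_iff_topologicalClosure_eq_top.symm.eq,
    Submodule.topologicalClosure_eq_top_iff, Submodule.eq_bot_iff]
  intro v hv
  rw [Lp.eq_zero_iff_ae_eq_zero]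
  refine ae_eq_zero_of_integral_contDiff_smul_eq_zero
    ((Lp.memLp v).locallyIntegrable (by norm_num)) fun g hg hgs => ?_
  have ht : IsTestFunction fun x => (g x : 𝕜) :=
    IsTestFunction.clm_comp (𝕜 := ℝ) ⟨hg, hgs⟩ RCLike.ofRealCLM
  have h1 := (Submodule.mem_orthogonal _ _).1 hv _ ⟨_, h.mem_kolmogorovGraph hN ht, rfl⟩
  rw [← h1]
  exact (inner_toLp_ofReal ht.memLp_rclike (fun _ => rfl) v).symm

/-- The real and imaginary parts of a vector orthogonal to the range solve the weak resolvent
equation, hence vanish. -/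
theorem HypothesisH1.dense_resolvent_range (hN : 1 ≤ N) (h : HypothesisH1 m G) :
    Dense {y | ∃ p ∈ kolmogorovGraph 𝕜 (densityMeasure m) m G, p.1 - p.2 = y} := by
  have hfm := h.isFiniteMeasureOnCompacts
  have hset : {y | ∃ p ∈ kolmogorovGraph 𝕜 (densityMeasure m) m G, p.1 - p.2 = y} =
      ((kolmogorovGraph 𝕜 (densityMeasure m) m G).map
        (LinearMap.fst 𝕜 _ _ - LinearMap.snd 𝕜 _ _) : Set _) := by
    ext x; simp
  rw [hset, ← Submodule.dense_iff_topologicalClosure_eq_top.symm.eq,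
    Submodule.topologicalClosure_eq_top_iff, Submodule.eq_bot_iff]
  intro v hv
  have key : ∀ l : 𝕜 →L[ℝ] ℝ, (fun x => l (v x)) =ᵐ[densityMeasure m] 0 := by
    intro l
    refine h.eq_zero_of_weak_resolvent hN (l.comp_memLp' (Lp.memLp v)) fun f hf => ?_
    have ht : IsTestFunction fun x => (f x : 𝕜) :=
      IsTestFunction.clm_comp (𝕜 := ℝ) hf RCLike.ofRealCLM
    have h1 := (Submodule.mem_orthogonal _ _).1 hv _ ⟨_, h.mem_kolmogorovGraph hN ht, rfl⟩
    have hm : MemLp (fun x => (f x : 𝕜) - kolmogorovExpr m G (fun x => (f x : 𝕜)) x) 2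
      (densityMeasure m) := ht.memLp_rclike.sub (h.memLp_kolmogorovExpr hN ht)
    have h2 : inner 𝕜 (hm.toLp _) v = 0 := by
      rw [← h1]
      congr 1
    rw [inner_toLp_ofReal (f := fun x => f x - kolmogorovExpr m G f x) hm (fun x => by
      rw [RCLike.ofReal_sub]
      congr 1
      exact kolmogorovExpr_clm_comp hf (RCLike.ofRealCLM (K := 𝕜)) x)] at h2
    have hi : Integrable (fun x => (f x - kolmogorovExpr m G f x) • v x) (densityMeasure m) := by
      refine (hm.integrable_mul (Lp.memLp v)).congr (Eventually.of_forall fun x => ?_)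
      have e : kolmogorovExpr m G (fun x => (f x : 𝕜)) x = RCLike.ofReal (kolmogorovExpr m G f x) :=
        kolmogorovExpr_clm_comp hf (RCLike.ofRealCLM (K := 𝕜)) x
      simp only [Pi.mul_apply, e, RCLike.real_smul_eq_coe_mul, RCLike.ofReal_sub]
    have h3 := l.integral_comp_comm hi
    rw [h2, map_zero] at h3
    rw [← h3]
    exact integral_congr_ae (Eventually.of_forall fun x => by simp)
  rw [Lp.eq_zero_iff_ae_eq_zero]
  filter_upwards [key RCLike.reCLM, key RCLike.imCLM] with x h1 h2
  exact RCLike.ext (by simpa using h1) (by simpa using h2)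

/-- The closure of the Kolmogorov operator on test functions is self-adjoint. -/
theorem HypothesisH1.isNonposSelfAdjointGraph (hN : 1 ≤ N) (h : HypothesisH1 m G) :
    IsNonposSelfAdjointGraph (kolmogorovGraph 𝕜 (densityMeasure m) m G).topologicalClosure :=
  (h.isNonposSymmetricGraph hN).topologicalClosure (h.dense_resolvent_range hN)
    (h.dense_testFunction hN)

end Scalars

/-! ### The kernel of `L` and the sub-Markov property of its resolvent -/

section Kernel

variable {N : ℕ} {m : Sp N → ℝ} {G : Sp N → Sp N} {𝕜 : Type*} [RCLike 𝕜]

/-- Real parts, or any real linear functional of the values, of a pair in the closed graph are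
approximated in graph norm by real test functions, where integration by parts is available. -/
theorem HypothesisH1.exists_approx (hN : 1 ≤ N) (h : HypothesisH1 m G)
    [IsFiniteMeasureOnCompacts (densityMeasure m)] {u y : Lp 𝕜 2 (densityMeasure m)}
    (huy : (u, y) ∈ (kolmogorovGraph 𝕜 (densityMeasure m) m G).topologicalClosure)
    (l : 𝕜 →L[ℝ] ℝ) :
    ∃ (f : ℕ → Sp N → ℝ) (hf : ∀ n, IsTestFunction (f n)),
      Tendsto (fun n => ((hf n).memLp (p := 2) (ν := densityMeasure m)).toLp (f n)) atTop
        (𝓝 (l.compLpL 2 (densityMeasure m) u)) ∧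
      Tendsto (fun n => (h.memLp_kolmogorovExpr hN (hf n)).toLp _) atTop
        (𝓝 (l.compLpL 2 (densityMeasure m) y)) := by
  obtain ⟨p, hp, hlim⟩ := mem_closure_iff_seq_limit.1 huy
  choose f hf hf1 hf2 using hp
  refine ⟨fun n x => l (f n x), fun n => (hf n).clm_comp l, ?_, ?_⟩
  · have e : ∀ n, (((hf n).clm_comp l).memLp (p := 2) (ν := densityMeasure m)).toLp
        (fun x => l (f n x)) = l.compLpL 2 (densityMeasure m) (p n).1 := fun n => by
      refine Lp.ext ?_
      filter_upwards [(((hf n).clm_comp l).memLp (p := 2) (ν := densityMeasure m)).coeFn_toLp,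
        l.coeFn_compLpL (p := 2) (μ := densityMeasure m) (p n).1, hf1 n] with x h1 h2 h3
      rw [h1, h2, h3]
    simp_rw [e]
    exact ((l.compLpL 2 (densityMeasure m)).continuous.tendsto u).comp
      ((continuous_fst.tendsto _).comp hlim)
  · have e : ∀ n, (h.memLp_kolmogorovExpr hN ((hf n).clm_comp l)).toLp
        (kolmogorovExpr m G fun x => l (f n x)) = l.compLpL 2 (densityMeasure m) (p n).2 :=
      fun n => by
        refine Lp.ext ?_
        filter_upwards [(h.memLp_kolmogorovExpr hN ((hf n).clm_comp l)).coeFn_toLp,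
          l.coeFn_compLpL (p := 2) (μ := densityMeasure m) (p n).2, hf2 n] with x h1 h2 h3
        rw [h1, h2, h3, kolmogorovExpr_clm_comp (hf n)]
    simp_rw [e]
    exact ((l.compLpL 2 (densityMeasure m)).continuous.tendsto y).comp
      ((continuous_snd.tendsto _).comp hlim)

theorem pd_eq_zero_of_notMem {f : Sp N → ℝ} {x : Sp N} (hx : x ∉ tsupport f) (i : Fin N) :
    pd i f x = 0 := by
  rw [pd, (notMem_tsupport_iff_eventuallyEq.1 hx).fderiv_eq]
  simp

/-- The constant 1 is not a test function; a cutoff equal to 1 near the support of f replaces it,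
and its gradient vanishes where f does not. -/
theorem HypothesisH1.integral_kolmogorovExpr_eq_zero (h : HypothesisH1 m G) {f : Sp N → ℝ}
    (hf : IsTestFunction f) : ∫ x, kolmogorovExpr m G f x ∂densityMeasure m = 0 := by
  obtain ⟨C, φ, -, hφ⟩ := exists_cutoffs N
  obtain ⟨R, hR⟩ := hf.2.isCompact.isBounded.exists_norm_le
  obtain ⟨n, hn⟩ := exists_nat_gt R
  obtain ⟨ht, -, -, h1, -⟩ := hφ n
  have e := h.integral_mul_kolmogorovExpr hf.1 ht
  have e1 : ∀ x, φ n x * kolmogorovExpr m G f x = kolmogorovExpr m G f x := fun x => by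
    by_cases hx : x ∈ tsupport f
    · rw [h1 x ((hR x hx).trans (by linarith)), one_mul]
    · rw [kolmogorovExpr_eq_zero hx, mul_zero]
  have e2 : ∀ x, gradDot f (φ n) x = 0 := fun x => by
    refine Finset.sum_eq_zero fun i _ => ?_
    by_cases hx : x ∈ tsupport f
    · have hloc : φ n =ᶠ[𝓝 x] fun _ => (1 : ℝ) := by
        filter_upwards [Metric.ball_mem_nhds x one_pos] with y hy
        refine h1 y ?_
        have := norm_le_norm_add_norm_sub' y x
        rw [Metric.mem_ball, dist_eq_norm] at hy
        linarith [hR x hx]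
      have : pd i (φ n) x = 0 := by
        rw [pd, hloc.fderiv_eq]
        simp
      rw [this, mul_zero]
    · rw [pd_eq_zero_of_notMem hx, zero_mul]
  simpa [e1, e2] using e

/-- As ∫ Lf dμ = 0, the pair (1, 0) lies in the graph of the adjoint, which is the closed graph
itself. -/
theorem HypothesisH1.const_mem_closure (hN : 1 ≤ N) (h : HypothesisH1 m G)
    [IsFiniteMeasure (densityMeasure m)] :
    (Lp.const 2 (densityMeasure m) (1 : 𝕜), (0 : Lp 𝕜 2 (densityMeasure m))) ∈
      (kolmogorovGraph 𝕜 (densityMeasure m) m G).topologicalClosure := by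
  refine (h.isNonposSelfAdjointGraph hN).mem_of_forall_inner fun p hp => ?_
  rw [inner_zero_right]
  have hcl : IsClosed {p : Lp 𝕜 2 (densityMeasure m) × Lp 𝕜 2 (densityMeasure m) |
      inner 𝕜 p.2 (Lp.const 2 (densityMeasure m) (1 : 𝕜)) = 0} :=
    isClosed_eq (continuous_snd.inner continuous_const) continuous_const
  refine closure_minimal ?_ hcl hp
  rintro q ⟨f, hf, -, hq⟩
  have key : ∀ l : 𝕜 →L[ℝ] ℝ, ∫ x, l (q.2 x) ∂densityMeasure m = 0 := fun l => by
    rw [← h.integral_kolmogorovExpr_eq_zero (hf.clm_comp l)]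
    refine integral_congr_ae ?_
    filter_upwards [hq] with x hx
    rw [hx, kolmogorovExpr_clm_comp hf]
  refine RCLike.ext ?_ ?_
  · rw [re_inner_Lp, map_zero, ← key RCLike.reCLM]
    refine integral_congr_ae ?_
    filter_upwards [Lp.coeFn_const 2 (densityMeasure m) (1 : 𝕜)] with x hx
    rw [hx]
    simp
  · rw [im_inner_Lp, map_zero, ← neg_eq_zero, ← integral_neg, ← key RCLike.imCLM]
    refine integral_congr_ae ?_
    filter_upwards [Lp.coeFn_const 2 (densityMeasure m) (1 : 𝕜)] with x hx
    rw [hx]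
    simp

/-- Dividing by m turns a Lebesgue pairing with φ into a pairing in L²_μ; m is bounded below on the
support of φ. -/
theorem HypothesisH1.memLp_div (h : HypothesisH1 m G)
    [IsFiniteMeasureOnCompacts (densityMeasure m)] {φ : Sp N → ℝ} (hφ : IsTestFunction φ) :
    MemLp (fun x => φ x / m x) 2 (densityMeasure m) := by
  obtain ⟨c, hc, hcm⟩ := h.pos_on_compacts _ hφ.2.isCompact
  have hcm' := (ae_restrict_iff' hφ.2.isCompact.measurableSet).1 hcm
  have hmeas : AEMeasurable m (densityMeasure m) :=
    h.aemeasurable.mono_ac (withDensity_absolutelyContinuous _ _)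
  refine ((hφ.memLp (p := 2) (ν := densityMeasure m)).const_mul c⁻¹).of_le
    ((hφ.continuous.measurable.aemeasurable.div hmeas).aestronglyMeasurable) ?_
  refine h.ae_iff.2 ?_
  filter_upwards [hcm', h.ae_pos] with x hx hp
  by_cases hxs : x ∈ tsupport φ
  · rw [norm_div, norm_mul, norm_inv, Real.norm_of_nonneg hp.le, Real.norm_of_nonneg hc.le,
      div_eq_inv_mul]
    gcongr
    exact hx hxs
  · simp [image_eq_zero_of_notMem_tsupport hxs]

theorem HypothesisH1.integral_div_mul (h : HypothesisH1 m G) (φ g : Sp N → ℝ) :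
    ∫ x, φ x / m x * g x ∂densityMeasure m = ∫ x, φ x * g x := by
  rw [h.integral_densityMeasure]
  refine integral_congr_ae ?_
  filter_upwards [h.ae_pos] with x hx
  field_simp

theorem HypothesisH1.locallyIntegrable_of_memLp (h : HypothesisH1 m G)
    [IsFiniteMeasure (densityMeasure m)] (a : Lp ℝ 2 (densityMeasure m)) :
    LocallyIntegrable a := by
  rw [locallyIntegrable_iff]
  intro K hK
  obtain ⟨c, hc, hcm⟩ := h.pos_on_compacts K hK
  have hi : Integrable a (densityMeasure m) := (Lp.memLp a).integrable (by norm_num)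
  refine (((h.integrable_densityMeasure_iff.1 hi).norm.const_mul c⁻¹).integrableOn
    (s := K)).mono' (Lp.stronglyMeasurable a).aestronglyMeasurable ?_
  filter_upwards [hcm] with x hx
  rw [norm_mul, Real.norm_of_nonneg (hc.le.trans hx), ← mul_assoc, mul_comm, mul_comm c⁻¹]
  have : 1 ≤ m x * c⁻¹ := by rwa [← div_eq_mul_inv, one_le_div hc]
  nlinarith [norm_nonneg (a x)]

/-- The mollifications have zero gradient, so they are constants, and they converge a.e. -/
theorem HasWeakGradient.ae_const {a : Sp N → ℝ} (ha : HasWeakGradient a 0) :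
    ∃ c : ℝ, a =ᵐ[volume] fun _ => c := by
  have hconst : ∀ n x, mollify volume n a x = mollify volume n a 0 := fun n x => by
    refine is_const_of_fderiv_eq_zero (𝕜 := ℝ)
      ((mollify_contDiff ha.locallyIntegrable n).differentiable (by simp)) (fun x => ?_) x 0
    ext v
    rw [ha.fderiv_mollify, mollify, convolution_zero]
    simp
  have hlim := mollify_ae_tendsto ha.locallyIntegrable
  obtain ⟨x₀, hx₀⟩ := hlim.exists
  refine ⟨a x₀, ?_⟩
  filter_upwards [hlim] with x hx
  simp_rw [hconst] at hx hx₀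
  exact tendsto_nhds_unique hx hx₀

/-- Functions in the kernel of `L` are constant. -/
theorem HypothesisH1.ae_const_of_mem (hN : 1 ≤ N) (h : HypothesisH1 m G)
    [IsFiniteMeasure (densityMeasure m)] {u : Lp 𝕜 2 (densityMeasure m)}
    (hu : (u, 0) ∈ (kolmogorovGraph 𝕜 (densityMeasure m) m G).topologicalClosure) :
    ∃ c : 𝕜, u =ᵐ[densityMeasure m] fun _ => c := by
  have key : ∀ l : 𝕜 →L[ℝ] ℝ, ∃ c : ℝ, ∀ᵐ x ∂densityMeasure m, l (u x) = c := fun l => by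
    obtain ⟨f, hf, hlim1, hlim2⟩ := h.exists_approx hN hu l
    rw [map_zero] at hlim2
    set a := l.compLpL 2 (densityMeasure m) u
    -- The Dirichlet integral of f n is -(f n | L f n), and L f n → 0. Hence the limit of f n has
    -- weak gradient zero.
    have hgrad : Tendsto (fun n => ∫ x, gradDot (f n) (f n) x ∂densityMeasure m) atTop (𝓝 0) := by
      have := (hlim1.inner hlim2 (𝕜 := ℝ)).neg
      rw [inner_zero_right, neg_zero] at this
      refine this.congr fun n => ?_
      rw [inner_toLp (hf n).memLp (h.memLp_kolmogorovExpr hN (hf n)),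
        h.integral_mul_kolmogorovExpr (hf n).1 (hf n), neg_neg]
    have hw : HasWeakGradient a 0 := by
      refine ⟨h.locallyIntegrable_of_memLp a, locallyIntegrable_zero, fun φ hφ i => ?_⟩
      have t1 := tendsto_integral_mul (fun n => (hf n).memLp) hlim1 (h.memLp_div (hφ.pd i))
      simp only [h.integral_div_mul] at t1
      have t2 : Tendsto (fun n => ∫ x, pd i φ x * f n x) atTop (𝓝 0) := by
        have e : ∀ n, ∫ x, pd i φ x * f n x = -∫ x, φ x / m x * pd i (f n) x ∂densityMeasure m := fun n => by
          rw [integral_pd_mul hφ (hf n).1 i, h.integral_div_mul]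
        simp_rw [e]
        rw [← neg_zero]
        refine Tendsto.neg ?_
        set K := ∫ x, (φ x / m x) ^ 2 ∂densityMeasure m
        have b : ∀ n, |∫ x, φ x / m x * pd i (f n) x ∂densityMeasure m| ≤
            √(K * ∫ x, gradDot (f n) (f n) x ∂densityMeasure m) := fun n => by
          refine Real.le_sqrt_of_sq_le ((integral_mul_sq_le (h.memLp_div hφ)
            ((hf n).pd i).memLp).trans ?_)
          refine mul_le_mul_of_nonneg_left ?_ (integral_nonneg fun x => sq_nonneg _)
          refine integral_mono ((hf n).pd i).memLp.integrable_sq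
            ((hf n).gradDot (hf n)).integrable fun x => ?_
          have := Finset.single_le_sum (f := fun j => pd j (f n) x * pd j (f n) x)
            (fun j _ => mul_self_nonneg _) (Finset.mem_univ i)
          simpa [gradDot, sq] using this
        refine squeeze_zero_norm b ?_
        have := (hgrad.const_mul K).sqrt
        simpa using this
      have e := tendsto_nhds_unique t1 t2
      simp only [Pi.zero_apply, PiLp.zero_apply, mul_zero, integral_zero, neg_zero]
      rw [← e]
      exact integral_congr_ae (Eventually.of_forall fun x => mul_comm _ _)
    obtain ⟨c, hc⟩ := hw.ae_const
    refine ⟨c, ?_⟩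
    filter_upwards [h.ae_iff.2 hc, l.coeFn_compLpL (p := 2) (μ := densityMeasure m) u] with x h1 h2
    rw [← h2, h1]
  obtain ⟨c, hc⟩ := key RCLike.reCLM
  obtain ⟨d, hd⟩ := key RCLike.imCLM
  refine ⟨c + d * RCLike.I, ?_⟩
  filter_upwards [hc, hd] with x h1 h2
  rw [← RCLike.re_add_im (u x)]
  simp only [RCLike.reCLM_apply, RCLike.imCLM_apply] at h1 h2
  rw [h1, h2]

/-- The Lipschitz bound makes composition with this function continuous on L². -/
theorem exists_smoothTransition_lipschitz : ∃ K, LipschitzWith K Real.smoothTransition := by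
  have hc : Continuous (deriv Real.smoothTransition) :=
    (Real.smoothTransition.contDiff (n := 1)).continuous_deriv le_rfl
  have hs : HasCompactSupport (deriv Real.smoothTransition) := by
    refine HasCompactSupport.intro (isCompact_Icc (a := 0) (b := 1)) fun x hx => ?_
    rw [Set.mem_Icc, not_and_or, not_le, not_le] at hx
    rcases hx with hx | hx
    · have : Real.smoothTransition =ᶠ[𝓝 x] fun _ => 0 := by
        filter_upwards [Iio_mem_nhds hx] with y hy
        exact Real.smoothTransition.zero_of_nonpos (le_of_lt hy)
      rw [this.deriv_eq, deriv_const]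
    · have : Real.smoothTransition =ᶠ[𝓝 x] fun _ => 1 := by
        filter_upwards [Ioi_mem_nhds hx] with y hy
        exact Real.smoothTransition.one_of_one_le (le_of_lt hy)
      rw [this.deriv_eq, deriv_const]
  obtain ⟨C, hC⟩ := hs.exists_bound_of_continuous hc
  refine ⟨C.toNNReal, lipschitzWith_of_nnnorm_deriv_le
    ((Real.smoothTransition.contDiff (n := 1)).differentiable (by simp)) fun x => ?_⟩
  rw [← NNReal.coe_le_coe, coe_nnnorm]
  exact (hC x).trans (Real.le_coe_toNNReal C)

/-- The resolvent of `L` preserves upper bounds. -/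
theorem HypothesisH1.ae_le_of_mem (hN : 1 ≤ N) (h : HypothesisH1 m G)
    [IsFiniteMeasure (densityMeasure m)] {u y : Lp 𝕜 2 (densityMeasure m)}
    (huy : (u, y) ∈ (kolmogorovGraph 𝕜 (densityMeasure m) m G).topologicalClosure)
    (l : 𝕜 →L[ℝ] ℝ) {c : ℝ} (hc : 0 ≤ c)
    (hle : ∀ᵐ x ∂densityMeasure m, l (u x) - l (y x) ≤ c) :
    ∀ᵐ x ∂densityMeasure m, l (u x) ≤ c := by
  have hin : ∀ s t : ℝ, inner ℝ s t = s * t := fun s t => by simp [mul_comm]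
  obtain ⟨f, hf, hlim1, hlim2⟩ := h.exists_approx hN huy l
  set a := l.compLpL 2 (densityMeasure m) u
  set b := l.compLpL 2 (densityMeasure m) y
  have ha : a =ᵐ[densityMeasure m] fun x => l (u x) := l.coeFn_compLpL u
  have hb : b =ᵐ[densityMeasure m] fun x => l (y x) := l.coeFn_compLpL y
  obtain ⟨K, hK⟩ := exists_smoothTransition_lipschitz
  -- A smooth increasing function vanishing exactly for s ≤ c, in place of the positive part of s -
  -- c. As c ≥ 0 it vanishes at 0, so χ ∘ f n is again a test function.
  set χ : ℝ → ℝ := fun s => Real.smoothTransition (s - c) with hχ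
  have hχc : ContDiff ℝ ∞ χ := Real.smoothTransition.contDiff.comp (contDiff_id.sub contDiff_const)
  have hχm : Monotone χ := fun s t hst => Real.smoothTransition.monotone (by linarith)
  have hχ0 : χ 0 = 0 := Real.smoothTransition.zero_of_nonpos (by linarith)
  have hχL : LipschitzWith K χ := by
    refine LipschitzWith.of_dist_le_mul fun s t => (hK.dist_le_mul _ _).trans_eq ?_
    rw [dist_sub_right]
  have hχf : ∀ n, IsTestFunction fun x => χ (f n x) := fun n =>
    ⟨hχc.comp (hf n).1, (hf n).2.comp_left hχ0⟩
  -- ∫ χ(f) Lf dμ = -∫ χ'(f)|∇f|² dμ, and χ' ≥ 0.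
  have hneg : ∀ n, ∫ x, χ (f n x) * kolmogorovExpr m G (f n) x ∂densityMeasure m ≤ 0 := fun n => by
    rw [h.integral_mul_kolmogorovExpr (hf n).1 (hχf n), Left.neg_nonpos_iff]
    refine integral_nonneg fun x => Finset.sum_nonneg fun i _ => ?_
    have e : pd i (fun x => χ (f n x)) x = deriv χ (f n x) * pd i (f n) x := by
      have h1 := ((hχc.differentiable (by simp)) (f n x)).hasDerivAt.comp_hasFDerivAt x
        (((hf n).1.differentiable (by simp)) x).hasFDerivAt
      have h2 : fderiv ℝ (fun x => χ (f n x)) x = deriv χ (f n x) • fderiv ℝ (f n) x := h1.fderiv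
      rw [pd, h2]
      rfl
    rw [e]
    nlinarith [mul_nonneg hχm.deriv_nonneg (mul_self_nonneg (pd i (f n) x)) (a := deriv χ (f n x))]
  have hlim3 := (((hχL.continuous_compLp hχ0 (p := 2) (μ := densityMeasure m)).tendsto a).comp hlim1).inner
    hlim2 (𝕜 := ℝ)
  have hint : inner ℝ (hχL.compLp hχ0 a) b ≤ 0 := by
    refine le_of_tendsto' hlim3 fun n => (le_of_eq ?_).trans (hneg n)
    rw [L2.inner_def]
    refine integral_congr_ae ?_
    filter_upwards [hχL.coeFn_compLp hχ0 (((hf n).memLp (p := 2) (ν := densityMeasure m)).toLp (f n)),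
      ((hf n).memLp (p := 2) (ν := densityMeasure m)).coeFn_toLp,
      (h.memLp_kolmogorovExpr hN (hf n)).coeFn_toLp] with x h1 h2 h3
    simp only [Function.comp_apply] at h1 ⊢
    rw [h1, h2, h3, hin]
  set w := hχL.compLp hχ0 a
  have hw : w =ᵐ[densityMeasure m] χ ∘ a := hχL.coeFn_compLp hχ0 a
  have hi1 : Integrable (fun x => w x * b x) (densityMeasure m) := (Lp.memLp w).integrable_mul (Lp.memLp b)
  have hi2 : Integrable (fun x => w x * (a x - c)) (densityMeasure m) :=
    (Lp.memLp w).integrable_mul ((Lp.memLp a).sub (memLp_const c))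
  have hpos : ∀ s, 0 ≤ χ s * (s - c) := fun s => by
    rcases le_total s c with hs | hs
    · rw [show χ s = 0 from Real.smoothTransition.zero_of_nonpos (by linarith), zero_mul]
    · exact mul_nonneg (Real.smoothTransition.nonneg _) (by linarith)
  have hnn : 0 ≤ᵐ[densityMeasure m] fun x => w x * (a x - c) := by
    filter_upwards [hw] with x hx
    rw [hx]
    exact hpos (a x)
  -- Since a - b ≤ c, the integral of χ(a)(a - c) is at most that of χ(a) b, which is ≤ 0. So the
  -- nonnegative function χ(a)(a - c) vanishes a.e., that is, a ≤ c.
  have hzero : ∫ x, w x * (a x - c) ∂densityMeasure m = 0 := by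
    refine le_antisymm (le_trans ?_ hint) (integral_nonneg_of_ae hnn)
    rw [L2.inner_def]
    refine integral_mono_ae hi2 (hi1.congr (Eventually.of_forall fun x =>
      (hin _ _).symm)) ?_
    filter_upwards [hw, ha, hb, hle] with x h1 h2 h3 h4
    rw [hin]
    refine mul_le_mul_of_nonneg_left (by rw [h2, h3]; linarith) ?_
    rw [h1]
    exact Real.smoothTransition.nonneg _
  filter_upwards [(integral_eq_zero_iff_of_nonneg_ae hnn hi2).1 hzero, hw, ha] with x h1 h2 h3
  rw [← h3]
  by_contra hcon
  rw [not_le] at hcon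
  rw [h2] at h1
  have : 0 < χ (a x) := Real.smoothTransition.pos_of_pos (by linarith)
  have := mul_pos this (sub_pos.2 hcon)
  simp only [Function.comp_apply, Pi.zero_apply] at h1
  linarith

/-- The resolvent of `L` preserves bounded functions. -/
theorem HypothesisH1.ae_abs_le_of_mem (hN : 1 ≤ N) (h : HypothesisH1 m G)
    [IsFiniteMeasure (densityMeasure m)] {u y : Lp 𝕜 2 (densityMeasure m)}
    (huy : (u, y) ∈ (kolmogorovGraph 𝕜 (densityMeasure m) m G).topologicalClosure)
    (l : 𝕜 →L[ℝ] ℝ) {c : ℝ} (hc : 0 ≤ c)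
    (hle : ∀ᵐ x ∂densityMeasure m, |l (u x) - l (y x)| ≤ c) :
    ∀ᵐ x ∂densityMeasure m, |l (u x)| ≤ c := by
  have h1 := h.ae_le_of_mem hN huy l hc (hle.mono fun x hx => (le_abs_self _).trans hx)
  have h2 := h.ae_le_of_mem hN huy (-l) hc (hle.mono fun x hx => by
    have := (neg_le_abs _).trans hx
    simp only [neg_apply]
    linarith)
  filter_upwards [h1, h2] with x h1 h2
  exact abs_le'.2 ⟨h1, h2⟩

end Kernel

/-! ### The semigroup generated by the square of a self-adjoint graph -/

section Generation

variable {𝕜 H : Type*} [RCLike 𝕜] [NormedAddCommGroup H] [InnerProductSpace 𝕜 H]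
  [NormedSpace ℝ H] [CompleteSpace H] [IsScalarTower ℝ 𝕜 H] {Γ : Submodule 𝕜 (H × H)}
  {T : C0Semigroup 𝕜 H}

theorem C0Semigroup.generator_eq_neg_iff {A : H →ₗ.[𝕜] H} :
    T.generator = -A ↔ ∀ x k, (x, k) ∈ T.generatorGraph ↔ (x, -k) ∈ A.graph := by
  have hneg : ∀ x k, (x, k) ∈ (-A).graph ↔ (x, -k) ∈ A.graph := fun x k => by
    rw [LinearPMap.neg_graph, Submodule.mem_map]
    constructor
    · rintro ⟨⟨a, b⟩, hab, he⟩
      obtain ⟨rfl, rfl⟩ := Prod.mk.inj he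
      simpa using hab
    · exact fun hx => ⟨(x, -k), hx, by simp⟩
  constructor
  · intro hT x k
    rw [← T.generator_graph, hT, hneg]
  · intro hT
    refine LinearPMap.eq_of_eq_graph ?_
    rw [T.generator_graph]
    ext ⟨x, k⟩
    rw [hT, hneg]

theorem re_inner_le_of_generates (hΓ : IsNonposSelfAdjointGraph Γ)
    (hT : ∀ x k, (x, k) ∈ T.generatorGraph ↔ (x, -k) ∈ squareGraph Γ) :
    ∀ p ∈ T.generatorGraph, RCLike.re (inner 𝕜 p.1 p.2) ≤ 0 := by
  rintro ⟨x, k⟩ hp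
  have := hΓ.accretive_squareGraph _ ((hT x k).1 hp)
  simp only [inner_neg_right, map_neg] at this ⊢
  linarith

theorem dense_of_generates (hΓ : IsNonposSelfAdjointGraph Γ)
    (hT : ∀ x k, (x, k) ∈ T.generatorGraph ↔ (x, -k) ∈ squareGraph Γ) :
    Dense {x | ∃ k, (x, k) ∈ T.generatorGraph} := by
  refine hΓ.dense_squareGraph.mono ?_
  rintro x ⟨k, hk⟩
  exact ⟨-k, (hT x _).2 (by rwa [neg_neg])⟩

theorem IsNonposSelfAdjointGraph.existsUnique_semigroup (hΓ : IsNonposSelfAdjointGraph Γ) :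
    ∃! T : C0Semigroup 𝕜 H, ∀ x k, (x, k) ∈ T.generatorGraph ↔ (x, -k) ∈ squareGraph Γ := by
  obtain ⟨T, hT⟩ := exists_semigroup_of_maximal_accretive hΓ.accretive_squareGraph
    hΓ.maximal_squareGraph hΓ.dense_squareGraph
  refine ⟨T, hT, fun S hS => ?_⟩
  refine C0Semigroup.ext_of_generatorGraph ?_ (re_inner_le_of_generates hΓ hS)
    (dense_of_generates hΓ hS)
  ext ⟨x, k⟩
  rw [hT, hS]

theorem norm_op_le_of_generates (hΓ : IsNonposSelfAdjointGraph Γ)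
    (hT : ∀ x k, (x, k) ∈ T.generatorGraph ↔ (x, -k) ∈ squareGraph Γ) (t : ℝ≥0) (x : H) :
    ‖T.op t x‖ ≤ ‖x‖ :=
  T.norm_op_apply_le (re_inner_le_of_generates hΓ hT) (dense_of_generates hΓ hT) t x

theorem op_eq_self_of_mem (hΓ : IsNonposSelfAdjointGraph Γ)
    (hT : ∀ x k, (x, k) ∈ T.generatorGraph ↔ (x, -k) ∈ squareGraph Γ) {e : H}
    (he : (e, 0) ∈ Γ) (t : ℝ≥0) : T.op t e = e := by
  have h1 : (e, (0 : H)) ∈ T.generatorGraph := by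
    rw [hT, neg_zero]
    exact hΓ.mem_squareGraph_zero_iff.2 he
  have h2 := T.integral_orbit h1 t.2
  simp only [map_zero, intervalIntegral.integral_zero, NNReal.val_eq_coe, Real.toNNReal_coe] at h2
  exact (sub_eq_zero.1 h2.symm)

/-- The derivative T(s)k of an orbit lies in the range of L, hence is orthogonal to the kernel. With
e = 1 this is the invariance of μ. -/
theorem inner_op_eq (hΓ : IsNonposSelfAdjointGraph Γ)
    (hT : ∀ x k, (x, k) ∈ T.generatorGraph ↔ (x, -k) ∈ squareGraph Γ) {e : H}
    (he : (e, 0) ∈ Γ) (t : ℝ≥0) (f : H) : inner 𝕜 e (T.op t f) = inner 𝕜 e f := by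
  have hcl : IsClosed {f : H | inner 𝕜 e (T.op t f) = inner 𝕜 e f} :=
    isClosed_eq (continuous_const.inner (T.op t).continuous) (continuous_const.inner continuous_id)
  refine closure_minimal ?_ hcl (dense_of_generates hΓ hT f)
  rintro x ⟨k, hk⟩
  have hz : ∀ s : ℝ≥0, inner 𝕜 e (T.op s k) = 0 := fun s => by
    obtain ⟨z, h1, h2⟩ := (hT _ _).1 (T.op_mem_generatorGraph hk s)
    have := hΓ.symm _ he _ h2
    simpa using this
  have h2 := T.integral_orbit hk t.2
  have h3 := (innerSL 𝕜 e).intervalIntegral_comp_comm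
    ((T.continuous_orbit_real k).intervalIntegrable (μ := volume) 0 (t : ℝ))
  simp only [NNReal.val_eq_coe, Real.toNNReal_coe] at h2
  simp only [innerSL_apply_apply, hz, intervalIntegral.integral_zero, h2, inner_sub_right] at h3
  exact sub_eq_zero.1 h3.symm

/-- The mean ergodic theorem for the semigroup. -/
theorem tendsto_average_of_generates (hΓ : IsNonposSelfAdjointGraph Γ)
    (hT : ∀ x k, (x, k) ∈ T.generatorGraph ↔ (x, -k) ∈ squareGraph Γ) {f : H}
    (hf : ∀ e, (e, 0) ∈ Γ → inner 𝕜 e f = 0) :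
    Tendsto (fun t : ℝ => t⁻¹ • ∫ s in (0 : ℝ)..t, T.op s.toNNReal f) atTop (𝓝 0) := by
  -- A vector orthogonal to the kernel lies in the closure of the range of L². On the range itself
  -- the time average telescopes to (T(t)g - g)/t up to sign.
  have hcl : f ∈ closure ((squareGraph Γ).map (LinearMap.snd 𝕜 H H) : Set H) := by
    rw [← Submodule.topologicalClosure_coe, ← Submodule.orthogonal_orthogonal_eq_closure]
    refine (Submodule.mem_orthogonal _ _).2 fun e he => hf e ?_
    exact hΓ.mem_of_forall_inner_snd_eq_zero fun p hp =>
      (Submodule.mem_orthogonal _ _).1 he _ ⟨p, hp, rfl⟩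
  have hint : ∀ (y : H) (t : ℝ), IntervalIntegrable (fun s => T.op s.toNNReal y) volume 0 t :=
    fun y t => (T.continuous_orbit_real y).intervalIntegrable 0 t
  rw [Metric.tendsto_atTop]
  intro ε hε
  obtain ⟨_, ⟨⟨g, k⟩, hk, rfl⟩, hy⟩ := Metric.mem_closure_iff.1 hcl (ε / 2) (half_pos hε)
  have hg : (g, -k) ∈ T.generatorGraph := (hT _ _).2 (by rwa [neg_neg])
  refine ⟨4 * ‖g‖ / ε + 1, fun t ht => ?_⟩
  have ht0 : 0 < t := lt_of_lt_of_le (by positivity) ht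
  have e1 : ∫ s in (0 : ℝ)..t, T.op s.toNNReal f =
      (∫ s in (0 : ℝ)..t, T.op s.toNNReal (f - k)) - (T.op t.toNNReal g - g) := by
    rw [← T.integral_orbit hg ht0.le, ← intervalIntegral.integral_sub (hint _ _) (hint _ _)]
    simp only [← map_sub, sub_neg_eq_add, sub_add_cancel]
  have b1 : ‖∫ s in (0 : ℝ)..t, T.op s.toNNReal (f - k)‖ ≤ ε / 2 * t := by
    have := intervalIntegral.norm_integral_le_of_norm_le_const (a := 0) (b := t) (C := ε / 2)
      (f := fun s => T.op s.toNNReal (f - k)) fun s _ =>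
        (norm_op_le_of_generates hΓ hT _ _).trans (by rw [← dist_eq_norm]; exact hy.le)
    rwa [sub_zero, abs_of_pos ht0] at this
  have b2 : ‖T.op t.toNNReal g - g‖ ≤ 2 * ‖g‖ :=
    (norm_sub_le _ _).trans (by linarith [norm_op_le_of_generates hΓ hT t.toNNReal g])
  have b3 : 2 * ‖g‖ < ε / 2 * t := by
    have : 4 * ‖g‖ / ε < t := by linarith
    rw [div_lt_iff₀ hε] at this
    linarith
  rw [dist_zero_right, norm_smul, norm_inv, Real.norm_of_nonneg ht0.le, inv_mul_lt_iff₀ ht0, e1]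
  have := norm_sub_le (∫ s in (0 : ℝ)..t, T.op s.toNNReal (f - k)) (T.op t.toNNReal g - g)
  linarith

end Generation

/-! ### Classes of functions that agree in two `L²` spaces -/

section TwoMeasures

variable {N : ℕ} {𝕜 : Type*} [RCLike 𝕜] {μ ν : Measure (Sp N)}

/-- The pairs `(a, b) ∈ L²_μ × L²_ν` for which `a` and `b` are the same function `ν`-a.e. -/
def agreeGraph (𝕜 : Type*) [RCLike 𝕜] (hνμ : ν ≪ μ) : Submodule 𝕜 (Lp 𝕜 2 μ × Lp 𝕜 2 ν) where
  carrier := {p | p.1 =ᵐ[ν] p.2}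
  zero_mem' := (hνμ.ae_eq (Lp.coeFn_zero 𝕜 2 μ)).trans (Lp.coeFn_zero 𝕜 2 ν).symm
  add_mem' := fun {p q} (hp : p.1 =ᵐ[ν] p.2) (hq : q.1 =ᵐ[ν] q.2) =>
    (hνμ.ae_eq (Lp.coeFn_add p.1 q.1)).trans ((hp.add hq).trans (Lp.coeFn_add p.2 q.2).symm)
  smul_mem' := fun c p (hp : p.1 =ᵐ[ν] p.2) =>
    (hνμ.ae_eq (Lp.coeFn_smul c p.1)).trans ((hp.const_smul c).trans (Lp.coeFn_smul c p.2).symm)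

theorem mem_agreeGraph {hνμ : ν ≪ μ} {p : Lp 𝕜 2 μ × Lp 𝕜 2 ν} :
    p ∈ agreeGraph 𝕜 hνμ ↔ p.1 =ᵐ[ν] p.2 := Iff.rfl

/-- L² convergence gives a.e. convergence along a subsequence, extracted once for each component; ν
≪ μ turns the first into ν-a.e. convergence. -/
theorem isClosed_agreeGraph (hνμ : ν ≪ μ) :
    IsClosed (agreeGraph 𝕜 hνμ : Set (Lp 𝕜 2 μ × Lp 𝕜 2 ν)) := by
  refine isClosed_of_closure_subset fun p hp => ?_
  obtain ⟨q, hq, hlim⟩ := mem_closure_iff_seq_limit.1 hp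
  obtain ⟨a, ha, ha'⟩ := (tendstoInMeasure_of_tendsto_Lp
    ((continuous_fst.tendsto p).comp hlim)).exists_seq_tendsto_ae
  obtain ⟨b, hb, hb'⟩ := (tendstoInMeasure_of_tendsto_Lp
    (((continuous_snd.tendsto p).comp hlim).comp ha.tendsto_atTop)).exists_seq_tendsto_ae
  have hall : ∀ᵐ x ∂ν, ∀ n, (q n).1 x = (q n).2 x := ae_all_iff.2 fun n => hq n
  change p.1 =ᵐ[ν] p.2
  filter_upwards [hνμ.ae_le ha', hb', hall] with x h1 h2 h3
  refine tendsto_nhds_unique (h1.comp hb.tendsto_atTop) (h2.congr fun n => ?_)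
  exact (h3 _).symm

/-- The common function lies in L² of μ + ν, where bounded continuous functions are dense, so one
sequence approximates it in both spaces. -/
theorem exists_boundedContinuous_tendsto [IsFiniteMeasure μ] [IsFiniteMeasure ν]
    {hνμ : ν ≪ μ} {p : Lp 𝕜 2 μ × Lp 𝕜 2 ν} (hp : p ∈ agreeGraph 𝕜 hνμ) :
    ∃ f : ℕ → Sp N →ᵇ 𝕜,
      Tendsto (fun n => BoundedContinuousFunction.toLp (E := 𝕜) 2 μ 𝕜 (f n)) atTop (𝓝 p.1) ∧
      Tendsto (fun n => BoundedContinuousFunction.toLp (E := 𝕜) 2 ν 𝕜 (f n)) atTop (𝓝 p.2) := by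
  have hmem : MemLp p.1 2 (μ + ν) := by
    refine ⟨(Lp.stronglyMeasurable p.1).aestronglyMeasurable, ?_⟩
    have h1 : MemLp p.1 2 ν := (Lp.memLp p.2).ae_eq (mem_agreeGraph.1 hp).symm
    have h2 := Lp.memLp p.1
    rw [eLpNorm_lt_top_iff_lintegral_rpow_enorm_lt_top (by norm_num) (by norm_num),
      lintegral_add_measure]
    exact ENNReal.add_lt_top.2 ⟨lintegral_rpow_enorm_lt_top_of_eLpNorm_lt_top (by norm_num)
      (by norm_num) h2.2, lintegral_rpow_enorm_lt_top_of_eLpNorm_lt_top (by norm_num)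
      (by norm_num) h1.2⟩
  have hex : ∀ n : ℕ, ∃ g : Sp N →ᵇ 𝕜,
      eLpNorm (⇑p.1 - ⇑g) 2 (μ + ν) ≤ ((n : ℝ≥0∞) + 1)⁻¹ ∧ MemLp g 2 (μ + ν) := fun n =>
    hmem.exists_boundedContinuous_eLpNorm_sub_le (by norm_num) (by simp)
  choose f hf _ using hex
  have hz : Tendsto (fun n : ℕ => ((n : ℝ≥0∞) + 1)⁻¹) atTop (𝓝 0) := by
    have := (tendsto_add_atTop_iff_nat 1).2 ENNReal.tendsto_inv_nat_nhds_zero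
    simpa using this
  refine ⟨f, ?_, ?_⟩
  · rw [Lp.tendsto_Lp_iff_tendsto_eLpNorm']
    refine tendsto_of_tendsto_of_tendsto_of_le_of_le tendsto_const_nhds hz
      (fun _ => zero_le) fun n => ?_
    have e : eLpNorm (⇑(BoundedContinuousFunction.toLp (E := 𝕜) 2 μ 𝕜 (f n)) - ⇑p.1) 2 μ =
        eLpNorm (⇑p.1 - ⇑(f n)) 2 μ := by
      rw [eLpNorm_sub_comm]
      exact eLpNorm_congr_ae
        (EventuallyEq.rfl.sub (BoundedContinuousFunction.coeFn_toLp 2 μ 𝕜 (f n)))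
    exact e.trans_le ((eLpNorm_mono_measure _ (Measure.le_add_right le_rfl)).trans (hf n))
  · rw [Lp.tendsto_Lp_iff_tendsto_eLpNorm']
    refine tendsto_of_tendsto_of_tendsto_of_le_of_le tendsto_const_nhds hz
      (fun _ => zero_le) fun n => ?_
    have e : eLpNorm (⇑(BoundedContinuousFunction.toLp (E := 𝕜) 2 ν 𝕜 (f n)) - ⇑p.2) 2 ν =
        eLpNorm (⇑p.1 - ⇑(f n)) 2 ν := by
      rw [eLpNorm_sub_comm]
      exact eLpNorm_congr_ae
        ((mem_agreeGraph.1 hp).symm.sub (BoundedContinuousFunction.coeFn_toLp 2 ν 𝕜 (f n)))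
    exact e.trans_le ((eLpNorm_mono_measure _ (Measure.le_add_left le_rfl)).trans (hf n))

theorem integral_eq_inner_const {ν : Measure (Sp N)} [IsFiniteMeasure ν] (f : Lp 𝕜 2 ν) :
    ∫ x, f x ∂ν = inner 𝕜 (Lp.const 2 ν (1 : 𝕜)) f := by
  rw [L2.inner_def]
  refine integral_congr_ae ?_
  filter_upwards [Lp.coeFn_const 2 ν (1 : 𝕜)] with x hx
  rw [hx]
  simp

theorem integral_bddContToL2 {ν : Measure (Sp N)} [IsProbabilityMeasure ν] (f : Sp N →ᵇ 𝕜) :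
    ∫ x, bddContToL2 ν f x ∂ν = ∫ x, f x ∂ν :=
  integral_congr_ae (BoundedContinuousFunction.coeFn_toLp 2 ν 𝕜 f)

theorem IsInvariantMeasure.integral_op [IsProbabilityMeasure ν] {S : C0Semigroup 𝕜 (Lp 𝕜 2 ν)}
    (hS : IsInvariantMeasure ν S) (t : ℝ≥0) (b : Lp 𝕜 2 ν) :
    ∫ x, S.op t b x ∂ν = ∫ x, b x ∂ν := by
  rw [integral_eq_inner_const, integral_eq_inner_const]
  have hcl : IsClosed {b : Lp 𝕜 2 ν | inner 𝕜 (Lp.const 2 ν (1 : 𝕜)) (S.op t b) =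
      inner 𝕜 (Lp.const 2 ν (1 : 𝕜)) b} :=
    isClosed_eq (continuous_const.inner (S.op t).continuous) (continuous_const.inner continuous_id)
  refine closure_minimal ?_ hcl
    ((BoundedContinuousFunction.toLp_denseRange 𝕜 ν 𝕜 (p := 2) (by norm_num)) b)
  rintro _ ⟨f, rfl⟩
  have := hS f t
  rw [← integral_bddContToL2, integral_eq_inner_const, integral_eq_inner_const] at this
  exact this

/-! ### The action of one semigroup on two L² spaces -/

section ActsAs

variable [IsProbabilityMeasure μ] [IsProbabilityMeasure ν] {T : C0Semigroup 𝕜 (Lp 𝕜 2 μ)}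
  {S : C0Semigroup 𝕜 (Lp 𝕜 2 ν)}

/-- The indicator of a μ-null set represents T(0)0, hence also S(0)0 = 0, so the set is ν-null. -/
theorem ActsAs.absolutelyContinuous (hTS : ActsAs μ T ν S) : ν ≪ μ := by
  intro s hs
  have h0 : ∀ (ρ : Measure (Sp N)) [IsProbabilityMeasure ρ] (U : C0Semigroup 𝕜 (Lp 𝕜 2 ρ)),
      U.op 0 (bddContToL2 ρ 0) =ᵐ[ρ] fun _ => (0 : 𝕜) := fun ρ _ U => by
    have : bddContToL2 (𝕜 := 𝕜) ρ 0 = 0 := map_zero _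
    rw [this, map_zero]
    exact Lp.coeFn_zero _ _ _
  have h1 : s.indicator (fun _ => (1 : 𝕜)) =ᵐ[μ] T.op 0 (bddContToL2 μ 0) :=
    (indicator_meas_zero hs).trans (h0 μ T).symm
  have h2 := (hTS 0 0 _ h1).trans (h0 ν S)
  refine measure_mono_null (fun x hx => ?_) (ae_iff.1 h2)
  simp [hx]

theorem ActsAs.op_mem (hTS : ActsAs μ T ν S) {hνμ : ν ≪ μ} {p : Lp 𝕜 2 μ × Lp 𝕜 2 ν}
    (hp : p ∈ agreeGraph 𝕜 hνμ) (t : ℝ≥0) : (T.op t p.1, S.op t p.2) ∈ agreeGraph 𝕜 hνμ := by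
  obtain ⟨f, h1, h2⟩ := exists_boundedContinuous_tendsto hp
  refine (isClosed_agreeGraph hνμ).mem_of_tendsto
    ((((T.op t).continuous.tendsto _).comp h1).prodMk_nhds
      (((S.op t).continuous.tendsto _).comp h2)) (Eventually.of_forall fun n => ?_)
  exact hTS (f n) t _ EventuallyEq.rfl

/-- The mean of a function with values in a closed convex set stays in the set. -/
theorem Submodule.setIntegral_mem {X : Type*} [NormedAddCommGroup X] [NormedSpace 𝕜 X]
    [NormedSpace ℝ X] [IsScalarTower ℝ 𝕜 X] [CompleteSpace X] {R : Submodule 𝕜 X}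
    (hR : IsClosed (R : Set X)) {F : ℝ → X} (hF : Continuous F) (hmem : ∀ s, F s ∈ R) {t : ℝ}
    (ht : 0 < t) : ∫ s in (0 : ℝ)..t, F s ∈ R := by
  have hconv : Convex ℝ (R : Set X) := (R.restrictScalars ℝ).convex
  have h1 := hconv.set_average_mem hR (μ := volume) (t := Set.Ioc 0 t) (f := F) (by simp [ht])
    (by simp) (Eventually.of_forall hmem) (hF.integrableOn_Ioc)
  rw [intervalIntegral.integral_of_le ht.le]
  rw [setAverage_eq] at h1
  have h2 := (R.restrictScalars ℝ).smul_mem (volume.real (Set.Ioc 0 t)) h1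
  rwa [smul_smul, mul_inv_cancel₀ (by simp [ht.le, ht.ne']), one_smul] at h2

/-- An invariant measure annihilates the generator. -/
theorem ActsAs.integral_generator_eq_zero (hTS : ActsAs μ T ν S) (hS : IsInvariantMeasure ν S)
    {hνμ : ν ≪ μ} {x y : Lp 𝕜 2 μ} {x' y' : Lp 𝕜 2 ν} (hxy : (x, y) ∈ T.generatorGraph)
    (hx : (x, x') ∈ agreeGraph 𝕜 hνμ) (hy : (y, y') ∈ agreeGraph 𝕜 hνμ) :
    ∫ s, y' s ∂ν = 0 := by
  have hcT := T.continuous_orbit_real y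
  have hcS := S.continuous_orbit_real y'
  have h1 := T.integral_orbit hxy (t := 1) zero_le_one
  have hmem := Submodule.setIntegral_mem (isClosed_agreeGraph hνμ)
    (hcT.prodMk hcS) (fun s => hTS.op_mem hy s.toNNReal) one_pos
  have e : ∫ s in (0 : ℝ)..1, ((T.op s.toNNReal y, S.op s.toNNReal y') : Lp 𝕜 2 μ × Lp 𝕜 2 ν) =
      (T.op (1 : ℝ).toNNReal x - x, ∫ s in (0 : ℝ)..1, S.op s.toNNReal y') := by
    refine Prod.ext ?_ ?_
    · have := (ContinuousLinearMap.fst 𝕜 (Lp 𝕜 2 μ) (Lp 𝕜 2 ν)).intervalIntegral_comp_comm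
        ((hcT.prodMk hcS).intervalIntegrable (μ := volume) 0 1)
      exact this.symm.trans h1
    · exact ((ContinuousLinearMap.snd 𝕜 (Lp 𝕜 2 μ) (Lp 𝕜 2 ν)).intervalIntegral_comp_comm
        ((hcT.prodMk hcS).intervalIntegrable (μ := volume) 0 1)).symm
  rw [e] at hmem
  have hmem' := Submodule.sub_mem _ (hTS.op_mem hx (1 : ℝ).toNNReal) hx
  -- The second component of the integral agrees ν-a.e. with T(1)x - x, hence is S(1)x' - x', whose
  -- ν-integral is 0 by invariance. By invariance again, the orbit of y' has constant ν-integral ∫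
  -- y' dν, so this constant is 0.
  have e2 : S.op (1 : ℝ).toNNReal x' - x' = ∫ s in (0 : ℝ)..1, S.op s.toNNReal y' :=
    Lp.ext ((mem_agreeGraph.1 hmem').symm.trans (mem_agreeGraph.1 hmem))
  have h3 := (innerSL 𝕜 (Lp.const 2 ν (1 : 𝕜))).intervalIntegral_comp_comm
    (hcS.intervalIntegrable (μ := volume) 0 1)
  rw [← e2, map_sub] at h3
  simp only [innerSL_apply_apply, ← integral_eq_inner_const, hS.integral_op, sub_self] at h3
  simpa using h3

end ActsAs

end TwoMeasures

/-! ### Ergodicity and uniqueness of the invariant measure -/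

section Ergodicity

variable {N : ℕ} {m : Sp N → ℝ} {G : Sp N → Sp N} {𝕜 : Type*} [RCLike 𝕜]

theorem HypothesisH1.biKolmogorov_graph (hN : 1 ≤ N) (h : HypothesisH1 m G) :
    (biKolmogorov 𝕜 (densityMeasure m) m G).graph =
      squareGraph (kolmogorovGraph 𝕜 (densityMeasure m) m G).topologicalClosure := by
  have hΓ := h.isNonposSelfAdjointGraph (𝕜 := 𝕜) hN
  have hg : (kolmogorov 𝕜 (densityMeasure m) m G).graph = _ := toLinearPMap_closure_graph hΓ
  rw [biKolmogorov, squareFormOperator_graph (by rwa [hg]), hg]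

theorem HypothesisH1.mem_closure_zero_iff (hN : 1 ≤ N) (h : HypothesisH1 m G)
    [IsFiniteMeasure (densityMeasure m)] {f : Lp 𝕜 2 (densityMeasure m)} :
    (f, 0) ∈ (kolmogorovGraph 𝕜 (densityMeasure m) m G).topologicalClosure ↔
      ∃ c : 𝕜, f =ᵐ[densityMeasure m] fun _ => c := by
  refine ⟨h.ae_const_of_mem hN, ?_⟩
  rintro ⟨c, hc⟩
  have e : f = c • Lp.const 2 (densityMeasure m) (1 : 𝕜) := by
    refine Lp.ext ?_
    filter_upwards [hc, Lp.coeFn_smul c (Lp.const 2 (densityMeasure m) (1 : 𝕜)),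
      Lp.coeFn_const 2 (densityMeasure m) (1 : 𝕜)] with x h1 h2 h3
    rw [h1, h2, Pi.smul_apply, h3]
    simp
  have := Submodule.smul_mem _ c (h.const_mem_closure (𝕜 := 𝕜) hN)
  rw [Prod.smul_mk, smul_zero] at this
  rwa [e]

theorem inner_sub_const_integral {ν : Measure (Sp N)} [IsProbabilityMeasure ν] (f : Lp 𝕜 2 ν)
    {e : Lp 𝕜 2 ν} {c : 𝕜} (he : e =ᵐ[ν] fun _ => c) :
    inner 𝕜 e (f - Lp.const 2 ν (∫ x, f x ∂ν)) = 0 := by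
  have e1 : ∀ g : Lp 𝕜 2 ν, inner 𝕜 e g = (∫ x, g x ∂ν) * (starRingEnd 𝕜) c := fun g => by
    rw [L2.inner_def, ← integral_mul_const]
    refine integral_congr_ae ?_
    filter_upwards [he] with x hx
    rw [hx, RCLike.inner_apply]
  rw [inner_sub_right, e1, e1, integral_congr_ae (Lp.coeFn_const 2 ν (∫ x, f x ∂ν))]
  simp

theorem HypothesisH1.tendsto_average (hN : 1 ≤ N) (h : HypothesisH1 m G)
    [IsProbabilityMeasure (densityMeasure m)] {T : C0Semigroup 𝕜 (Lp 𝕜 2 (densityMeasure m))}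
    (hT : ∀ x k, (x, k) ∈ T.generatorGraph ↔
      (x, -k) ∈ squareGraph (kolmogorovGraph 𝕜 (densityMeasure m) m G).topologicalClosure)
    (f : Lp 𝕜 2 (densityMeasure m)) :
    Tendsto (fun t : ℝ => (t⁻¹ : ℝ) • ∫ s in (0 : ℝ)..t, T.op s.toNNReal f) atTop
      (𝓝 (Lp.const 2 (densityMeasure m) (∫ x, f x ∂densityMeasure m))) := by
  have hΓ := h.isNonposSelfAdjointGraph (𝕜 := 𝕜) hN
  set c := Lp.const 2 (densityMeasure m) (∫ x, f x ∂densityMeasure m) with hc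
  have hcmem : (c, 0) ∈ (kolmogorovGraph 𝕜 (densityMeasure m) m G).topologicalClosure :=
    (h.mem_closure_zero_iff hN).2 ⟨_, Lp.coeFn_const _ _ _⟩
  have hlim := tendsto_average_of_generates hΓ hT (f := f - c) fun e he => by
    obtain ⟨d, hd⟩ := (h.mem_closure_zero_iff hN).1 he
    exact inner_sub_const_integral f hd
  have hlim' := hlim.const_add c
  rw [add_zero] at hlim'
  refine hlim'.congr' ?_
  filter_upwards [eventually_gt_atTop 0] with t ht
  have hint : ∀ y : Lp 𝕜 2 (densityMeasure m),
      IntervalIntegrable (fun s : ℝ => T.op s.toNNReal y) volume 0 t :=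
    fun y => (T.continuous_orbit_real y).intervalIntegrable 0 t
  simp only [map_sub]
  rw [intervalIntegral.integral_sub (hint f) (hint c)]
  simp only [op_eq_self_of_mem hΓ hT hcmem]
  rw [intervalIntegral.integral_const, sub_zero, smul_sub, smul_smul, inv_mul_cancel₀ ht.ne',
    one_smul]
  abel

/-- An arithmetic progression that stays bounded is constant. -/
theorem eq_of_second_difference_eq_zero {F : ℕ → 𝕜} {C : ℝ} (hb : ∀ n, ‖F n‖ ≤ C)
    (hF : ∀ n, F (n + 2) - F (n + 1) - (F (n + 1) - F n) = 0) (n : ℕ) : F n = F 0 := by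
  have h1 : ∀ n, F (n + 1) - F n = F 1 - F 0 := fun n => by
    induction n with
    | zero => rfl
    | succ k ih => rw [← ih]; exact sub_eq_zero.1 (hF k)
  have h2 : ∀ n : ℕ, F n = F 0 + n * (F 1 - F 0) := fun n => by
    induction n with
    | zero => simp
    | succ k ih =>
      rw [← sub_add_cancel (F (k + 1)) (F k), h1, ih]
      push_cast
      ring
  have h3 : F 1 - F 0 = 0 := by
    by_contra hne
    have hpos : 0 < ‖F 1 - F 0‖ := norm_pos_iff.2 hne
    obtain ⟨k, hk⟩ := exists_nat_gt (2 * C / ‖F 1 - F 0‖)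
    rw [div_lt_iff₀ hpos] at hk
    have e : ‖(k : 𝕜) * (F 1 - F 0)‖ = k * ‖F 1 - F 0‖ := by
      rw [norm_mul, RCLike.norm_natCast]
    have := norm_sub_le (F k) (F 0)
    rw [h2 k, add_sub_cancel_left, e, ← h2 k] at this
    linarith [hb k, hb 0]
  rw [h2, h3, mul_zero, add_zero]

/-- The resolvent preserves bounds on real and imaginary parts separately; the factor 2 recombines
them, and does not depend on n. -/
theorem HypothesisH1.ae_norm_resolvent_iterate_le (hN : 1 ≤ N) (h : HypothesisH1 m G)
    [IsFiniteMeasure (densityMeasure m)]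
    {J : Lp 𝕜 2 (densityMeasure m) →L[𝕜] Lp 𝕜 2 (densityMeasure m)}
    (hJ : ∀ f, (J f, J f - f) ∈ (kolmogorovGraph 𝕜 (densityMeasure m) m G).topologicalClosure)
    {f : Lp 𝕜 2 (densityMeasure m)} {c : ℝ} (hf : ∀ᵐ x ∂densityMeasure m, ‖f x‖ ≤ c) (n : ℕ) :
    ∀ᵐ x ∂densityMeasure m, ‖(J^[n] f) x‖ ≤ 2 * |c| := by
  have key : ∀ l : 𝕜 →L[ℝ] ℝ, (∀ z, |l z| ≤ ‖z‖) → ∀ n : ℕ,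
      ∀ᵐ x ∂densityMeasure m, |l ((J^[n] f) x)| ≤ |c| := fun l hl n => by
    induction n with
    | zero =>
      filter_upwards [hf] with x hx
      exact (hl _).trans (hx.trans (le_abs_self c))
    | succ k ih =>
      rw [Function.iterate_succ_apply']
      refine h.ae_abs_le_of_mem hN (hJ _) l (abs_nonneg c) ?_
      filter_upwards [ih, Lp.coeFn_sub (J (J^[k] f)) (J^[k] f)] with x h1 h2
      rwa [h2, Pi.sub_apply, map_sub, sub_sub_cancel]
  filter_upwards [key RCLike.reCLM RCLike.abs_re_le_norm n,
    key RCLike.imCLM RCLike.abs_im_le_norm n] with x h1 h2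
  have h3 := RCLike.norm_sq_eq_def (z := (J^[n] f) x)
  simp only [RCLike.reCLM_apply, RCLike.imCLM_apply] at h1 h2
  refine abs_le_of_sq_le_sq' ?_ (by positivity) |>.2
  rw [h3]
  nlinarith [sq_abs (RCLike.re ((J^[n] f) x)), sq_abs (RCLike.im ((J^[n] f) x)),
    abs_nonneg (RCLike.re ((J^[n] f) x)), abs_nonneg (RCLike.im ((J^[n] f) x)), abs_nonneg c]

/-- An invariant measure on which the semigroup acts integrates bounded functions as `μ` does. -/
theorem HypothesisH1.integral_eq_of_invariant (hN : 1 ≤ N) (h : HypothesisH1 m G)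
    [IsProbabilityMeasure (densityMeasure m)] {T : C0Semigroup 𝕜 (Lp 𝕜 2 (densityMeasure m))}
    (hT : ∀ x k, (x, k) ∈ T.generatorGraph ↔
      (x, -k) ∈ squareGraph (kolmogorovGraph 𝕜 (densityMeasure m) m G).topologicalClosure)
    {ν : Measure (Sp N)} [IsProbabilityMeasure ν] {S : C0Semigroup 𝕜 (Lp 𝕜 2 ν)}
    (hTS : ActsAs (densityMeasure m) T ν S) (hS : IsInvariantMeasure ν S)
    {f : Lp 𝕜 2 (densityMeasure m)} {c : ℝ} (hf : ∀ᵐ x ∂densityMeasure m, ‖f x‖ ≤ c) :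
    ∫ x, f x ∂ν = ∫ x, f x ∂densityMeasure m := by
  have hΓ := h.isNonposSelfAdjointGraph (𝕜 := 𝕜) hN
  have hνμ := hTS.absolutelyContinuous
  obtain ⟨J, hJ1, hJ, hJ2⟩ := hΓ.exists_resolvent
  have hbd := h.ae_norm_resolvent_iterate_le hN hJ hf
  have hmem : ∀ n, MemLp (J^[n] f) 2 ν := fun n =>
    MemLp.of_bound (Lp.stronglyMeasurable _).aestronglyMeasurable _ (hνμ.ae_le (hbd n))
  set b : ℕ → Lp 𝕜 2 ν := fun n => (hmem n).toLp _
  have hb : ∀ n, (J^[n] f, b n) ∈ agreeGraph 𝕜 hνμ := fun n => (hmem n).coeFn_toLp.symm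
  have hF : ∀ n, ∫ x, (J^[n] f) x ∂ν = inner 𝕜 (Lp.const 2 ν (1 : 𝕜)) (b n) := fun n => by
    rw [← integral_eq_inner_const]
    exact integral_congr_ae (mem_agreeGraph.1 (hb n))
  have hconst : ∀ n, ∫ x, (J^[n] f) x ∂ν = ∫ x, f x ∂ν := by
    refine eq_of_second_difference_eq_zero (F := fun n => ∫ x, (J^[n] f) x ∂ν) (C := 2 * |c|)
      (fun n => ?_) fun n => ?_
    · simpa using norm_integral_le_of_norm_le_const (hνμ.ae_le (hbd n))
    -- J^(n+2) f lies in the domain of A with A J^(n+2) f = (J - 1)² J^n f, and invariance of ν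
    -- annihilates this second difference.
    · have hgen : (J^[n + 2] f, -(J^[n + 2] f - J^[n + 1] f - (J^[n + 1] f - J^[n] f))) ∈
          T.generatorGraph := by
        rw [hT, neg_neg, Function.iterate_succ_apply', Function.iterate_succ_apply']
        exact IsNonposSelfAdjointGraph.resolvent_sq_mem_squareGraph hJ _
      have hy := Submodule.neg_mem _ (Submodule.sub_mem _ (Submodule.sub_mem _ (hb (n + 2))
        (hb (n + 1))) (Submodule.sub_mem _ (hb (n + 1)) (hb n)))
      have := hTS.integral_generator_eq_zero hS hgen (hb (n + 2)) hy
      rw [integral_eq_inner_const, inner_neg_right, neg_eq_zero] at this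
      simp only [hF, ← inner_sub_right]
      exact this
  -- Von Neumann's mean ergodic theorem for the contraction J: the averages tend to the projection
  -- on the fixed vectors, which are the constants.
  set A : ℕ → Lp 𝕜 2 (densityMeasure m) := fun n => birkhoffAverage 𝕜 J id n f with hA
  have hAlim : Tendsto A atTop
      (𝓝 (Lp.const 2 (densityMeasure m) (∫ x, f x ∂densityMeasure m))) := by
    have h1 := J.tendsto_birkhoffAverage_orthogonalProjection
      (J.opNorm_le_bound zero_le_one fun x => by rw [one_mul]; exact hJ1 x) f
    refine h1.trans_eq ?_
    congr 1
    refine Submodule.eq_starProjection_of_mem_of_inner_eq_zero ?_ fun w hw => ?_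
    · have := hJ2 _ _ ((h.mem_closure_zero_iff (𝕜 := 𝕜) hN).2
        ⟨∫ x, f x ∂densityMeasure m, Lp.coeFn_const 2 (densityMeasure m) _⟩)
      rw [sub_zero] at this
      exact this
    · obtain ⟨d, hd⟩ := (h.mem_closure_zero_iff hN).1
        (IsNonposSelfAdjointGraph.mem_of_resolvent_eq hJ (show J w = w from hw))
      rw [← inner_conj_symm, inner_sub_const_integral f hd, map_zero]
  have hsum : ∀ n, ∀ᵐ x ∂densityMeasure m, ‖(birkhoffSum J id n f) x‖ ≤ n * (2 * |c|) := fun n => by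
    induction n with
    | zero =>
      filter_upwards [Lp.coeFn_zero 𝕜 2 (densityMeasure m)] with x hx
      rw [birkhoffSum_zero, hx]
      simp
    | succ k ih =>
      rw [birkhoffSum_succ]
      filter_upwards [ih, hbd k, Lp.coeFn_add (birkhoffSum J id k f) (J^[k] f)] with x h1 h2 h3
      rw [id, h3, Pi.add_apply]
      refine (norm_add_le _ _).trans ?_
      push_cast
      linarith
  have hAbd : ∀ n, ∀ᵐ x ∂densityMeasure m, ‖A n x‖ ≤ 2 * |c| := fun n => by
    filter_upwards [hsum n, Lp.coeFn_smul ((n : 𝕜)⁻¹) (birkhoffSum J id n f)] with x h1 h2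
    rw [hA]
    simp only [birkhoffAverage]
    rw [h2, Pi.smul_apply, norm_smul, norm_inv, RCLike.norm_natCast]
    rcases Nat.eq_zero_or_pos n with rfl | hn
    · simp
    · rw [inv_mul_le_iff₀ (by positivity)]
      exact h1
  -- For n = 0 the average is 0 by convention, hence the restriction.
  have hAint : ∀ n, 0 < n → ∫ x, A n x ∂ν = ∫ x, f x ∂ν := fun n hn => by
    have hmemA : (A n, (n : 𝕜)⁻¹ • ∑ k ∈ Finset.range n, b k) ∈ agreeGraph 𝕜 hνμ := by
      have := Submodule.smul_mem _ ((n : 𝕜)⁻¹)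
        (Submodule.sum_mem (agreeGraph 𝕜 hνμ) fun k (_ : k ∈ Finset.range n) => hb k)
      convert this using 1
      rw [Prod.ext_iff]
      simp [hA, birkhoffAverage, birkhoffSum, Prod.fst_sum, Prod.snd_sum]
    rw [integral_congr_ae (mem_agreeGraph.1 hmemA), integral_eq_inner_const, inner_smul_right,
      inner_sum]
    simp only [← hF, hconst, Finset.sum_const, Finset.card_range, nsmul_eq_mul]
    rw [inv_mul_cancel_left₀ (by exact_mod_cast hn.ne')]
  -- Convergence in L²_μ says nothing directly about ν; a.e. convergence along a subsequence does,
  -- because ν ≪ μ, and the averages are uniformly bounded.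
  obtain ⟨ns, hns, hae⟩ := (tendstoInMeasure_of_tendsto_Lp hAlim).exists_seq_tendsto_ae
  have hdom : Tendsto (fun i => ∫ x, A (ns i) x ∂ν) atTop
      (𝓝 (∫ _, (∫ x, f x ∂densityMeasure m) ∂ν)) := by
    refine tendsto_integral_of_dominated_convergence (fun _ => 2 * |c|)
      (fun i => (Lp.stronglyMeasurable _).aestronglyMeasurable) (integrable_const _)
      (fun i => hνμ.ae_le (hAbd (ns i))) (hνμ.ae_le ?_)
    filter_upwards [hae, Lp.coeFn_const 2 (densityMeasure m) (∫ x, f x ∂densityMeasure m)]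
      with x h1 h2
    rwa [h2] at h1
  rw [integral_const, probReal_univ, one_smul] at hdom
  refine tendsto_nhds_unique (tendsto_const_nhds.congr' ?_) hdom
  filter_upwards [eventually_gt_atTop 0] with i hi
  exact (hAint _ (hi.trans_le hns.le_apply)).symm

theorem HypothesisH1.eq_of_invariant (hN : 1 ≤ N) (h : HypothesisH1 m G)
    [IsProbabilityMeasure (densityMeasure m)] {T : C0Semigroup 𝕜 (Lp 𝕜 2 (densityMeasure m))}
    (hT : ∀ x k, (x, k) ∈ T.generatorGraph ↔
      (x, -k) ∈ squareGraph (kolmogorovGraph 𝕜 (densityMeasure m) m G).topologicalClosure)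
    {ν : Measure (Sp N)} [IsProbabilityMeasure ν] {S : C0Semigroup 𝕜 (Lp 𝕜 2 ν)}
    (hTS : ActsAs (densityMeasure m) T ν S) (hS : IsInvariantMeasure ν S) :
    ν = densityMeasure m := by
  refine Measure.ext fun s hs => ?_
  have hcoe : (indicatorConstLp 2 hs (measure_ne_top (densityMeasure m) s) (1 : 𝕜)) =ᵐ[_]
    s.indicator fun _ => (1 : 𝕜) := indicatorConstLp_coeFn
  have e := h.integral_eq_of_invariant hN hT hTS hS
    (f := indicatorConstLp 2 hs (measure_ne_top (densityMeasure m) s) (1 : 𝕜)) (c := 1) <| by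
      filter_upwards [hcoe] with x hx
      rw [hx]
      exact (norm_indicator_le_norm_self _ _).trans (by simp)
  rw [integral_congr_ae (hTS.absolutelyContinuous.ae_eq hcoe), integral_congr_ae hcoe,
    integral_indicator_const _ hs, integral_indicator_const _ hs] at e
  have e' : ν.real s = (densityMeasure m).real s := by
    simpa [RCLike.real_smul_eq_coe_mul] using e
  exact (ENNReal.toReal_eq_toReal_iff' (measure_ne_top _ _) (measure_ne_top _ _)).1 e'

end Ergodicity

end BiKolmogorov

/-! ### Generation, kernel, ergodicity and uniqueness of the invariant measure -/

theorem mainTheorem8 {𝕜 : Type*} [RCLike 𝕜] {N : ℕ} (hN : 1 ≤ N)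
    (m : EuclideanSpace ℝ (Fin N) → ℝ)
    (G : EuclideanSpace ℝ (Fin N) → EuclideanSpace ℝ (Fin N))
    (μ : Measure (EuclideanSpace ℝ (Fin N))) [IsProbabilityMeasure μ]
    (hm : ∀ᵐ x, 0 ≤ m x)
    (hμ : μ = volume.withDensity (fun x => ENNReal.ofReal (m x)))
    (hH1 : BiKolmogorov.HypothesisH1 m G) :
    (∃! T : BiKolmogorov.C0Semigroup 𝕜 (Lp 𝕜 2 μ),
      T.generator = -BiKolmogorov.biKolmogorov 𝕜 μ m G) ∧
    (∃ u : (BiKolmogorov.biKolmogorov 𝕜 μ m G).domain,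
      (u : Lp 𝕜 2 μ) ≠ 0 ∧ BiKolmogorov.biKolmogorov 𝕜 μ m G u = 0) ∧
    (∀ f : Lp 𝕜 2 μ,
      (∃ u : (BiKolmogorov.biKolmogorov 𝕜 μ m G).domain,
        (u : Lp 𝕜 2 μ) = f ∧ BiKolmogorov.biKolmogorov 𝕜 μ m G u = 0) ↔
      ∃ c : 𝕜, f =ᵐ[μ] fun _ => c) ∧
    ∀ T : BiKolmogorov.C0Semigroup 𝕜 (Lp 𝕜 2 μ),
      T.generator = -BiKolmogorov.biKolmogorov 𝕜 μ m G →
      BiKolmogorov.IsInvariantMeasure μ T ∧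
      (∀ f : Lp 𝕜 2 μ,
        Tendsto (fun t : ℝ => (t⁻¹ : ℝ) • ∫ s in (0 : ℝ)..t, T.op s.toNNReal f) atTop
          (𝓝 (Lp.const 2 μ (∫ x, f x ∂μ)))) ∧
      (∀ (ν : Measure (EuclideanSpace ℝ (Fin N))) [IsProbabilityMeasure ν]
        (S : BiKolmogorov.C0Semigroup 𝕜 (Lp 𝕜 2 ν)),
        BiKolmogorov.ActsAs μ T ν S → BiKolmogorov.IsInvariantMeasure ν S → ν = μ) := by
  change μ = BiKolmogorov.densityMeasure m at hμ
  subst hμ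
  have hΓ := hH1.isNonposSelfAdjointGraph (𝕜 := 𝕜) hN
  have hgen : ∀ T : BiKolmogorov.C0Semigroup 𝕜 (Lp 𝕜 2 (BiKolmogorov.densityMeasure m)),
      T.generator = -BiKolmogorov.biKolmogorov 𝕜 (BiKolmogorov.densityMeasure m) m G ↔ _ :=
    fun T => BiKolmogorov.C0Semigroup.generator_eq_neg_iff
  simp only [hH1.biKolmogorov_graph hN] at hgen
  have hker : ∀ f : Lp 𝕜 2 (BiKolmogorov.densityMeasure m),
      (∃ u : (BiKolmogorov.biKolmogorov 𝕜 (BiKolmogorov.densityMeasure m) m G).domain,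
        (u : Lp 𝕜 2 (BiKolmogorov.densityMeasure m)) = f ∧
          BiKolmogorov.biKolmogorov 𝕜 (BiKolmogorov.densityMeasure m) m G u = 0) ↔
      ∃ c : 𝕜, f =ᵐ[BiKolmogorov.densityMeasure m] fun _ => c := fun f => by
    rw [← hH1.mem_closure_zero_iff hN, ← hΓ.mem_squareGraph_zero_iff,
      ← hH1.biKolmogorov_graph hN, LinearPMap.mem_graph_iff]
  refine ⟨?_, ?_, hker, fun T hT => ?_⟩
  · simp only [hgen]
    exact hΓ.existsUnique_semigroup
  · have hone := Lp.coeFn_const 2 (BiKolmogorov.densityMeasure m) (1 : 𝕜)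
    obtain ⟨u, hu, hu0⟩ := (hker (Lp.const 2 (BiKolmogorov.densityMeasure m) (1 : 𝕜))).2 ⟨1, hone⟩
    refine ⟨u, fun h0 => ?_, hu0⟩
    rw [hu, Lp.eq_zero_iff_ae_eq_zero] at h0
    obtain ⟨x, h1, h2⟩ := (hone.and h0).exists
    rw [h1] at h2
    exact one_ne_zero h2
  · rw [hgen] at hT
    refine ⟨fun f t => ?_, hH1.tendsto_average hN hT, fun ν _ S hTS hS =>
      hH1.eq_of_invariant hN hT hTS hS⟩
    -- Integrals are inner products with the constant 1, which is in the kernel of L.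
    rw [← BiKolmogorov.integral_bddContToL2, BiKolmogorov.integral_eq_inner_const,
      BiKolmogorov.integral_eq_inner_const]
    exact BiKolmogorov.inner_op_eq hΓ hT (hH1.const_mem_closure hN) t _
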